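/- Let $d\ge 2$ be an integer, $\eta=e^{2\pi i/d}$, and regard $\mathbb C[x]$-bimodules as $\mathbb C[x,y]$-modules, $p\in\mathbb C[x]$ acting from the left by $p(x)$ and from the right by $p(y)$; give $x$ and $y$ the $\mathbb C$-degree $2/d$. A $\mathbb C$-graded matrix bifactorisation of $x^d$ is a $\mathbb Z_2$-graded free $\mathbb C[x,y]$-module $M=M_0\oplus M_1$ (possibly of infinite rank) with a compatible $\mathbb C$-grading on $M_0$ and $M_1$ and an odd $\mathbb C[x,y]$-linear map $d^M$ of $\mathbb C$-degree $1$ with $d^M\circ d^M=(x^d-y^d)\cdot\mathrm{id}_M$. These are the objects of the category $\mathrm{HMF}^{\mathrm{gr}}_{\mathrm{bi}}$. Its morphisms $M\to N$ are the even $\mathbb C[x,y]$-linear maps $f$ of $\mathbb C$-degree $0$ with $d^N f=f d^M$, modulo those of the form $d^N g+g d^M$ with $g:M\to N$ odd, $\mathbb C[x,y]$-linear and of $\mathbb C$-degree $-1$. The tensor product is $M\otimes_{\mathbb C[x]}N$ with twisted differential $d^M\otimes 1+1\otimes d^N$ (with Koszul sign) and additive degrees. For $S\subset\mathbb Z_d$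 let $\hat P_S$ be the graded matrix bifactorisation with $M_0=M_1=\mathbb C[x,y]$, $d_1=\prod_{j\in S}(x-\eta^jy):M_1\to M_0$, $d_0=\prod_{j\in\mathbb Z_d\setminus S}(x-\eta^jy):M_0\to M_1$, where $1\in M_0$ has degree $\frac{1-|S|}d$ and $1\in M_1$ has degree $\frac{1+|S|}d-1$. For $a\in\mathbb Z_d$ and $\lambda\in\{0,1,\dots,d-2\}$ put $\hat P_{a:\lambda}=\hat P_{\{a,a+1,\dots,a+\lambda\}}$, and let $\mathcal P_d^{\mathrm{gr}}$ be the full subcategory of $\mathrm{HMF}^{\mathrm{gr}}_{\mathrm{bi}}$ of all objects isomorphic to finite direct sums of the $\hat P_{a:\lambda}$. **Theorem.** The category $\mathcal P_d^{\mathrm{gr}}$ is semisimple (abelian, and every object is a finite direct sum of simple objects). Its simple objects are, up to isomorphism, exactly the $\hat P_{a:\lambda}$ with $a\in\mathbb Z_d$ and $\lambda\in\{0,1,\dots,d-2\}$, and these are pairwise non-isomorphic. The category $\mathcal P_d^{\mathrm{gr}}$ is closed under tensor products, and for $m,n\in\mathbb Z_d$ and $\lambda,\mu\in\{0,\dots,d-2\}$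 there is an isomorphism in $\mathrm{HMF}^{\mathrm{gr}}_{\mathrm{bi}}$ $$\hat P_{m:\lambda}\otimes\hat P_{n:\mu}\;\simeq\;\bigoplus_{\substack{\nu=|\lambda-\mu|\\ \text{step }2}}^{\min(\lambda+\mu,\,2d-4-\lambda-\mu)}\hat P_{\,m+n+\frac12(\lambda+\mu-\nu):\,\nu}\ .$$ -/

import Mathlib

open CategoryTheory
open scoped TensorProduct

noncomputable section

namespace BiMF

/-! ### The graded polynomial ring `ℂ[x, y]`

A bimodule over `S = ℂ[x]` is the same thing as a module over `S ⊗ S = ℂ[x, y]`: a polynomial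
`p ∈ ℂ[x]` acts from the left as `p(x)` and from the right as `p(y)`. -/

/-- `ℂ[x, y]`. -/
abbrev Poly : Type := MvPolynomial (Fin 2) ℂ

/-- The variable `x` (left action). -/
abbrev vx : Poly := MvPolynomial.X 0

/-- The variable `y` (right action). -/
abbrev vy : Poly := MvPolynomial.X 1

/-- The polynomials of `ℂ`-degree `q`, where `x` and `y` have degree `2 / d`. -/
def polyDeg (d : ℕ) (q : ℂ) : Submodule ℂ Poly :=
  MvPolynomial.weightedHomogeneousSubmodule ℂ (fun _ : Fin 2 => (2 / (d : ℂ))) q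

/-! ### Helper facts on gradings by `ℂ` -/

theorem isInternal_of_coaction {V : Type*} [AddCommGroup V] [Module ℂ V]
    (G : ℂ → Submodule ℂ V) (ρ : V →ₗ[ℂ] (ℂ →₀ V))
    (hρ : ∀ q, ∀ v ∈ G q, ρ v = Finsupp.single q v) (htop : ⨆ q, G q = ⊤) :
    DirectSum.IsInternal G := by
  refine ⟨?_, ?_⟩
  · have key : ∀ (f : DirectSum ℂ fun i => G i) (i : ℂ),
        ρ (DirectSum.coeAddMonoidHom G f) i = f i := by
      intro f i
      induction f using DirectSum.induction_on with
      | zero => simp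
      | of j v =>
        rw [DirectSum.coeAddMonoidHom_of, hρ j v v.2]
        by_cases h : j = i
        · subst h; simp
        · rw [Finsupp.single_eq_of_ne (Ne.symm h), DirectSum.of_eq_of_ne _ _ _ (Ne.symm h)]; rfl
      | add f g hf hg => simp [map_add, hf, hg]
    intro f g h
    refine DFinsupp.ext fun i => Subtype.ext ?_
    exact (key f i).symm.trans ((congrArg (fun v => ρ v i) h).trans (key g i))
  · have := (DirectSum.range_coeLinearMap (A := G)).trans htop
    exact LinearMap.range_eq_top.mp this

theorem exists_coaction {V : Type*} [AddCommGroup V] [Module ℂ V]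
    (G : ℂ → Submodule ℂ V) (h : DirectSum.IsInternal G) :
    ∃ ρ : V →ₗ[ℂ] (ℂ →₀ V), ∀ q, ∀ v ∈ G q, ρ v = Finsupp.single q v := by
  let e := LinearEquiv.ofBijective (DirectSum.coeLinearMap G) h
  let φ : (DirectSum ℂ fun i => G i) →ₗ[ℂ] (ℂ →₀ V) :=
    DirectSum.toModule ℂ ℂ _ fun q => Finsupp.lsingle q ∘ₗ (G q).subtype
  refine ⟨φ ∘ₗ e.symm.toLinearMap, fun q v hv => ?_⟩
  have h1 : e (DirectSum.lof ℂ ℂ (fun i => G i) q ⟨v, hv⟩) = v := by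
    exact DirectSum.coeLinearMap_lof G q ⟨v, hv⟩
  have h2 : e.symm v = DirectSum.lof ℂ ℂ (fun i => G i) q ⟨v, hv⟩ := by
    rw [LinearEquiv.symm_apply_eq]; exact h1.symm
  simp [φ, h2]

@[elab_as_elim]
theorem homogeneous_induction {V : Type*} [AddCommGroup V] [Module ℂ V]
    (G : ℂ → Submodule ℂ V) (h : DirectSum.IsInternal G) {P : V → Prop} (v : V)
    (hom : ∀ q, ∀ v ∈ G q, P v) (add : ∀ v w, P v → P w → P (v + w)) : P v :=
  Submodule.iSup_induction G (motive := P) (h.submodule_iSup_eq_top ▸ Submodule.mem_top) hom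
    (hom 0 0 (Submodule.zero_mem _)) add

/-! ### The balanced tensor product over `ℂ[x]` -/

section Balanced

set_option linter.unusedSectionVars false

variable (M N : Type*) [AddCommGroup M] [Module ℂ M] [Module Poly M] [IsScalarTower ℂ Poly M]
  [AddCommGroup N] [Module ℂ N] [Module Poly N] [IsScalarTower ℂ Poly N]

/-- The relations `m.x ⊗ n = m ⊗ x.n`; they imply `m.p ⊗ n = m ⊗ p.n` for all `p ∈ ℂ[x]`,
see `BTensor.balanced`. -/
def balRel : Submodule ℂ (M ⊗[ℂ] N) :=
  Submodule.span ℂ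
    (Set.range fun mn : M × N => (vy • mn.1) ⊗ₜ[ℂ] mn.2 - mn.1 ⊗ₜ[ℂ] (vx • mn.2))

/-- The tensor product `M ⊗_{ℂ[x]} N` of `ℂ[x]`-bimodules. -/
def BTensor : Type _ := (M ⊗[ℂ] N) ⧸ balRel M N

namespace BTensor

instance instAddCommGroup : AddCommGroup (BTensor M N) :=
  inferInstanceAs (AddCommGroup ((M ⊗[ℂ] N) ⧸ balRel M N))

instance instModuleComplex : Module ℂ (BTensor M N) :=
  inferInstanceAs (Module ℂ ((M ⊗[ℂ] N) ⧸ balRel M N))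

/-- The projection `M ⊗_ℂ N → M ⊗_{ℂ[x]} N`. -/
def mkQ : M ⊗[ℂ] N →ₗ[ℂ] BTensor M N := (balRel M N).mkQ

variable {M N}

/-- The class of a pure tensor. -/
def tmul (m : M) (n : N) : BTensor M N := mkQ M N (m ⊗ₜ n)

theorem mkQ_surjective : Function.Surjective (mkQ M N) := (balRel M N).mkQ_surjective

theorem mkQ_tmul (m : M) (n : N) : mkQ M N (m ⊗ₜ n) = tmul m n := rfl

theorem tmul_add (m : M) (n n' : N) : tmul m (n + n') = tmul m n + tmul m n' := by
  simp [tmul, TensorProduct.tmul_add]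

theorem add_tmul (m m' : M) (n : N) : tmul (m + m') n = tmul m n + tmul m' n := by
  simp [tmul, TensorProduct.add_tmul]

theorem smul_tmul_complex (c : ℂ) (m : M) (n : N) : tmul (c • m) n = c • tmul m n := by
  simp only [tmul, ← TensorProduct.smul_tmul', map_smul]

theorem tmul_smul_complex (c : ℂ) (m : M) (n : N) : tmul m (c • n) = c • tmul m n := by
  simp only [tmul, TensorProduct.tmul_smul, map_smul]

theorem smul_vy_tmul (m : M) (n : N) : tmul (vy • m) n = tmul m (vx • n) := by
  refine (Submodule.Quotient.eq _).mpr ?_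
  exact Submodule.subset_span ⟨(m, n), rfl⟩

theorem balanced (p : Polynomial ℂ) (m : M) (n : N) :
    tmul (Polynomial.aeval vy p • m) n = tmul m (Polynomial.aeval vx p • n) := by
  induction p using Polynomial.induction_on generalizing m n with
  | C a =>
    simp only [Polynomial.aeval_C, algebraMap_smul]
    rw [smul_tmul_complex, tmul_smul_complex]
  | add p q hp hq => simp only [map_add, add_smul, add_tmul, tmul_add, hp, hq]
  | monomial k a ih =>
    rw [pow_succ, ← mul_assoc, map_mul (Polynomial.aeval vy), map_mul (Polynomial.aeval vx),
      Polynomial.aeval_X, Polynomial.aeval_X, mul_smul, ih, smul_vy_tmul, smul_smul, mul_comm]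

@[elab_as_elim]
theorem induction_on {P : BTensor M N → Prop} (t : BTensor M N)
    (h1 : ∀ m n, P (tmul m n)) (h2 : ∀ s t, P s → P t → P (s + t)) : P t := by
  obtain ⟨t, rfl⟩ := mkQ_surjective t
  induction t with
  | zero => simpa [tmul] using h1 0 0
  | tmul m n => exact h1 m n
  | add s t hs ht => rw [map_add]; exact h2 _ _ hs ht

variable {V : Type*} [AddCommGroup V] [Module ℂ V]

/-- Descent of a balanced `ℂ`-linear map. -/
def lift (φ : M ⊗[ℂ] N →ₗ[ℂ] V)
    (h : ∀ m n, φ ((vy • m) ⊗ₜ n) = φ (m ⊗ₜ (vx • n))) : BTensor M N →ₗ[ℂ] V :=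
  (balRel M N).liftQ φ (by
    rw [balRel, Submodule.span_le]
    rintro _ ⟨⟨m, n⟩, rfl⟩
    simp [h m n])

theorem lift_mkQ (φ : M ⊗[ℂ] N →ₗ[ℂ] V)
    (h : ∀ m n, φ ((vy • m) ⊗ₜ n) = φ (m ⊗ₜ (vx • n))) (t : M ⊗[ℂ] N) :
    lift φ h (mkQ M N t) = φ t := rfl

theorem lift_tmul (φ : M ⊗[ℂ] N →ₗ[ℂ] V)
    (h : ∀ m n, φ ((vy • m) ⊗ₜ n) = φ (m ⊗ₜ (vx • n))) (m : M) (n : N) :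
    lift φ h (tmul m n) = φ (m ⊗ₜ n) := rfl

theorem ext_lin {f g : BTensor M N →ₗ[ℂ] V} (h : ∀ m n, f (tmul m n) = g (tmul m n)) :
    f = g := by
  ext t
  induction t using induction_on with
  | h1 m n => exact h m n
  | h2 s t hs ht => rw [map_add, map_add, hs, ht]

variable {M' N' : Type*} [AddCommGroup M'] [Module ℂ M'] [Module Poly M']
  [IsScalarTower ℂ Poly M'] [AddCommGroup N'] [Module ℂ N'] [Module Poly N']
  [IsScalarTower ℂ Poly N']

/-- The `ℂ`-linear map underlying `f ⊗ g`. -/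
def mapC (f : M →ₗ[Poly] M') (g : N →ₗ[Poly] N') : BTensor M N →ₗ[ℂ] BTensor M' N' :=
  lift (mkQ M' N' ∘ₗ TensorProduct.map (f.restrictScalars ℂ) (g.restrictScalars ℂ)) (by
    intro m n
    simp [mkQ_tmul, smul_vy_tmul])

theorem mapC_tmul (f : M →ₗ[Poly] M') (g : N →ₗ[Poly] N') (m : M) (n : N) :
    mapC f g (tmul m n) = tmul (f m) (g n) := rfl

variable (M N) in
/-- The left action of `x`, through `M`. -/
def opL : Module.End ℂ (BTensor M N) := mapC (LinearMap.lsmul Poly M vx) LinearMap.id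

variable (M N) in
/-- The right action of `x`, through `N`. -/
def opR : Module.End ℂ (BTensor M N) := mapC LinearMap.id (LinearMap.lsmul Poly N vy)

theorem opL_tmul (m : M) (n : N) : opL M N (tmul m n) = tmul (vx • m) n := rfl

theorem opR_tmul (m : M) (n : N) : opR M N (tmul m n) = tmul m (vy • n) := rfl

theorem op_comm : Commute (opL M N) (opR M N) := by
  refine ext_lin fun m n => ?_
  simp [opL_tmul, opR_tmul]

theorem commute_aeval {A : Type*} [Ring A] [Algebra ℂ A] {a b : A} (h : Commute a b)
    (p q : Polynomial ℂ) : Commute (Polynomial.aeval a p) (Polynomial.aeval b q) := by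
  have h1 : ∀ c : A, Commute a c → Commute (Polynomial.aeval a p) c := by
    intro c hc
    induction p using Polynomial.induction_on' with
    | add p q hp hq => rw [map_add]; exact hp.add_left hq
    | monomial n r =>
      rw [Polynomial.aeval_monomial]
      exact Commute.mul_left (Algebra.commutes r c) (hc.pow_left n)
  refine h1 _ ?_
  induction q using Polynomial.induction_on' with
  | add p q hp hq => rw [map_add]; exact hp.add_right hq
  | monomial n r =>
    rw [Polynomial.aeval_monomial]
    exact Commute.mul_right (Algebra.commutes r a).symm (h.pow_right n)

variable (M N) in
/-- `ℂ[x, y]` acts with `x` as the left action and `y` as the right action of `ℂ[x]`. -/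
def action : Poly →ₐ[ℂ] Module.End ℂ (BTensor M N) :=
  (Algebra.TensorProduct.lift (Polynomial.aeval (opL M N)) (Polynomial.aeval (opR M N))
    (fun p q => commute_aeval op_comm p q)).comp
    (MvPolynomial.aeval ![Polynomial.X ⊗ₜ[ℂ] (1 : Polynomial ℂ),
      (1 : Polynomial ℂ) ⊗ₜ[ℂ] Polynomial.X])

theorem action_vx : action M N vx = opL M N := by simp [action]

theorem action_vy : action M N vy = opR M N := by simp [action]

instance instModulePoly : Module Poly (BTensor M N) :=
  Module.compHom (BTensor M N) (action M N).toRingHom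

theorem smul_def (p : Poly) (t : BTensor M N) : p • t = action M N p t := rfl

instance instIsScalarTower : IsScalarTower ℂ Poly (BTensor M N) where
  smul_assoc c p t := by
    rw [smul_def, smul_def, map_smul]; rfl

theorem vx_smul_tmul (m : M) (n : N) : vx • tmul m n = tmul (vx • m) n := by
  rw [smul_def, action_vx, opL_tmul]

theorem vy_smul_tmul (m : M) (n : N) : vy • tmul m n = tmul m (vy • n) := by
  rw [smul_def, action_vy, opR_tmul]

theorem monomial_smul_tmul (s : Fin 2 →₀ ℕ) (c : ℂ) (m : M) (n : N) :
    MvPolynomial.monomial s c • tmul m n = c • tmul (vx ^ s 0 • m) (vy ^ s 1 • n) := by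
  have hx : ∀ (k : ℕ) (m : M) (n : N), vx ^ k • tmul m n = tmul (vx ^ k • m) n := by
    intro k
    induction k with
    | zero => simp
    | succ k ih => intro m n; rw [pow_succ, mul_smul, vx_smul_tmul, ih, smul_smul]
  have hy : ∀ (k : ℕ) (m : M) (n : N), vy ^ k • tmul m n = tmul m (vy ^ k • n) := by
    intro k
    induction k with
    | zero => simp
    | succ k ih => intro m n; rw [pow_succ, mul_smul, vy_smul_tmul, ih, smul_smul]
  rw [MvPolynomial.monomial_eq, Finsupp.prod_fintype _ _ (by simp), Fin.prod_univ_two, mul_smul,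
    mul_smul, hy, hx, ← MvPolynomial.algebraMap_eq, algebraMap_smul]

theorem mapC_smul (f : M →ₗ[Poly] M') (g : N →ₗ[Poly] N') (p : Poly) (t : BTensor M N) :
    mapC f g (p • t) = p • mapC f g t := by
  induction t using induction_on with
  | h2 s t hs ht => rw [smul_add, map_add, hs, ht, map_add, smul_add]
  | h1 m n =>
    induction p using MvPolynomial.induction_on' with
    | add p q hp hq => rw [add_smul, map_add, hp, hq, add_smul]
    | monomial s c =>
      rw [monomial_smul_tmul, map_smul, mapC_tmul, mapC_tmul, monomial_smul_tmul, map_smul,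
        map_smul]

/-- The tensor product `f ⊗ g` of bimodule maps. -/
def map (f : M →ₗ[Poly] M') (g : N →ₗ[Poly] N') : BTensor M N →ₗ[Poly] BTensor M' N' where
  toFun := mapC f g
  map_add' := map_add _
  map_smul' p t := mapC_smul f g p t

theorem map_tmul (f : M →ₗ[Poly] M') (g : N →ₗ[Poly] N') (m : M) (n : N) :
    map f g (tmul m n) = tmul (f m) (g n) := rfl

theorem ext_poly {W : Type*} [AddCommGroup W] [Module Poly W]
    {f g : BTensor M N →ₗ[Poly] W} (h : ∀ m n, f (tmul m n) = g (tmul m n)) : f = g := by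
  ext t
  induction t using induction_on with
  | h1 m n => exact h m n
  | h2 s t hs ht => rw [map_add, map_add, hs, ht]

/-- The exponent `s` as a monomial. -/
abbrev mon (s : Fin 2 →₀ ℕ) : Poly := MvPolynomial.monomial s 1

theorem mon_eq (s : Fin 2 →₀ ℕ) : mon s = vx ^ s 0 * vy ^ s 1 := by
  rw [mon, MvPolynomial.monomial_eq, Finsupp.prod_fintype _ _ (by simp), Fin.prod_univ_two]
  simp

theorem pow_vy_tmul (k : ℕ) (m : M) (n : N) : tmul (vy ^ k • m) n = tmul m (vx ^ k • n) := by
  simpa using balanced (Polynomial.X ^ k) m n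

theorem mon_tmul_mon (s t : Fin 2 →₀ ℕ) (m : M) (n : N) :
    tmul (mon s • m) (mon t • n) =
      (vx ^ s 0 * vy ^ t 1) • tmul m (vx ^ (s 1 + t 0) • n) := by
  have h : (vx ^ s 0 * vy ^ t 1 : Poly) =
      mon (Finsupp.single 0 (s 0) + Finsupp.single 1 (t 1)) := by
    rw [mon_eq]; simp
  rw [h, monomial_smul_tmul, mon_eq, mon_eq, mul_comm (vx ^ s 0), mul_smul, pow_vy_tmul]
  simp only [Finsupp.coe_add, Pi.add_apply, Finsupp.single_eq_same, ne_eq, zero_ne_one,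
    not_false_eq_true, Finsupp.single_eq_of_ne, add_zero, one_ne_zero, zero_add, one_smul,
    smul_smul]
  congr 2
  ring

/-- The tensor product of free bimodules is free (of infinite rank in general): if `M` and `N`
have bases `(e_i)` and `(f_j)`, then the elements `e_i ⊗ x ^ k • f_j` form a basis. -/
instance instFree [Module.Free Poly M] [Module.Free Poly N] :
    Module.Free Poly (BTensor M N) := by
  classical
  let e := Module.Free.chooseBasis Poly M
  let f := Module.Free.chooseBasis Poly N
  let I := Module.Free.ChooseBasisIndex Poly M
  let J := Module.Free.ChooseBasisIndex Poly N
  let F := (I × J × ℕ) →₀ Poly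
  let bM := (MvPolynomial.basisMonomials (Fin 2) ℂ).smulTower e
  let bN := (MvPolynomial.basisMonomials (Fin 2) ℂ).smulTower f
  have hbM : ∀ s i, bM (s, i) = mon s • e i := by
    intro s i; simp [bM, Module.Basis.smulTower_apply]
  have hbN : ∀ s j, bN (s, j) = mon s • f j := by
    intro s j; simp [bN, Module.Basis.smulTower_apply]
  let θ : F →ₗ[Poly] BTensor M N :=
    Finsupp.linearCombination Poly fun ijk : I × J × ℕ =>
      tmul (e ijk.1) (vx ^ ijk.2.2 • f ijk.2.1)
  have hθ : ∀ i j k p, θ (Finsupp.single (i, j, k) p) = p • tmul (e i) (vx ^ k • f j) := by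
    intro i j k p
    exact Finsupp.linearCombination_single Poly p (i, j, k)
  let val : ((Fin 2 →₀ ℕ) × I) × ((Fin 2 →₀ ℕ) × J) → F := fun u =>
    Finsupp.single (u.1.2, u.2.2, u.1.1 1 + u.2.1 0) (vx ^ u.1.1 0 * vy ^ u.2.1 1)
  let φ₀ : M ⊗[ℂ] N →ₗ[ℂ] F := (bM.tensorProduct bN).constr ℂ val
  have hφ₀ : ∀ s i t j, φ₀ ((mon s • e i) ⊗ₜ (mon t • f j)) =
      Finsupp.single (i, j, s 1 + t 0) (vx ^ s 0 * vy ^ t 1) := by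
    intro s i t j
    rw [← hbM, ← hbN, ← Module.Basis.tensorProduct_apply, Module.Basis.constr_basis]
  have hbal : ∀ m n, φ₀ ((vy • m) ⊗ₜ n) = φ₀ (m ⊗ₜ (vx • n)) := by
    have h : (φ₀ ∘ₗ TensorProduct.map ((LinearMap.lsmul Poly M vy).restrictScalars ℂ)
        LinearMap.id) = (φ₀ ∘ₗ TensorProduct.map LinearMap.id
          ((LinearMap.lsmul Poly N vx).restrictScalars ℂ)) := by
      refine (bM.tensorProduct bN).ext ?_
      rintro ⟨⟨s, i⟩, ⟨t, j⟩⟩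
      have h1 : vy • mon s • e i = mon (s + Finsupp.single 1 1) • e i := by
        rw [smul_smul, mon_eq, mon_eq]; congr 1; simp; ring
      have h2 : vx • mon t • f j = mon (t + Finsupp.single 0 1) • f j := by
        rw [smul_smul, mon_eq, mon_eq]; congr 1; simp; ring
      rw [Module.Basis.tensorProduct_apply, hbM, hbN]
      simp only [LinearMap.comp_apply, TensorProduct.map_tmul, LinearMap.id_apply,
        LinearMap.restrictScalars_apply, LinearMap.lsmul_apply]
      have e1 : (s + Finsupp.single 1 1 : Fin 2 →₀ ℕ) 1 + t 0 =
          s 1 + (t + Finsupp.single 0 1 : Fin 2 →₀ ℕ) 0 := by simp; omega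
      have e2 : (s + Finsupp.single 1 1 : Fin 2 →₀ ℕ) 0 = s 0 := by simp
      have e3 : (t + Finsupp.single 0 1 : Fin 2 →₀ ℕ) 1 = t 1 := by simp
      rw [h1, h2, hφ₀, hφ₀, e1, e2, e3]
    intro m n
    simpa using LinearMap.congr_fun h (m ⊗ₜ n)
  let φ : BTensor M N →ₗ[ℂ] F := lift φ₀ hbal
  have hθφ : ∀ t, θ (φ t) = t := by
    have h : (θ.restrictScalars ℂ ∘ₗ φ) ∘ₗ mkQ M N = mkQ M N := by
      refine (bM.tensorProduct bN).ext ?_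
      rintro ⟨⟨s, i⟩, ⟨t, j⟩⟩
      rw [Module.Basis.tensorProduct_apply, hbM, hbN]
      simp only [LinearMap.comp_apply, LinearMap.restrictScalars_apply]
      rw [lift_mkQ, hφ₀, mkQ_tmul, mon_tmul_mon, hθ]
    intro t
    obtain ⟨t, rfl⟩ := mkQ_surjective t
    exact LinearMap.congr_fun h t
  have hφθ : ∀ u, φ (θ u) = u := by
    intro u
    induction u using Finsupp.induction_linear with
    | zero => simp
    | add u v hu hv => rw [map_add, map_add, hu, hv]
    | single a p =>
      obtain ⟨i, j, k⟩ := a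
      induction p using MvPolynomial.induction_on' with
      | add p q hp hq => rw [Finsupp.single_add, map_add, map_add, hp, hq]
      | monomial s c =>
        have h1 : θ (Finsupp.single (i, j, k) (MvPolynomial.monomial s c)) =
            c • tmul (mon (Finsupp.single 0 (s 0)) • e i)
              (mon (Finsupp.single 0 k + Finsupp.single 1 (s 1)) • f j) := by
          rw [mon_tmul_mon]
          have h2 : MvPolynomial.monomial s c = c • (vx ^ s 0 * vy ^ s 1) := by
            rw [← mon_eq, mon, MvPolynomial.smul_monomial]; simp
          rw [hθ, h2, smul_assoc]
          simp
        rw [h1, map_smul]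
        have h3 : φ (tmul (mon (Finsupp.single 0 (s 0)) • e i)
              (mon (Finsupp.single 0 k + Finsupp.single 1 (s 1)) • f j)) = _ := hφ₀ _ _ _ _
        rw [h3, Finsupp.smul_single]
        have h2 : MvPolynomial.monomial s c = c • (vx ^ s 0 * vy ^ s 1) := by
          rw [← mon_eq, mon, MvPolynomial.smul_monomial]; simp
        simp [h2]
  exact Module.Free.of_equiv (LinearEquiv.ofBijective θ
    ⟨Function.LeftInverse.injective (g := φ) hφθ, fun t => ⟨φ t, hθφ t⟩⟩)

/-- Elements of degree `q` of the tensor product: the degree is additive on pure tensors. -/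
def deg (GM : ℂ → Submodule ℂ M) (GN : ℂ → Submodule ℂ N) (q : ℂ) :
    Submodule ℂ (BTensor M N) :=
  Submodule.span ℂ {t | ∃ a b : ℂ, ∃ m ∈ GM a, ∃ n ∈ GN b, a + b = q ∧ t = tmul m n}

theorem deg_isInternal {c : ℂ} {GM : ℂ → Submodule ℂ M} {GN : ℂ → Submodule ℂ N}
    (hM : DirectSum.IsInternal GM) (hN : DirectSum.IsInternal GN)
    (hy : ∀ q, ∀ m ∈ GM q, vy • m ∈ GM (c + q)) (hx : ∀ q, ∀ n ∈ GN q, vx • n ∈ GN (c + q)) :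
    DirectSum.IsInternal (deg GM GN) := by
  obtain ⟨ρM, hρM⟩ := exists_coaction GM hM
  obtain ⟨ρN, hρN⟩ := exists_coaction GN hN
  let β : (ℂ →₀ M) →ₗ[ℂ] (ℂ →₀ N) →ₗ[ℂ] (ℂ →₀ BTensor M N) :=
    Finsupp.lsum ℂ fun a => LinearMap.flip (Finsupp.lsum ℂ fun b =>
      LinearMap.flip (((TensorProduct.mk ℂ M N).compr₂ (mkQ M N)).compr₂
        (Finsupp.lsingle (a + b))))
  have hβ : ∀ a b m n, β (Finsupp.single a m) (Finsupp.single b n) =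
      Finsupp.single (a + b) (tmul m n) := by
    intro a b m n
    simp [β, mkQ_tmul]
  let ρ₀ : M ⊗[ℂ] N →ₗ[ℂ] (ℂ →₀ BTensor M N) :=
    TensorProduct.lift (β.compl₁₂ ρM ρN)
  have hρ₀ : ∀ a, ∀ m ∈ GM a, ∀ b, ∀ n ∈ GN b,
      ρ₀ (m ⊗ₜ n) = Finsupp.single (a + b) (tmul m n) := by
    intro a m hm b n hn
    simp [ρ₀, hρM a m hm, hρN b n hn, hβ]
  have hbal : ∀ m n, ρ₀ ((vy • m) ⊗ₜ n) = ρ₀ (m ⊗ₜ (vx • n)) := by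
    intro m n
    induction m using homogeneous_induction GM hM with
    | add m m' h h' => rw [smul_add, TensorProduct.add_tmul, TensorProduct.add_tmul, map_add,
        map_add, h, h']
    | hom a m hm =>
      induction n using homogeneous_induction GN hN with
      | add n n' h h' => rw [smul_add, TensorProduct.tmul_add, TensorProduct.tmul_add, map_add,
          map_add, h, h']
      | hom b n hn =>
        rw [hρ₀ _ _ (hy a m hm) _ _ hn, hρ₀ _ _ hm _ _ (hx b n hn), smul_vy_tmul]
        congr 1; ring
  refine isInternal_of_coaction _ (lift ρ₀ hbal) ?_ ?_
  · intro q v hv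
    induction hv using Submodule.span_induction with
    | mem t ht =>
      obtain ⟨a, b, m, hm, n, hn, rfl, rfl⟩ := ht
      rw [lift_tmul, hρ₀ _ _ hm _ _ hn]
    | zero => simp
    | add s t _ _ hs ht => rw [map_add, hs, ht, Finsupp.single_add]
    | smul c t _ ht => rw [map_smul, ht, Finsupp.smul_single]
  · rw [eq_top_iff]
    rintro t -
    induction t using induction_on with
    | h2 s t hs ht => exact Submodule.add_mem _ hs ht
    | h1 m n =>
      induction m using homogeneous_induction GM hM with
      | add m m' h h' => rw [add_tmul]; exact Submodule.add_mem _ h h'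
      | hom a m hm =>
        induction n using homogeneous_induction GN hN with
        | add n n' h h' => rw [tmul_add]; exact Submodule.add_mem _ h h'
        | hom b n hn =>
          exact Submodule.mem_iSup_of_mem (a + b)
            (Submodule.subset_span ⟨a, b, m, hm, n, hn, rfl, rfl⟩)

end BTensor

end Balanced

/-! ### Graded free bimodules -/

theorem smul_mem_of_vars {d : ℕ} {V : Type*} [AddCommGroup V] [Module ℂ V] [Module Poly V]
    [IsScalarTower ℂ Poly V] (G : ℂ → Submodule ℂ V)
    (hx : ∀ q, ∀ m ∈ G q, vx • m ∈ G (2 / (d : ℂ) + q))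
    (hy : ∀ q, ∀ m ∈ G q, vy • m ∈ G (2 / (d : ℂ) + q))
    (a b : ℂ) (p : Poly) (hp : p ∈ polyDeg d a) (m : V) (hm : m ∈ G b) :
    p • m ∈ G (a + b) := by
  have hx' : ∀ (k : ℕ) (q : ℂ), ∀ m ∈ G q, vx ^ k • m ∈ G (k * (2 / (d : ℂ)) + q) := by
    intro k
    induction k with
    | zero => intro q m hm; simpa using hm
    | succ k ih =>
      intro q m hm
      have := hx _ _ (ih q m hm)
      rw [smul_smul, ← pow_succ'] at this
      convert this using 2
      push_cast; ring
  have hy' : ∀ (k : ℕ) (q : ℂ), ∀ m ∈ G q, vy ^ k • m ∈ G (k * (2 / (d : ℂ)) + q) := by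
    intro k
    induction k with
    | zero => intro q m hm; simpa using hm
    | succ k ih =>
      intro q m hm
      have := hy _ _ (ih q m hm)
      rw [smul_smul, ← pow_succ'] at this
      convert this using 2
      push_cast; ring
  rw [← MvPolynomial.support_sum_monomial_coeff p, Finset.sum_smul]
  refine Submodule.sum_mem _ fun s hs => ?_
  have hw := hp (MvPolynomial.mem_support_iff.mp hs)
  rw [Finsupp.weight_apply, Finsupp.sum_fintype _ _ (by simp),
    Fin.sum_univ_two] at hw
  rw [MvPolynomial.monomial_eq, Finsupp.prod_fintype _ _ (by simp), Fin.prod_univ_two,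
    ← MvPolynomial.algebraMap_eq, mul_smul, algebraMap_smul, mul_smul]
  refine Submodule.smul_mem _ _ ?_
  have := hx' (s 0) _ _ (hy' (s 1) b m hm)
  convert this using 2
  rw [← hw]
  simp only [nsmul_eq_mul]
  ring

/-- A `ℂ`-graded free `ℂ[x]`-bimodule, i.e. a `ℂ[x, y]`-module that is free (of possibly
infinite rank) and carries a `ℂ`-grading which is compatible with the action, where
`x` and `y` have degree `2 / d`. -/
structure GrBimod (d : ℕ) : Type 1 where
  carrier : Type
  [addCommGroup : AddCommGroup carrier]
  [moduleComplex : Module ℂ carrier]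
  [modulePoly : Module Poly carrier]
  [isScalarTower : IsScalarTower ℂ Poly carrier]
  [free : Module.Free Poly carrier]
  /-- The homogeneous elements of a given degree. -/
  deg : ℂ → Submodule ℂ carrier
  isInternal : DirectSum.IsInternal deg
  smul_mem : ∀ (a b : ℂ) (p : Poly), p ∈ polyDeg d a → ∀ m : carrier, m ∈ deg b →
    p • m ∈ deg (a + b)

namespace GrBimod

variable {d : ℕ}

instance : CoeSort (GrBimod d) Type := ⟨carrier⟩

attribute [instance] addCommGroup moduleComplex modulePoly isScalarTower free

theorem vx_mem_polyDeg (d : ℕ) : vx ∈ polyDeg d (2 / (d : ℂ)) :=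
  MvPolynomial.isWeightedHomogeneous_X ℂ _ _

theorem vy_mem_polyDeg (d : ℕ) : vy ∈ polyDeg d (2 / (d : ℂ)) :=
  MvPolynomial.isWeightedHomogeneous_X ℂ _ _

theorem polyDeg_isInternal (d : ℕ) : DirectSum.IsInternal (polyDeg d) :=
  letI : DirectSum.Decomposition (polyDeg d) :=
    MvPolynomial.weightedDecomposition ℂ (fun _ : Fin 2 => (2 / (d : ℂ)))
  DirectSum.Decomposition.isInternal (polyDeg d)

/-- `ℂ[x, y]{α}`: the free bimodule of rank one whose generator `1` has degree `α`. -/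
abbrev shift (d : ℕ) (α : ℂ) : GrBimod d where
  carrier := Poly
  deg q := polyDeg d (q - α)
  isInternal := by
    obtain ⟨ρ, hρ⟩ := exists_coaction _ (polyDeg_isInternal d)
    refine isInternal_of_coaction _ (Finsupp.lmapDomain Poly ℂ (fun q => q + α) ∘ₗ ρ) ?_ ?_
    · intro q v hv
      rw [LinearMap.comp_apply, hρ _ v hv, Finsupp.lmapDomain_apply, Finsupp.mapDomain_single,
        sub_add_cancel]
    · rw [eq_top_iff]
      rintro t -
      induction t using homogeneous_induction _ (polyDeg_isInternal d) with
      | hom q v hv => exact Submodule.mem_iSup_of_mem (q + α) (by simpa using hv)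
      | add v w hv hw => exact Submodule.add_mem _ hv hw
  smul_mem a b p hp m hm := by
    have := MvPolynomial.IsWeightedHomogeneous.mul hp hm
    rwa [← add_sub_assoc] at this

/-- The direct sum of two graded bimodules. -/
abbrev prod (M N : GrBimod d) : GrBimod d where
  carrier := M × N
  deg q := (M.deg q).prod (N.deg q)
  isInternal := by
    obtain ⟨ρM, hρM⟩ := exists_coaction _ M.isInternal
    obtain ⟨ρN, hρN⟩ := exists_coaction _ N.isInternal
    refine isInternal_of_coaction _
      (LinearMap.coprod (Finsupp.mapRange.linearMap (LinearMap.inl ℂ M N) ∘ₗ ρM)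
        (Finsupp.mapRange.linearMap (LinearMap.inr ℂ M N) ∘ₗ ρN)) ?_ ?_
    · rintro q ⟨m, n⟩ ⟨hm, hn⟩
      rw [LinearMap.coprod_apply, LinearMap.comp_apply, LinearMap.comp_apply, hρM q m hm,
        hρN q n hn, Finsupp.mapRange.linearMap_apply, Finsupp.mapRange.linearMap_apply,
        Finsupp.mapRange_single, Finsupp.mapRange_single, ← Finsupp.single_add]
      simp
    · rw [eq_top_iff]
      rintro ⟨m, n⟩ -
      have h : (m, n) = LinearMap.inl ℂ M N m + LinearMap.inr ℂ M N n := by simp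
      rw [h]
      clear h
      refine Submodule.add_mem _ ?_ ?_
      · induction m using homogeneous_induction _ M.isInternal with
        | hom q v hv => exact Submodule.mem_iSup_of_mem q ⟨hv, Submodule.zero_mem _⟩
        | add v w hv hw => rw [map_add]; exact Submodule.add_mem _ hv hw
      · induction n using homogeneous_induction _ N.isInternal with
        | hom q v hv => exact Submodule.mem_iSup_of_mem q ⟨Submodule.zero_mem _, hv⟩
        | add v w hv hw => rw [map_add]; exact Submodule.add_mem _ hv hw
  smul_mem a b p hp m hm := ⟨M.smul_mem a b p hp _ hm.1, N.smul_mem a b p hp _ hm.2⟩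

/-- The tensor product `M ⊗_{ℂ[x]} N`, with the total degree. -/
abbrev tensor (M N : GrBimod d) : GrBimod d where
  carrier := BTensor M N
  deg := BTensor.deg M.deg N.deg
  isInternal := BTensor.deg_isInternal M.isInternal N.isInternal
    (fun q m hm => M.smul_mem _ q vy (vy_mem_polyDeg d) m hm)
    (fun q n hn => N.smul_mem _ q vx (vx_mem_polyDeg d) n hn)
  smul_mem := by
    refine smul_mem_of_vars _ ?_ ?_
    · intro q t ht
      induction ht using Submodule.span_induction with
      | mem t ht =>
        obtain ⟨a, b, m, hm, n, hn, rfl, rfl⟩ := ht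
        rw [BTensor.vx_smul_tmul]
        exact Submodule.subset_span
          ⟨_, b, _, M.smul_mem _ a vx (vx_mem_polyDeg d) m hm, n, hn, by ring, rfl⟩
      | zero => rw [smul_zero]; exact Submodule.zero_mem _
      | add s t _ _ hs ht => rw [smul_add]; exact Submodule.add_mem _ hs ht
      | smul c t _ ht => rw [smul_comm]; exact Submodule.smul_mem _ _ ht
    · intro q t ht
      induction ht using Submodule.span_induction with
      | mem t ht =>
        obtain ⟨a, b, m, hm, n, hn, rfl, rfl⟩ := ht
        rw [BTensor.vy_smul_tmul]
        exact Submodule.subset_span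
          ⟨a, _, m, hm, _, N.smul_mem _ b vy (vy_mem_polyDeg d) n hn, by ring, rfl⟩
      | zero => rw [smul_zero]; exact Submodule.zero_mem _
      | add s t _ _ hs ht => rw [smul_add]; exact Submodule.add_mem _ hs ht
      | smul c t _ ht => rw [smul_comm]; exact Submodule.smul_mem _ _ ht

/-- A bimodule map is homogeneous of degree `c`. -/
def HasDegree {M N : GrBimod d} (c : ℂ) (f : M →ₗ[Poly] N) : Prop :=
  ∀ q : ℂ, ∀ m : M, m ∈ M.deg q → f m ∈ N.deg (q + c)

end GrBimod

/-! ### Graded matrix bifactorisations of `x ^ d` -/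

/-- A `ℂ`-graded matrix bifactorisation of `W = x ^ d` over `ℂ[x]`: a `ℤ/2`-graded free bimodule
`M = M₀ ⊕ M₁` with an odd twisted differential of `ℂ`-degree `1` that squares to the
map `m ↦ W.m - m.W`. -/
structure GrMF (d : ℕ) : Type 1 where
  M0 : GrBimod d
  M1 : GrBimod d
  d1 : M1 →ₗ[Poly] M0
  d0 : M0 →ₗ[Poly] M1
  d1_d0 : ∀ m : M0, d1 (d0 m) = (vx ^ d - vy ^ d) • m
  d0_d1 : ∀ m : M1, d0 (d1 m) = (vx ^ d - vy ^ d) • m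
  deg_d1 : GrBimod.HasDegree 1 d1
  deg_d0 : GrBimod.HasDegree 1 d0

namespace GrMF

variable {d : ℕ}

/-- The even morphisms `(f₀, f₁)` of `ℂ`-degree `0` that commute with the twisted
differentials. -/
def cycles (M N : GrMF d) : Submodule ℂ ((M.M0 →ₗ[Poly] N.M0) × (M.M1 →ₗ[Poly] N.M1)) where
  carrier := {f | (∀ q, ∀ m ∈ M.M0.deg q, f.1 m ∈ N.M0.deg q) ∧
    (∀ q, ∀ m ∈ M.M1.deg q, f.2 m ∈ N.M1.deg q) ∧
    f.1 ∘ₗ M.d1 = N.d1 ∘ₗ f.2 ∧ f.2 ∘ₗ M.d0 = N.d0 ∘ₗ f.1}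
  zero_mem' := ⟨fun _ _ _ => Submodule.zero_mem _, fun _ _ _ => Submodule.zero_mem _,
    by simp, by simp⟩
  add_mem' := by
    rintro f g ⟨f1, f2, f3, f4⟩ ⟨g1, g2, g3, g4⟩
    refine ⟨fun q m hm => Submodule.add_mem _ (f1 q m hm) (g1 q m hm),
      fun q m hm => Submodule.add_mem _ (f2 q m hm) (g2 q m hm), ?_, ?_⟩
    · simp only [Prod.fst_add, Prod.snd_add, LinearMap.add_comp, LinearMap.comp_add, f3, g3]
    · simp only [Prod.fst_add, Prod.snd_add, LinearMap.add_comp, LinearMap.comp_add, f4, g4]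
  smul_mem' := by
    rintro c f ⟨f1, f2, f3, f4⟩
    refine ⟨fun q m hm => Submodule.smul_mem _ c (f1 q m hm),
      fun q m hm => Submodule.smul_mem _ c (f2 q m hm), ?_, ?_⟩
    · ext m
      have := LinearMap.congr_fun f3 m
      simp only [LinearMap.comp_apply] at this
      simp only [Prod.smul_fst, Prod.smul_snd, LinearMap.comp_apply, LinearMap.smul_apply, this]
      rw [← algebraMap_smul Poly c, ← algebraMap_smul Poly c, map_smul]
    · ext m
      have := LinearMap.congr_fun f4 m
      simp only [LinearMap.comp_apply] at this
      simp only [Prod.smul_fst, Prod.smul_snd, LinearMap.comp_apply, LinearMap.smul_apply, this]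
      rw [← algebraMap_smul Poly c, ← algebraMap_smul Poly c, map_smul]

/-- The category `ZMF^gr_bi`: morphisms are the cycles of degree zero. -/
instance : Category (GrMF d) where
  Hom M N := cycles M N
  id M := ⟨(LinearMap.id, LinearMap.id), fun _ _ h => h, fun _ _ h => h, rfl, rfl⟩
  comp f g := ⟨(g.1.1 ∘ₗ f.1.1, g.1.2 ∘ₗ f.1.2),
    fun q m hm => g.2.1 q _ (f.2.1 q m hm), fun q m hm => g.2.2.1 q _ (f.2.2.1 q m hm),
    by rw [LinearMap.comp_assoc, f.2.2.2.1, ← LinearMap.comp_assoc, g.2.2.2.1,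
      LinearMap.comp_assoc],
    by rw [LinearMap.comp_assoc, f.2.2.2.2, ← LinearMap.comp_assoc, g.2.2.2.2,
      LinearMap.comp_assoc]⟩

instance : Preadditive (GrMF d) where
  homGroup M N := inferInstanceAs (AddCommGroup (cycles M N))
  add_comp _ _ _ _ _ _ := Subtype.ext (Prod.ext (LinearMap.comp_add _ _ _)
    (LinearMap.comp_add _ _ _))
  comp_add _ _ _ _ _ _ := Subtype.ext (Prod.ext (LinearMap.add_comp _ _ _)
    (LinearMap.add_comp _ _ _))

/-- Two morphisms are homotopic if their difference is `δ(h) = d h + h d` for an odd bimodule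
map `h = (h₀, h₁)` of `ℂ`-degree `-1`. -/
def Homotopic : HomRel (GrMF d) := fun M N f g =>
  ∃ (h0 : M.M0 →ₗ[Poly] N.M1) (h1 : M.M1 →ₗ[Poly] N.M0),
    GrBimod.HasDegree (-1) h0 ∧ GrBimod.HasDegree (-1) h1 ∧
    f.1.1 - g.1.1 = N.d1 ∘ₗ h0 + h1 ∘ₗ M.d0 ∧
    f.1.2 - g.1.2 = N.d0 ∘ₗ h1 + h0 ∘ₗ M.d1

theorem homotopic_zero_iff {M N : GrMF d} (f g : M ⟶ N) :
    Homotopic f g ↔ Homotopic (f - g) 0 := by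
  constructor
  · rintro ⟨h0, h1, a, b, c, e⟩
    exact ⟨h0, h1, a, b, (sub_zero _).trans c, (sub_zero _).trans e⟩
  · rintro ⟨h0, h1, a, b, c, e⟩
    exact ⟨h0, h1, a, b, (sub_zero _).symm.trans c, (sub_zero _).symm.trans e⟩

theorem Homotopic.zero (M N : GrMF d) : Homotopic (0 : M ⟶ N) 0 :=
  ⟨0, 0, fun _ _ _ => Submodule.zero_mem _, fun _ _ _ => Submodule.zero_mem _,
    (sub_self _).trans (by simp), (sub_self _).trans (by simp)⟩

theorem Homotopic.add {M N : GrMF d} {f f' g g' : M ⟶ N} (h : Homotopic f f')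
    (k : Homotopic g g') : Homotopic (f + g) (f' + g') := by
  obtain ⟨h0, h1, ha, hb, hc, he⟩ := h
  obtain ⟨k0, k1, ka, kb, kc, ke⟩ := k
  refine ⟨h0 + k0, h1 + k1, fun q m hm => Submodule.add_mem _ (ha q m hm) (ka q m hm),
    fun q m hm => Submodule.add_mem _ (hb q m hm) (kb q m hm), ?_, ?_⟩
  · refine (add_sub_add_comm _ _ _ _).trans ?_
    rw [hc, kc, LinearMap.comp_add, LinearMap.add_comp]
    abel
  · refine (add_sub_add_comm _ _ _ _).trans ?_
    rw [he, ke, LinearMap.comp_add, LinearMap.add_comp]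
    abel

theorem Homotopic.neg {M N : GrMF d} {f f' : M ⟶ N} (h : Homotopic f f') :
    Homotopic (-f) (-f') := by
  obtain ⟨h0, h1, ha, hb, hc, he⟩ := h
  refine ⟨-h0, -h1, fun q m hm => Submodule.neg_mem _ (ha q m hm),
    fun q m hm => Submodule.neg_mem _ (hb q m hm), ?_, ?_⟩
  · refine (neg_sub_neg _ _).trans ((neg_sub _ _).symm.trans ?_)
    rw [hc, LinearMap.comp_neg, LinearMap.neg_comp, neg_add]
  · refine (neg_sub_neg _ _).trans ((neg_sub _ _).symm.trans ?_)
    rw [he, LinearMap.comp_neg, LinearMap.neg_comp, neg_add]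

instance : Congruence (Homotopic (d := d)) where
  equivalence {M N} :=
    { refl f := by rw [homotopic_zero_iff, sub_self]; exact .zero M N
      symm {f g} h := by
        rw [homotopic_zero_iff] at h ⊢
        simpa using h.neg
      trans {f g k} h h' := by
        rw [homotopic_zero_iff] at h h' ⊢
        simpa using h.add h' }
  comp_left f g g' := by
    rintro ⟨h0, h1, ha, hb, hc, he⟩
    refine ⟨h0 ∘ₗ f.1.1, h1 ∘ₗ f.1.2, fun q m hm => ha q _ (f.2.1 q m hm),
      fun q m hm => hb q _ (f.2.2.1 q m hm), ?_, ?_⟩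
    · refine (LinearMap.sub_comp _ _ _).symm.trans ?_
      rw [hc, LinearMap.add_comp, LinearMap.comp_assoc, LinearMap.comp_assoc,
        LinearMap.comp_assoc, f.2.2.2.2]
    · refine (LinearMap.sub_comp _ _ _).symm.trans ?_
      rw [he, LinearMap.add_comp, LinearMap.comp_assoc, LinearMap.comp_assoc,
        LinearMap.comp_assoc, f.2.2.2.1]
  comp_right {M N K} f f' g := by
    rintro ⟨h0, h1, ha, hb, hc, he⟩
    refine ⟨g.1.2 ∘ₗ h0, g.1.1 ∘ₗ h1, fun q m hm => g.2.2.1 _ _ (ha q m hm),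
      fun q m hm => g.2.1 _ _ (hb q m hm), ?_, ?_⟩
    · refine (LinearMap.comp_sub _ _ _).symm.trans ?_
      rw [hc, LinearMap.comp_add, ← LinearMap.comp_assoc, ← LinearMap.comp_assoc,
        ← LinearMap.comp_assoc, g.2.2.2.1]
    · refine (LinearMap.comp_sub _ _ _).symm.trans ?_
      rw [he, LinearMap.comp_add, ← LinearMap.comp_assoc, ← LinearMap.comp_assoc,
        ← LinearMap.comp_assoc, g.2.2.2.2]

end GrMF

/-- The category `HMF^gr_bi`: same objects, and morphisms modulo homotopy. -/
abbrev HMF (d : ℕ) : Type 1 := Quotient (GrMF.Homotopic (d := d))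

instance (d : ℕ) : Preadditive (HMF d) :=
  Quotient.preadditive _ fun _ _ _ _ _ _ h k => h.add k

/-! ### Tensor products -/

theorem BTensor.pow_sub_smul {M N : Type*} [AddCommGroup M] [Module ℂ M] [Module Poly M]
    [IsScalarTower ℂ Poly M] [AddCommGroup N] [Module ℂ N] [Module Poly N]
    [IsScalarTower ℂ Poly N] (d : ℕ) (m : M) (n : N) :
    BTensor.tmul ((vx ^ d - vy ^ d) • m) n + BTensor.tmul m ((vx ^ d - vy ^ d) • n) =
      (vx ^ d - vy ^ d) • BTensor.tmul m n := by
  have sub1 : ∀ a b : M, BTensor.tmul (a - b) n = BTensor.tmul a n - BTensor.tmul b n := by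
    intro a b
    rw [eq_sub_iff_add_eq, ← BTensor.add_tmul, sub_add_cancel]
  have sub2 : ∀ a b : N, BTensor.tmul m (a - b) = BTensor.tmul m a - BTensor.tmul m b := by
    intro a b
    rw [eq_sub_iff_add_eq, ← BTensor.tmul_add, sub_add_cancel]
  have hx : vx ^ d • BTensor.tmul m n = BTensor.tmul (vx ^ d • m) n := by
    have := BTensor.monomial_smul_tmul (Finsupp.single 0 d) 1 m n
    rw [show MvPolynomial.monomial (Finsupp.single (0 : Fin 2) d) (1 : ℂ) = vx ^ d from
      (MvPolynomial.X_pow_eq_monomial).symm] at this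
    simpa using this
  have hy : vy ^ d • BTensor.tmul m n = BTensor.tmul m (vy ^ d • n) := by
    have := BTensor.monomial_smul_tmul (Finsupp.single 1 d) 1 m n
    rw [show MvPolynomial.monomial (Finsupp.single (1 : Fin 2) d) (1 : ℂ) = vy ^ d from
      (MvPolynomial.X_pow_eq_monomial).symm] at this
    simpa using this
  rw [sub_smul, sub_smul, sub_smul, sub1, sub2, hx, hy, BTensor.pow_vy_tmul]
  abel

theorem GrBimod.HasDegree.map {d : ℕ} {M M' N N' : GrBimod d} {a b : ℂ}
    {f : M →ₗ[Poly] M'} {g : N →ₗ[Poly] N'} (hf : GrBimod.HasDegree a f)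
    (hg : GrBimod.HasDegree b g) :
    GrBimod.HasDegree (M := M.tensor N) (N := M'.tensor N') (a + b) (BTensor.map f g) := by
  have key : ∀ q, ∀ t ∈ BTensor.deg M.deg N.deg q,
      BTensor.map f g t ∈ BTensor.deg M'.deg N'.deg (q + (a + b)) := by
    intro q t ht
    induction ht using Submodule.span_induction with
    | mem t ht =>
      obtain ⟨u, v, m, hm, n, hn, rfl, rfl⟩ := ht
      exact Submodule.subset_span ⟨_, _, _, hf u m hm, _, hg v n hn, by ring, rfl⟩
    | zero => rw [map_zero]; exact Submodule.zero_mem _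
    | add s t _ _ hs ht => rw [map_add]; exact Submodule.add_mem _ hs ht
    | smul c t _ ht =>
      rw [← algebraMap_smul Poly c t, map_smul, algebraMap_smul]
      exact Submodule.smul_mem _ _ ht
  exact key

theorem GrBimod.HasDegree.map_id_right {d : ℕ} {M M' N : GrBimod d} {a : ℂ}
    {f : M →ₗ[Poly] M'} (hf : GrBimod.HasDegree a f) :
    GrBimod.HasDegree (M := M.tensor N) (N := M'.tensor N) a
      (BTensor.map f (LinearMap.id : N →ₗ[Poly] N)) := by
  have := hf.map (g := (LinearMap.id : N →ₗ[Poly] N)) (b := 0) fun q m hm => by simpa using hm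
  rwa [add_zero] at this

theorem GrBimod.HasDegree.map_id_left {d : ℕ} {M N N' : GrBimod d} {a : ℂ}
    {g : N →ₗ[Poly] N'} (hg : GrBimod.HasDegree a g) :
    GrBimod.HasDegree (M := M.tensor N) (N := M.tensor N') a
      (BTensor.map (LinearMap.id : M →ₗ[Poly] M) g) := by
  have := GrBimod.HasDegree.map (f := (LinearMap.id : M →ₗ[Poly] M)) (a := 0)
    (fun q m hm => by simpa using hm) hg
  rwa [zero_add] at this

theorem BTensor.map_map_comm {M M' N N' : Type*} [AddCommGroup M] [Module ℂ M] [Module Poly M]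
    [IsScalarTower ℂ Poly M] [AddCommGroup N] [Module ℂ N] [Module Poly N]
    [IsScalarTower ℂ Poly N] [AddCommGroup M'] [Module ℂ M'] [Module Poly M']
    [IsScalarTower ℂ Poly M'] [AddCommGroup N'] [Module ℂ N'] [Module Poly N']
    [IsScalarTower ℂ Poly N'] (f : M →ₗ[Poly] M') (g : N →ₗ[Poly] N') (t : BTensor M N) :
    BTensor.map f LinearMap.id (BTensor.map LinearMap.id g t) =
      BTensor.map LinearMap.id g (BTensor.map f LinearMap.id t) := by
  induction t using BTensor.induction_on with
  | h1 m n => rfl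
  | h2 s t hs ht => simp only [map_add, hs, ht]

theorem BTensor.map_sq {M M' N N' : Type*} [AddCommGroup M] [Module ℂ M] [Module Poly M]
    [IsScalarTower ℂ Poly M] [AddCommGroup N] [Module ℂ N] [Module Poly N]
    [IsScalarTower ℂ Poly N] [AddCommGroup M'] [Module ℂ M'] [Module Poly M']
    [IsScalarTower ℂ Poly M'] [AddCommGroup N'] [Module ℂ N'] [Module Poly N']
    [IsScalarTower ℂ Poly N'] {d : ℕ} {f : M →ₗ[Poly] M'} {f' : M' →ₗ[Poly] M}
    {g : N →ₗ[Poly] N'} {g' : N' →ₗ[Poly] N}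
    (hf : ∀ m, f' (f m) = (vx ^ d - vy ^ d) • m) (hg : ∀ n, g' (g n) = (vx ^ d - vy ^ d) • n)
    (t : BTensor M N) :
    BTensor.map f' LinearMap.id (BTensor.map f (LinearMap.id : N →ₗ[Poly] N) t) +
      BTensor.map LinearMap.id g' (BTensor.map (LinearMap.id : M →ₗ[Poly] M) g t) =
      (vx ^ d - vy ^ d) • t := by
  induction t using BTensor.induction_on with
  | h1 m n =>
    simp only [BTensor.map_tmul, hf, hg, LinearMap.id_apply]
    exact BTensor.pow_sub_smul d m n
  | h2 s t hs ht =>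
    rw [smul_add, ← hs, ← ht]
    simp only [map_add]
    abel

namespace GrMF

variable {d : ℕ}

/-- The tensor product of graded matrix bifactorisations over `ℂ[x]`, with the twisted
differential `d ⊗ 1 + 1 ⊗ d` (and its Koszul sign) written out on
`(M ⊗ N)₀ = M₀ ⊗ N₀ ⊕ M₁ ⊗ N₁` and `(M ⊗ N)₁ = M₁ ⊗ N₀ ⊕ M₀ ⊗ N₁`. -/
def tensor (M N : GrMF d) : GrMF d where
  M0 := (M.M0.tensor N.M0).prod (M.M1.tensor N.M1)
  M1 := (M.M1.tensor N.M0).prod (M.M0.tensor N.M1)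
  d1 := LinearMap.prod
    (LinearMap.coprod (BTensor.map M.d1 LinearMap.id) (BTensor.map LinearMap.id N.d1))
    (LinearMap.coprod (-BTensor.map LinearMap.id N.d0) (BTensor.map M.d0 LinearMap.id))
  d0 := LinearMap.prod
    (LinearMap.coprod (BTensor.map M.d0 LinearMap.id) (-BTensor.map LinearMap.id N.d1))
    (LinearMap.coprod (BTensor.map LinearMap.id N.d0) (BTensor.map M.d1 LinearMap.id))
  d1_d0 := by
    rintro ⟨s, t⟩
    refine Prod.ext ?_ ?_
    · change BTensor.map M.d1 LinearMap.id
          (BTensor.map M.d0 LinearMap.id s + -BTensor.map LinearMap.id N.d1 t) +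
        BTensor.map LinearMap.id N.d1
          (BTensor.map LinearMap.id N.d0 s + BTensor.map M.d1 LinearMap.id t) = _ • s
      rw [← BTensor.map_sq M.d1_d0 N.d1_d0 s]
      simp only [map_add, map_neg, BTensor.map_map_comm]
      abel
    · change -BTensor.map LinearMap.id N.d0
          (BTensor.map M.d0 LinearMap.id s + -BTensor.map LinearMap.id N.d1 t) +
        BTensor.map M.d0 LinearMap.id
          (BTensor.map LinearMap.id N.d0 s + BTensor.map M.d1 LinearMap.id t) = _ • t
      rw [← BTensor.map_sq M.d0_d1 N.d0_d1 t]
      simp only [map_add, map_neg, BTensor.map_map_comm]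
      abel
  d0_d1 := by
    rintro ⟨s, t⟩
    refine Prod.ext ?_ ?_
    · change BTensor.map M.d0 LinearMap.id
          (BTensor.map M.d1 LinearMap.id s + BTensor.map LinearMap.id N.d1 t) +
        -BTensor.map LinearMap.id N.d1
          (-BTensor.map LinearMap.id N.d0 s + BTensor.map M.d0 LinearMap.id t) = _ • s
      rw [← BTensor.map_sq M.d0_d1 N.d1_d0 s]
      simp only [map_add, map_neg, BTensor.map_map_comm]
      abel
    · change BTensor.map LinearMap.id N.d0
          (BTensor.map M.d1 LinearMap.id s + BTensor.map LinearMap.id N.d1 t) +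
        BTensor.map M.d1 LinearMap.id
          (-BTensor.map LinearMap.id N.d0 s + BTensor.map M.d0 LinearMap.id t) = _ • t
      rw [← BTensor.map_sq M.d1_d0 N.d0_d1 t]
      simp only [map_add, map_neg, BTensor.map_map_comm]
      abel
  deg_d1 := by
    rintro q ⟨s, t⟩ ⟨hs, ht⟩
    exact ⟨Submodule.add_mem _ (M.deg_d1.map_id_right q s hs) (N.deg_d1.map_id_left q t ht),
      Submodule.add_mem _ (Submodule.neg_mem _ (N.deg_d0.map_id_left q s hs))
        (M.deg_d0.map_id_right q t ht)⟩
  deg_d0 := by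
    rintro q ⟨s, t⟩ ⟨hs, ht⟩
    exact ⟨Submodule.add_mem _ (M.deg_d0.map_id_right q s hs)
        (Submodule.neg_mem _ (N.deg_d1.map_id_left q t ht)),
      Submodule.add_mem _ (N.deg_d0.map_id_left q s hs) (M.deg_d1.map_id_right q t ht)⟩

end GrMF

/-- The tensor product on objects of `HMF^gr_bi`. -/
def HMF.tensor {d : ℕ} (M N : HMF d) : HMF d := ⟨M.as.tensor N.as⟩

/-! ### Permutation type matrix bifactorisations -/

section Permutation

set_option linter.unusedSectionVars false

variable (d : ℕ) [NeZero d]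

/-- The primitive root of unity `η = exp (2πi / d)`. -/
def eta : ℂ := Complex.exp (2 * Real.pi * Complex.I / d)

/-- The polynomial `∏_{j ∈ S} (x - η ^ j y)`; since `η ^ d = 1`, the power `η ^ j` is
well defined for `j ∈ ℤ/d`. -/
def permPoly (S : Finset (ZMod d)) : Poly :=
  ∏ j ∈ S, (vx - MvPolynomial.C (eta d ^ j.val) * vy)

theorem eta_isPrimitiveRoot : IsPrimitiveRoot (eta d) d :=
  Complex.isPrimitiveRoot_exp d (NeZero.ne d)

theorem permPoly_univ : permPoly d Finset.univ = vx ^ d - vy ^ d := by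
  have h := (eta_isPrimitiveRoot d).map_of_injective
    (f := (MvPolynomial.C : ℂ →+* Poly)) (MvPolynomial.C_injective _ _)
  rw [h.pow_sub_pow_eq_prod_sub_mul (x := vx) (y := vy) (NeZero.pos d), permPoly]
  refine Finset.prod_bij (fun j _ => MvPolynomial.C (eta d ^ j.val)) ?_ ?_ ?_ ?_
  · intro j _
    rw [Polynomial.mem_nthRootsFinset (NeZero.pos d), ← map_pow, ← pow_mul, mul_comm, pow_mul,
      (eta_isPrimitiveRoot d).pow_eq_one, one_pow, map_one]
  · intro i _ j _ hij
    exact ZMod.val_injective d ((eta_isPrimitiveRoot d).pow_inj (ZMod.val_lt i) (ZMod.val_lt j)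
      (MvPolynomial.C_injective _ _ hij))
  · intro b hb
    rw [Polynomial.mem_nthRootsFinset (NeZero.pos d)] at hb
    obtain ⟨i, hi, rfl⟩ := h.eq_pow_of_pow_eq_one hb
    exact ⟨(i : ZMod d), Finset.mem_univ _, by rw [ZMod.val_cast_of_lt hi, map_pow]⟩
  · intro j _
    rfl

theorem permPoly_mul_compl (S : Finset (ZMod d)) :
    permPoly d S * permPoly d Sᶜ = vx ^ d - vy ^ d := by
  rw [← permPoly_univ]
  exact Finset.prod_mul_prod_compl S _

theorem permPoly_mem (S : Finset (ZMod d)) :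
    permPoly d S ∈ polyDeg d (2 / (d : ℂ) * S.card) := by
  have := MvPolynomial.IsWeightedHomogeneous.prod S
    (fun j : ZMod d => vx - MvPolynomial.C (eta d ^ j.val) * vy) (fun _ => 2 / (d : ℂ))
    (w := fun _ => 2 / (d : ℂ)) (fun j _ => by
      refine Submodule.sub_mem (polyDeg d (2 / (d : ℂ))) (GrBimod.vx_mem_polyDeg d) ?_
      rw [← MvPolynomial.smul_eq_C_mul]
      exact Submodule.smul_mem _ _ (GrBimod.vy_mem_polyDeg d))
  rw [Finset.sum_const, nsmul_eq_mul, mul_comm] at this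
  exact this

/-- The graded permutation type matrix bifactorisation `P_S{α}`. Both components are `ℂ[x, y]`,
the generator of `M₀` has degree `α`, and that of `M₁` has degree `α + (2 / d) |S| - 1`. -/
def permMF (S : Finset (ZMod d)) (α : ℂ) : GrMF d where
  M0 := GrBimod.shift d α
  M1 := GrBimod.shift d (α + 2 / (d : ℂ) * S.card - 1)
  d1 := LinearMap.lsmul Poly Poly (permPoly d S)
  d0 := LinearMap.lsmul Poly Poly (permPoly d Sᶜ)
  d1_d0 m := by
    change permPoly d S • permPoly d Sᶜ • (m : Poly) = _
    rw [smul_smul, permPoly_mul_compl]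
  d0_d1 m := by
    change permPoly d Sᶜ • permPoly d S • (m : Poly) = _
    rw [smul_smul, mul_comm (permPoly d Sᶜ), permPoly_mul_compl]
  deg_d1 q m hm := by
    have := MvPolynomial.IsWeightedHomogeneous.mul (permPoly_mem d S) hm
    have e : 2 / (d : ℂ) * S.card + (q - (α + 2 / (d : ℂ) * S.card - 1)) = q + 1 - α := by ring
    rw [e] at this
    exact this
  deg_d0 q m hm := by
    have := MvPolynomial.IsWeightedHomogeneous.mul (permPoly_mem d Sᶜ) hm
    have hd : (d : ℂ) ≠ 0 := NeZero.ne _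
    have e : 2 / (d : ℂ) * Sᶜ.card + (q - α) =
        q + 1 - (α + 2 / (d : ℂ) * S.card - 1) := by
      have hc : ((Sᶜ.card : ℕ) : ℂ) = d - S.card := by
        have := Finset.card_add_card_compl S
        rw [ZMod.card] at this
        rw [eq_sub_iff_add_eq, add_comm]
        exact_mod_cast this
      rw [hc]
      field_simp
      ring
    rw [e] at this
    exact this

/-- `P̂_S = P_S{(1 - |S|) / d}` as an object of `HMF^gr_bi`. -/
def hatP (S : Finset (ZMod d)) : HMF d := ⟨permMF d S ((1 - S.card) / d)⟩

/-- The consecutive index set `{a, a + 1, …, a + l}` in `ℤ/d`. -/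
def consecutive (a : ZMod d) (l : ℕ) : Finset (ZMod d) :=
  (Finset.range (l + 1)).image fun k : ℕ => a + (k : ZMod d)

/-- `P̂_{a:l}`. -/
def hatPc (a : ZMod d) (l : ℕ) : HMF d := hatP d (consecutive d a l)

end Permutation

/-! ### Direct sums and semisimplicity -/

/-- `X` is a direct sum (biproduct) of the finite family `F`. -/
def IsDirectSum {C : Type*} [Category C] [Preadditive C] {ι : Type} [Finite ι] (X : C)
    (F : ι → C) : Prop :=
  ∃ b : Limits.Bicone F, Nonempty b.IsBilimit ∧ Nonempty (X ≅ b.pt)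

/-- A semisimple category: an abelian category in which every object is a finite direct sum
of simple objects. (All the conditions making a preadditive category abelian are
spelled out.) -/
structure IsSemisimple (C : Type*) [Category C] [Preadditive C] : Prop where
  hasFiniteProducts : Limits.HasFiniteProducts C
  hasKernels : Limits.HasKernels C
  hasCokernels : Limits.HasCokernels C
  normalMono : IsNormalMonoCategory C
  normalEpi : IsNormalEpiCategory C
  decomposition : ∀ X : C, ∃ (n : ℕ) (F : Fin n → C),
    (∀ i, Simple (F i)) ∧ IsDirectSum X F

/-- The objects of `HMF^gr_bi` that are isomorphic to finite direct sums of the `P̂_{a:l}` with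
`a ∈ ℤ/d` and `0 ≤ l ≤ d - 2`. -/
def isPgr (d : ℕ) [NeZero d] : ObjectProperty (HMF d) := fun X =>
  ∃ (n : ℕ) (a : Fin n → ZMod d) (l : Fin n → ℕ), (∀ i, l i ≤ d - 2) ∧
    IsDirectSum X fun i => hatPc d (a i) (l i)

/-- The full subcategory `P_d^gr` of `HMF^gr_bi`. -/
abbrev Pgr (d : ℕ) [NeZero d] : Type 1 := (isPgr d).FullSubcategory

/-- The labels `ν = |l - m|, |l - m| + 2, …, min (l + m) (2 d - 4 - l - m)`. -/
def fusionLabels (d l m : ℕ) : Finset ℕ :=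
  (Finset.Icc (max l m - min l m) (min (l + m) (2 * d - 4 - l - m))).filter
    fun ν => ν % 2 = (l + m) % 2

end BiMF

end

noncomputable section

namespace BiMF

/-! ### Direct sums in preadditive categories -/

section DirectSums

variable {C : Type*} [Category C] [Preadditive C]

/-! Two inputs carry the theorem: Schur's lemma for the `P̂_S`, and an explicit splitting of `P̂_S ⊗
P̂_T` when `T` has one or two consecutive elements. The rest is a dimension count.

Schur's lemma (`isSchurFamily_simples`). A degree-zero cycle `P̂_S → P̂_T` is a pair of
multiplications by homogeneous polynomials `u`, `w` with `p_S u = p_T w`. The normalisation of the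
degrees makes `deg u + deg w = 0`, so both are constants, and comparing roots of `p_S` and `p_T`
leaves `0` for `S ≠ T` and the scalars for `S = T`. If `S` and its complement are nonempty, the
identity is not null-homotopic: otherwise `1` would lie in the ideal generated by `p_S` and
`p_{Sᶜ}`, whose elements have no constant term. If `S` is empty or everything, `P̂_S` is
contractible.

For any family `S i` with these morphism spaces, the retracts of finite sums of the `S i` form a
category equivalent, via `X ↦ (Hom (S i, X))_i`, to families of finite-dimensional vector spaces.
Hence it is abelian and semisimple with simple objects the `S i` (`IsSchurFamily.isSemisimple`,
`IsSchurFamily.simple_iff`), and an object is determined by the dimensions of its `Hom (S i, X)`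
(`IsSchurFamily.isDirectSum`).

Tensor products. With `y` the middle variable, each of the four blocks of `P̂_S ⊗ P̂_T` is `ℂ[x, y,
z]`, and the differential consists of multiplications by `p_S(x, y)`, `p_T(y, z)` and their
complements. Since `p_T(y, z)` is monic in `y`, dividing by it is a homotopy that contracts the
tensor product onto the factorisation of `x ^ d - z ^ d` given by multiplication with `p_S(x, y)` on
the finite free `ℂ[x, z]`-module `ℂ[x, y, z] / p_T(y, z)`. Whenever that multiplication is diagonal
in suitable bases, with entries `p_{Z k}`, the tensor product is the sum of the `P̂_{Z k}`
(`Splitting.isDirectSum`). For `T = {n}` the quotient has rank one and `y` becomes `η ^ n z`, which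
shifts `S` by `n`. For `T = {n, n + 1}` the rank is two and interpolation at the two roots
diagonalises it (`exists_splitting_two`): this is the rule for tensoring with `P̂_{n:1}`.

The general rule follows as for representations of `SU(2)`, by induction on `μ`. Decompose `P̂_{m:λ}
⊗ P̂_{n:μ+1} ⊗ P̂_{0:1}` in two ways using associativity, compare multiplicities, and cancel the
known contribution of `P̂_{m:λ} ⊗ P̂_{n+1:μ}` (`fusion`). The truncation at `2 d - 4 - λ - μ` enters
because the set of all of `ℤ/d` gives a zero object. -/

theorem isDirectSum_of_maps {ι : Type} [Fintype ι] {X : C} {F : ι → C}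
    (i : ∀ k, F k ⟶ X) (p : ∀ k, X ⟶ F k) (h1 : ∀ k, i k ≫ p k = 𝟙 _)
    (h2 : ∀ j k, j ≠ k → i j ≫ p k = 0) (h3 : ∑ k, p k ≫ i k = 𝟙 X) : IsDirectSum X F := by
  classical
  let b : Limits.Bicone F :=
    { pt := X, π := p, ι := i
      ι_π := fun j k => by
        by_cases h : j = k
        · subst h; simp [h1]
        · simp [h, h2 j k h] }
  exact ⟨b, ⟨Limits.isBilimitOfTotal b h3⟩, ⟨Iso.refl X⟩⟩

theorem IsDirectSum.exists_maps {ι : Type} [Fintype ι] {X : C} {F : ι → C}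
    (h : IsDirectSum X F) : ∃ (i : ∀ k, F k ⟶ X) (p : ∀ k, X ⟶ F k),
      (∀ k, i k ≫ p k = 𝟙 _) ∧ (∀ j k, j ≠ k → i j ≫ p k = 0) ∧
        ∑ k, p k ≫ i k = 𝟙 X := by
  classical
  obtain ⟨b, ⟨hb⟩, ⟨e⟩⟩ := h
  refine ⟨fun k => b.ι k ≫ e.inv, fun k => e.hom ≫ b.π k, ?_, ?_, ?_⟩
  · intro k; simp
  · intro j k hjk; simp [b.ι_π, hjk]
  · have := Limits.IsBilimit.total hb
    simp only [Category.assoc]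
    rw [← Preadditive.comp_sum]
    simp only [← Category.assoc]
    rw [← Preadditive.sum_comp, this]
    simp

theorem IsDirectSum.map {D : Type*} [Category D] [Preadditive D] (G : C ⥤ D) [G.Additive]
    {ι : Type} [Finite ι] {X : C} {F : ι → C} (h : IsDirectSum X F) :
    IsDirectSum (G.obj X) fun k => G.obj (F k) := by
  have := Fintype.ofFinite ι
  obtain ⟨i, p, h1, h2, h3⟩ := h.exists_maps
  refine isDirectSum_of_maps (fun k => G.map (i k)) (fun k => G.map (p k)) ?_ ?_ ?_
  · intro k; rw [← G.map_comp, h1, G.map_id]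
  · intro j k hjk; rw [← G.map_comp, h2 j k hjk, G.map_zero]
  · simp only [← G.map_comp]
    rw [← G.map_sum, h3, G.map_id]

theorem IsDirectSum.reindex {ι κ : Type} [Finite ι] [Finite κ] {X : C} {F : ι → C}
    (h : IsDirectSum X F) (e : κ ≃ ι) : IsDirectSum X fun k => F (e k) := by
  have := Fintype.ofFinite ι
  have := Fintype.ofFinite κ
  obtain ⟨i, p, h1, h2, h3⟩ := h.exists_maps
  refine isDirectSum_of_maps (fun k => i (e k)) (fun k => p (e k)) (fun k => h1 _)
    (fun j k hjk => h2 _ _ (e.injective.ne hjk)) ?_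
  rw [← h3]
  exact e.sum_comp fun k => p k ≫ i k

theorem IsDirectSum.of_iso {ι : Type} [Finite ι] {X Y : C} {F : ι → C}
    (h : IsDirectSum X F) (e : Y ≅ X) : IsDirectSum Y F := by
  obtain ⟨b, hb, ⟨e'⟩⟩ := h
  exact ⟨b, hb, ⟨e ≪≫ e'⟩⟩

/-- `X` is a retract of a finite direct sum of members of the family `S`. -/
def IsSummand {ι : Type} (S : ι → C) : ObjectProperty C := fun X =>
  ∃ (K : Type) (_ : Fintype K) (a : K → ι) (p : ∀ k, X ⟶ S (a k)) (i : ∀ k, S (a k) ⟶ X),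
    ∑ k, p k ≫ i k = 𝟙 X

theorem IsSummand.of_isDirectSum {ι K : Type} [Fintype K] {S : ι → C} {X : C} {F : K → C}
    (h : IsDirectSum X F) (hF : ∀ k, IsSummand S (F k)) : IsSummand S X := by
  obtain ⟨i, p, -, -, h3⟩ := h.exists_maps
  choose L hL a q j hq using hF
  refine ⟨Σ k, L k, inferInstance, fun k => a k.1 k.2, fun k => p k.1 ≫ q k.1 k.2,
    fun k => j k.1 k.2 ≫ i k.1, ?_⟩
  rw [Fintype.sum_sigma, ← h3]
  refine Finset.sum_congr rfl fun k _ => ?_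
  simp only [Category.assoc]
  rw [← Preadditive.comp_sum]
  simp only [← Category.assoc]
  rw [← Preadditive.sum_comp, hq, Category.id_comp]

/-- `IsSummand` asks only that the identity be a sum of maps through the family, without
orthogonality, so conjugating with the retraction preserves it. -/
theorem IsSummand.of_retract {ι : Type} {S : ι → C} {X Y : C} (h : IsSummand S X)
    (r : X ⟶ Y) (s : Y ⟶ X) (hr : s ≫ r = 𝟙 Y) : IsSummand S Y := by
  obtain ⟨K, hK, a, p, i, h⟩ := h
  refine ⟨K, hK, a, fun k => s ≫ p k, fun k => i k ≫ r, ?_⟩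
  simp only [Category.assoc]
  rw [← Preadditive.comp_sum]
  simp only [← Category.assoc]
  rw [← Preadditive.sum_comp, h, Category.id_comp, hr]

theorem IsSummand.self {ι : Type} (S : ι → C) (i : ι) : IsSummand S (S i) :=
  ⟨Unit, inferInstance, fun _ => i, fun _ => 𝟙 _, fun _ => 𝟙 _, by simp⟩

/-- The identity of `X` is a sum of maps factoring through the `S i`, so maps from the `S i` detect
equality of morphisms out of `X`. -/
theorem IsSummand.hom_ext {ι : Type} {S : ι → C} {X Y : C} (hX : IsSummand S X) {f g : X ⟶ Y}
    (h : ∀ i, ∀ s : S i ⟶ X, s ≫ f = s ≫ g) : f = g := by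
  obtain ⟨K, _, a, p, i, hpi⟩ := hX
  rw [← Category.id_comp f, ← Category.id_comp g, ← hpi, Preadditive.sum_comp,
    Preadditive.sum_comp]
  simp only [Category.assoc, h]

end DirectSums

/-! ### Schur families -/

section Schur

variable {C : Type*} [Category C] [Preadditive C] [Linear ℂ C] {ι : Type}

/-- A family of objects all of whose morphism spaces are as in Schur's lemma. -/
structure IsSchurFamily (S : ι → C) : Prop where
  hom_eq_zero : ∀ i j, i ≠ j → ∀ f : S i ⟶ S j, f = 0
  exists_smul_id : ∀ i, ∀ f : S i ⟶ S i, ∃ c : ℂ, f = c • 𝟙 (S i)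
  id_ne_zero : ∀ i, 𝟙 (S i) ≠ 0

variable {S : ι → C}

namespace IsSchurFamily

theorem eq_of_ne_zero (hS : IsSchurFamily S) {i j : ι} (f : S i ⟶ S j) (hf : f ≠ 0) : i = j := by
  by_contra h
  exact hf (hS.hom_eq_zero i j h f)

/-- No naturality is required of `L`: morphisms between members of the family are scalars or zero,
and linear maps commute with both. This gives fullness of the functor of multiplicity spaces. -/
theorem exists_hom (hS : IsSchurFamily S) {X Y : C} (hX : IsSummand S X)
    (L : ∀ i, (S i ⟶ X) →ₗ[ℂ] (S i ⟶ Y)) :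
    ∃ f : X ⟶ Y, ∀ i, ∀ s : S i ⟶ X, s ≫ f = L i s := by
  obtain ⟨K, _, a, p, i, hpi⟩ := hX
  -- The only possible choice: `f = ∑ p k ≫ (i k ≫ f)`, and `i k ≫ f` has to be `L (i k)`.
  refine ⟨∑ k, p k ≫ L (a k) (i k), fun j s => ?_⟩
  have key : ∀ (j' : ι) (g : S j ⟶ S j') (t : S j' ⟶ X), g ≫ L j' t = L j (g ≫ t) := by
    intro j' g t
    by_cases h : j = j'
    · subst h
      obtain ⟨c, rfl⟩ := hS.exists_smul_id j g
      simp
    · simp [hS.hom_eq_zero _ _ h g]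
  rw [Preadditive.comp_sum]
  simp only [← Category.assoc, key]
  rw [← map_sum]
  simp only [Category.assoc]
  rw [← Preadditive.comp_sum, hpi, Category.comp_id]

/-- Turns a coordinate on `Hom (S j, X)` into an actual projection `X ⟶ S j`; on the other members
of the family the prescribed map is zero. -/
theorem exists_hom_of_functional (hS : IsSchurFamily S) {X : C} (hX : IsSummand S X) (j : ι)
    (φ : (S j ⟶ X) →ₗ[ℂ] ℂ) : ∃ f : X ⟶ S j, ∀ s : S j ⟶ X, s ≫ f = φ s • 𝟙 (S j) := by
  classical
  obtain ⟨f, hf⟩ := hS.exists_hom hX (Y := S j) fun i =>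
    if h : j = i then by subst h; exact φ.smulRight (𝟙 _) else 0
  refine ⟨f, fun s => ?_⟩
  simp [hf]

theorem finite_hom (hS : IsSchurFamily S) {X : C} (hX : IsSummand S X) (j : ι) :
    Module.Finite ℂ (S j ⟶ X) := by
  classical
  obtain ⟨K, _, a, p, i, hpi⟩ := hX
  have key : ∀ (j' : ι) (g : S j ⟶ S j') (t : S j' ⟶ X), ∃ u : S j ⟶ X, ∀ g : S j ⟶ S j',
      ∃ c : ℂ, g ≫ t = c • u := by
    intro j' g t
    by_cases h : j = j'
    · subst h
      refine ⟨t, fun g => ?_⟩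
      obtain ⟨c, rfl⟩ := hS.exists_smul_id j g
      exact ⟨c, by simp⟩
    · exact ⟨0, fun g => ⟨0, by simp [hS.hom_eq_zero _ _ h g]⟩⟩
  choose u hu using fun k => key (a k) 0 (i k)
  refine ⟨⟨Finset.univ.image u, ?_⟩⟩
  rw [eq_top_iff]
  rintro s -
  rw [← Category.comp_id s, ← hpi, Preadditive.comp_sum]
  refine Submodule.sum_mem _ fun k _ => ?_
  obtain ⟨c, hc⟩ := hu k (s ≫ p k)
  rw [← Category.assoc, hc]
  exact Submodule.smul_mem _ _ (Submodule.subset_span (by simp))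

/-- A basis of `Hom (S i, X)` serves as inclusions and its dual basis, realised by morphisms, as
projections. This reduces every later decomposition to a count of dimensions; `b` lists the labels
with multiplicity. -/
theorem isDirectSum (hS : IsSchurFamily S) [Fintype ι] {X : C} (hX : IsSummand S X) {K : Type}
    [Fintype K] (b : K → ι)
    (hb : ∀ i, Module.finrank ℂ (S i ⟶ X) = Nat.card {k // b k = i}) :
    IsDirectSum X fun k => S (b k) := by
  classical
  have hfin := hS.finite_hom hX
  let e : ∀ i, Module.Basis {k // b k = i} ℂ (S i ⟶ X) := fun i =>
    (Module.finBasisOfFinrankEq ℂ (S i ⟶ X)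
      ((hb i).trans Nat.card_eq_fintype_card)).reindex (Fintype.equivFin _).symm
  choose p hp using fun (i : ι) (k : {k // b k = i}) =>
    hS.exists_hom_of_functional hX i ((e i).coord k)
  have main : IsDirectSum X fun k : (Σ i, {k // b k = i}) => S k.1 := by
    refine isDirectSum_of_maps (fun k => e k.1 k.2) (fun k => p k.1 k.2) ?_ ?_ ?_
    · rintro ⟨i, k⟩
      simp [hp]
    · rintro ⟨i, k⟩ ⟨i', k'⟩ h
      by_cases hi : i = i'
      · subst hi
        have : k ≠ k' := fun hk => h (by rw [hk])
        simp [hp, this]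
      · exact hS.hom_eq_zero _ _ hi _
    -- Completeness is tested on maps `s : S i ⟶ X`. Only the summands of label `i` see `s`, and
    -- their sum is the expansion of `s` in the chosen basis.
    · refine hX.hom_ext fun i s => ?_
      rw [Fintype.sum_sigma, Preadditive.comp_sum, Finset.sum_eq_single i]
      · rw [Preadditive.comp_sum, Category.comp_id]
        simp only [← Category.assoc, hp, Linear.smul_comp, Category.id_comp]
        exact (e i).sum_repr s
      · intro i' _ hi'
        rw [Preadditive.comp_sum]
        refine Finset.sum_eq_zero fun k _ => ?_
        rw [← Category.assoc, hS.hom_eq_zero i i' (Ne.symm hi') (s ≫ p i' k), Limits.zero_comp]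
      · simp
  exact main.reindex (Equiv.sigmaFiberEquiv b).symm

theorem exists_isDirectSum (hS : IsSchurFamily S) [Fintype ι] {X : C} (hX : IsSummand S X) :
    ∃ (n : ℕ) (b : Fin n → ι), IsDirectSum X fun k => S (b k) := by
  classical
  let K := Σ i, Fin (Module.finrank ℂ (S i ⟶ X))
  have h : IsDirectSum X fun k : K => S k.1 := by
    refine hS.isDirectSum hX _ fun i => ?_
    rw [Nat.card_congr (Equiv.sigmaSubtype i)]
    simp
  exact ⟨_, fun k => ((Fintype.equivFin K).symm k).1, h.reindex (Fintype.equivFin K).symm⟩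

theorem finrank_hom_of_isDirectSum {X Y : C} {K : Type} [Fintype K] {F : K → C}
    (h : IsDirectSum X F) [∀ k, Module.Finite ℂ (Y ⟶ F k)] :
    Module.finrank ℂ (Y ⟶ X) = ∑ k, Module.finrank ℂ (Y ⟶ F k) := by
  classical
  obtain ⟨i, p, h1, h2, h3⟩ := h.exists_maps
  let e : (Y ⟶ X) ≃ₗ[ℂ] (∀ k, Y ⟶ F k) :=
    { toFun := fun s k => s ≫ p k
      map_add' := fun s t => by ext k; simp
      map_smul' := fun c s => by ext k; simp
      invFun := fun s => ∑ k, s k ≫ i k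
      left_inv := fun s => by
        simp only [Category.assoc]
        rw [← Preadditive.comp_sum, h3, Category.comp_id]
      right_inv := fun s => by
        ext k
        simp only [Preadditive.sum_comp, Category.assoc]
        rw [Finset.sum_eq_single k]
        · simp [h1]
        · intro j _ hj; simp [h2 j k hj]
        · simp }
  rw [e.finrank_eq, Module.finrank_pi_fintype]

end IsSchurFamily

end Schur

/-! ### Semisimplicity of the category of summands of a Schur family -/

section SchurAbelian

variable {C : Type*} [Category.{0} C] [Preadditive C] [Linear ℂ C] {ι : Type} {S : ι → C}

namespace IsSchurFamily

/-- The functor that records the multiplicity spaces `Hom (S i, X)`. -/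
def multiplicity (hS : IsSchurFamily S) (P : ObjectProperty C)
    (hP : ∀ X, P X → IsSummand S X) :
    P.FullSubcategory ⥤ (Discrete ι ⥤ FGModuleCat.{0} ℂ) where
  obj X := Discrete.functor fun i =>
    haveI := hS.finite_hom (hP _ X.property) i
    FGModuleCat.of ℂ (S i ⟶ X.obj)
  map {X Y} f := Discrete.natTrans fun i =>
    haveI := hS.finite_hom (hP _ X.property) i.as
    haveI := hS.finite_hom (hP _ Y.property) i.as
    FGModuleCat.ofHom (Linear.rightComp ℂ (S i.as) f.hom)
  map_id X := by
    ext i s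
    exact Category.comp_id _
  map_comp f g := by
    ext i s
    exact (Category.assoc _ _ _).symm

theorem multiplicity_map_apply (hS : IsSchurFamily S) (P : ObjectProperty C)
    (hP : ∀ X, P X → IsSummand S X) {X Y : P.FullSubcategory} (f : X ⟶ Y) (i : ι)
    (s : S i ⟶ X.obj) :
    ((hS.multiplicity P hP).map f).app ⟨i⟩ s = (s ≫ f.hom : S i ⟶ Y.obj) := rfl

theorem multiplicity_faithful (hS : IsSchurFamily S) (P : ObjectProperty C)
    (hP : ∀ X, P X → IsSummand S X) : (hS.multiplicity P hP).Faithful where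
  map_injective {X Y} f g h := by
    ext
    refine (hP _ X.property).hom_ext fun i s => ?_
    rw [← hS.multiplicity_map_apply P hP, ← hS.multiplicity_map_apply P hP, h]

theorem multiplicity_full (hS : IsSchurFamily S) (P : ObjectProperty C)
    (hP : ∀ X, P X → IsSummand S X) : (hS.multiplicity P hP).Full where
  map_surjective {X Y} φ := by
    obtain ⟨f, hf⟩ := hS.exists_hom (hP _ X.property) (Y := Y.obj)
      fun i => (φ.app ⟨i⟩).hom.hom
    refine ⟨ObjectProperty.homMk f, ?_⟩
    ext i s
    exact hf i.as s

/-- The biproduct with `dim V i` copies of each `S i` has, by Schur's lemma, multiplicity spaces of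
the prescribed dimensions, and over a discrete index category an isomorphism can be chosen at each
index separately. -/
theorem multiplicity_essSurj (hS : IsSchurFamily S) (P : ObjectProperty C) [Fintype ι]
    [Limits.HasFiniteBiproducts C]
    (hP' : ∀ X, P X ↔ IsSummand S X) :
    (hS.multiplicity P fun X => (hP' X).mp).EssSurj where
  mem_essImage V := by
    classical
    let K := Σ i, Fin (Module.finrank ℂ (V.obj ⟨i⟩))
    let F : K → C := fun k => S k.1
    let X : C := ⨁ F
    have hX : IsDirectSum X F := ⟨_, ⟨Limits.biproduct.isBilimit F⟩, ⟨Iso.refl _⟩⟩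
    have hX' : IsSummand S X := IsSummand.of_isDirectSum hX fun k => IsSummand.self S k.1
    have hfin : ∀ i, ∀ k : K, Module.Finite ℂ (S i ⟶ F k) :=
      fun i k => hS.finite_hom (IsSummand.self S k.1) i
    have hdim : ∀ i, Module.finrank ℂ (S i ⟶ X) = Module.finrank ℂ (V.obj ⟨i⟩) := by
      intro i
      have := hfin i
      rw [finrank_hom_of_isDirectSum hX, Fintype.sum_sigma, Finset.sum_eq_single i]
      · have h1 : Module.finrank ℂ (S i ⟶ S i) = 1 :=
          finrank_eq_one (𝟙 (S i)) (hS.id_ne_zero i) fun f => by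
            obtain ⟨c, rfl⟩ := hS.exists_smul_id i f
            exact ⟨c, rfl⟩
        simp [F, h1]
      · intro j _ hj
        have : Subsingleton (S i ⟶ S j) :=
          ⟨fun f g => by rw [hS.hom_eq_zero _ _ hj.symm f, hS.hom_eq_zero _ _ hj.symm g]⟩
        simp [F, Module.finrank_zero_of_subsingleton]
      · simp
    refine ⟨⟨X, (hP' X).mpr hX'⟩, ⟨Discrete.natIso fun i => ?_⟩⟩
    have := hS.finite_hom hX' i.as
    exact (LinearEquiv.ofFinrankEq (R := ℂ) (S i.as ⟶ X) (V.obj i) (hdim i.as)).toFGModuleCatIso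

/-- A simple object contains one of its summands by a nonzero split monomorphism, which is then an
isomorphism. Conversely, a nonzero map into `S i` is seen by some `S j`, which by Schur's lemma
splits it. -/
theorem simple_iff (hS : IsSchurFamily S) (P : ObjectProperty C) [Fintype ι]
    (hP' : ∀ X, P X ↔ IsSummand S X) (X : P.FullSubcategory) :
    Simple X ↔ ∃ i, Nonempty (X.obj ≅ S i) := by
  constructor
  · intro hX
    obtain ⟨n, b, hb⟩ := hS.exists_isDirectSum ((hP' _).mp X.property)
    obtain ⟨i, p, h1, -, h3⟩ := hb.exists_maps
    have hk : ∃ k, i k ≠ 0 := by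
      by_contra! h
      refine id_nonzero X ?_
      ext
      exact h3.symm.trans (Finset.sum_eq_zero fun k _ => by simp [h])
    obtain ⟨k, hk⟩ := hk
    let Y : P.FullSubcategory := ⟨S (b k), (hP' _).mpr (IsSummand.self S _)⟩
    let f : Y ⟶ X := ObjectProperty.homMk (i k)
    let g : X ⟶ Y := ObjectProperty.homMk (p k)
    have hfg : f ≫ g = 𝟙 Y := by ext; exact h1 k
    have : IsSplitMono f := ⟨⟨⟨g, hfg⟩⟩⟩
    have : IsIso f := isIso_of_mono_of_nonzero fun h => hk (congrArg (·.hom) h)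
    exact ⟨b k, ⟨(P.ι.mapIso (asIso f)).symm⟩⟩
  · rintro ⟨i, ⟨e⟩⟩
    refine ⟨fun {Y} f _ => ⟨fun _ h => ?_, fun h => ?_⟩⟩
    · have h1 : 𝟙 X = 0 := (IsIso.inv_hom_id f).symm.trans
        ((congrArg (inv f ≫ ·) h).trans Limits.comp_zero)
      have h2 : 𝟙 X.obj = 0 := congrArg (·.hom) h1
      refine hS.id_ne_zero i ?_
      rw [← e.inv_hom_id, ← Category.id_comp e.hom, h2, Limits.zero_comp, Limits.comp_zero]
    · have h1 : ∃ j, ∃ s : S j ⟶ Y.obj, s ≫ f.hom ≫ e.hom ≠ 0 := by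
        by_contra! h'
        refine h ?_
        ext
        have := ((hP' _).mp Y.property).hom_ext (f := f.hom ≫ e.hom) (g := 0)
          fun j s => by rw [h', Limits.comp_zero]
        rw [← Category.comp_id f.hom, ← e.hom_inv_id, ← Category.assoc, this, Limits.zero_comp]
        rfl
      obtain ⟨j, s, hs⟩ := h1
      -- A nonzero composite `S j ⟶ Y ⟶ X ≅ S i` forces `j = i` and is a nonzero scalar `c`.
      -- Rescaling by `c⁻¹` gives a section of the monomorphism `f`.
      obtain rfl := hS.eq_of_ne_zero _ hs
      obtain ⟨c, hc⟩ := hS.exists_smul_id _ (s ≫ f.hom ≫ e.hom)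
      have hc0 : c ≠ 0 := by
        rintro rfl
        exact hs (by rw [hc, zero_smul])
      let g : X ⟶ Y := ObjectProperty.homMk (c⁻¹ • (e.hom ≫ s))
      have hgf : g ≫ f = 𝟙 X := by
        ext
        change (c⁻¹ • (e.hom ≫ s)) ≫ f.hom = 𝟙 X.obj
        rw [← cancel_mono e.hom, Linear.smul_comp, Linear.smul_comp, Category.assoc,
          Category.assoc, hc, Linear.comp_smul, smul_smul, inv_mul_cancel₀ hc0, one_smul,
          Category.comp_id, Category.id_comp]
      have : IsSplitEpi f := ⟨⟨⟨g, hgf⟩⟩⟩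
      exact isIso_of_mono_of_isSplitEpi f

/-- The functor of multiplicity spaces is an equivalence onto families of finite-dimensional vector
spaces, along which the abelian structure is transported. -/
theorem isSemisimple (hS : IsSchurFamily S) (P : ObjectProperty C) [Fintype ι]
    [Limits.HasFiniteBiproducts C]
    (hP' : ∀ X, P X ↔ IsSummand S X) : IsSemisimple P.FullSubcategory := by
  have := hS.multiplicity_faithful P fun X => (hP' X).mp
  have := hS.multiplicity_full P fun X => (hP' X).mp
  have := hS.multiplicity_essSurj P hP'
  let G := hS.multiplicity P fun X => (hP' X).mp
  have hG : G.IsEquivalence := { }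
  have hprod : Limits.HasFiniteProducts P.FullSubcategory :=
    ⟨fun n => Adjunction.hasLimitsOfShape_of_equivalence G⟩
  let A : Abelian P.FullSubcategory := abelianOfEquivalence G
  refine ⟨hprod, A.has_kernels, A.has_cokernels, A.toIsNormalMonoCategory,
    A.toIsNormalEpiCategory, fun X => ?_⟩
  obtain ⟨n, b, hb⟩ := hS.exists_isDirectSum ((hP' _).mp X.property)
  refine ⟨n, fun k => ⟨S (b k), (hP' _).mpr (IsSummand.self S _)⟩, fun k =>
    (hS.simple_iff P hP' _).mpr ⟨b k, ⟨Iso.refl _⟩⟩, ?_⟩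
  obtain ⟨i, p, h1, h2, h3⟩ := hb.exists_maps
  refine isDirectSum_of_maps (fun k => ObjectProperty.homMk (i k))
    (fun k => ObjectProperty.homMk (p k)) ?_ ?_ ?_
  · intro k; ext; exact h1 k
  · intro j k hjk; ext; exact h2 j k hjk
  · ext
    rw [← P.ι_map, Functor.map_sum]
    exact h3

end IsSchurFamily

end SchurAbelian

/-! ### The linear structure and direct sums of `HMF^gr_bi` -/

namespace GrMF

variable {d : ℕ}

instance : Linear ℂ (GrMF d) where
  homModule M N := inferInstanceAs (Module ℂ (cycles M N))
  smul_comp M N K c f g := Subtype.ext (Prod.ext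
    (LinearMap.ext fun m => by
      change g.1.1 (c • f.1.1 m) = c • g.1.1 (f.1.1 m)
      rw [← algebraMap_smul Poly c, map_smul, algebraMap_smul])
    (LinearMap.ext fun m => by
      change g.1.2 (c • f.1.2 m) = c • g.1.2 (f.1.2 m)
      rw [← algebraMap_smul Poly c, map_smul, algebraMap_smul]))
  comp_smul M N K f c g := rfl

theorem Homotopic.smul {M N : GrMF d} (c : ℂ) {f g : M ⟶ N} (h : Homotopic f g) :
    Homotopic (c • f) (c • g) := by
  obtain ⟨h0, h1, ha, hb, hc, he⟩ := h
  refine ⟨c • h0, c • h1, fun q m hm => Submodule.smul_mem _ _ (ha q m hm),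
    fun q m hm => Submodule.smul_mem _ _ (hb q m hm), ?_, ?_⟩
  · refine (smul_sub c f.1.1 g.1.1).symm.trans ?_
    rw [hc]
    ext m
    simp only [LinearMap.smul_apply, LinearMap.add_apply, LinearMap.comp_apply, smul_add]
    rw [← algebraMap_smul Poly c (h0 m), map_smul, algebraMap_smul]
  · refine (smul_sub c f.1.2 g.1.2).symm.trans ?_
    rw [he]
    ext m
    simp only [LinearMap.smul_apply, LinearMap.add_apply, LinearMap.comp_apply, smul_add]
    rw [← algebraMap_smul Poly c (h1 m), map_smul, algebraMap_smul]

/-- The projection from cycles to homotopy classes. -/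
abbrev toHMF (d : ℕ) : GrMF d ⥤ HMF d := Quotient.functor _

instance : (toHMF d).Additive := Quotient.functor_additive _ fun _ _ _ _ _ _ h k => h.add k

instance : Linear ℂ (HMF d) := Quotient.linear ℂ _ fun c _ _ _ _ h => h.smul c

instance : (toHMF d).Linear ℂ where
  map_smul _ _ := rfl

/-- The direct sum of two graded matrix bifactorisations. -/
def prod (M N : GrMF d) : GrMF d where
  M0 := M.M0.prod N.M0
  M1 := M.M1.prod N.M1
  d1 := LinearMap.prodMap M.d1 N.d1
  d0 := LinearMap.prodMap M.d0 N.d0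
  d1_d0 m := Prod.ext (M.d1_d0 m.1) (N.d1_d0 m.2)
  d0_d1 m := Prod.ext (M.d0_d1 m.1) (N.d0_d1 m.2)
  deg_d1 q _ hm := ⟨M.deg_d1 q _ hm.1, N.deg_d1 q _ hm.2⟩
  deg_d0 q _ hm := ⟨M.deg_d0 q _ hm.1, N.deg_d0 q _ hm.2⟩

/-- The biproduct structure on the direct sum. -/
def prodBicone (M N : GrMF d) : Limits.BinaryBicone M N where
  pt := M.prod N
  fst := ⟨(LinearMap.fst _ _ _, LinearMap.fst _ _ _), fun _ _ h => h.1, fun _ _ h => h.1,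
    rfl, rfl⟩
  snd := ⟨(LinearMap.snd _ _ _, LinearMap.snd _ _ _), fun _ _ h => h.2, fun _ _ h => h.2,
    rfl, rfl⟩
  inl := ⟨(LinearMap.inl _ _ _, LinearMap.inl _ _ _), fun _ _ h => ⟨h, Submodule.zero_mem _⟩,
    fun _ _ h => ⟨h, Submodule.zero_mem _⟩,
    LinearMap.ext fun _ => Prod.ext rfl (map_zero N.d1).symm,
    LinearMap.ext fun _ => Prod.ext rfl (map_zero N.d0).symm⟩
  inr := ⟨(LinearMap.inr _ _ _, LinearMap.inr _ _ _), fun _ _ h => ⟨Submodule.zero_mem _, h⟩,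
    fun _ _ h => ⟨Submodule.zero_mem _, h⟩,
    LinearMap.ext fun _ => Prod.ext (map_zero M.d1).symm rfl,
    LinearMap.ext fun _ => Prod.ext (map_zero M.d0).symm rfl⟩
  inl_fst := rfl
  inl_snd := rfl
  inr_fst := rfl
  inr_snd := rfl

theorem prodBicone_total (M N : GrMF d) :
    (prodBicone M N).fst ≫ (prodBicone M N).inl +
      (prodBicone M N).snd ≫ (prodBicone M N).inr = 𝟙 (M.prod N) :=
  Subtype.ext (Prod.ext
    (LinearMap.ext fun m => Prod.ext (add_zero m.1) (zero_add m.2))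
    (LinearMap.ext fun m => Prod.ext (add_zero m.1) (zero_add m.2)))

end GrMF

open GrMF

instance (d : ℕ) : Limits.HasBinaryBiproducts (HMF d) where
  has_binary_biproduct X Y := by
    let b := prodBicone X.as Y.as
    refine Limits.hasBinaryBiproduct_of_total
      { pt := (toHMF d).obj b.pt
        fst := (toHMF d).map b.fst
        snd := (toHMF d).map b.snd
        inl := (toHMF d).map b.inl
        inr := (toHMF d).map b.inr
        inl_fst := congrArg (toHMF d).map b.inl_fst
        inl_snd := congrArg (toHMF d).map b.inl_snd
        inr_fst := congrArg (toHMF d).map b.inr_fst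
        inr_snd := congrArg (toHMF d).map b.inr_snd } ?_
    exact congrArg (toHMF d).map (prodBicone_total X.as Y.as)

/-! ### Homogeneous polynomials -/

theorem exists_nat_of_mem_polyDeg {d : ℕ} {q : ℂ} {p : Poly} (hp : p ∈ polyDeg d q)
    (h0 : p ≠ 0) : ∃ n : ℕ, q = n * (2 / (d : ℂ)) := by
  obtain ⟨s, hs⟩ := MvPolynomial.exists_coeff_ne_zero h0
  refine ⟨s 0 + s 1, ?_⟩
  rw [← hp hs, Finsupp.weight_apply, Finsupp.sum_fintype _ _ (by simp), Fin.sum_univ_two]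
  simp only [nsmul_eq_mul]
  push_cast
  ring

theorem eq_C_of_mem_polyDeg_zero {d : ℕ} [NeZero d] {p : Poly} (hp : p ∈ polyDeg d 0) :
    ∃ c : ℂ, p = MvPolynomial.C c := by
  refine ⟨p.coeff 0, ?_⟩
  ext s
  rw [MvPolynomial.coeff_C]
  split_ifs with h
  · rw [h]
  · by_contra hs
    have := hp hs
    rw [Finsupp.weight_apply, Finsupp.sum_fintype _ _ (by simp), Fin.sum_univ_two] at this
    simp only [nsmul_eq_mul] at this
    have hd : (d : ℂ) ≠ 0 := NeZero.ne _
    rw [← add_mul, mul_eq_zero, or_iff_left (div_ne_zero two_ne_zero hd)] at this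
    have h2 : s 0 + s 1 = 0 := by exact_mod_cast this
    refine h (Finsupp.ext fun i => ?_)
    fin_cases i <;> simp <;> omega

theorem one_mem_polyDeg (d : ℕ) : (1 : Poly) ∈ polyDeg d 0 :=
  MvPolynomial.isWeightedHomogeneous_one ℂ _

/-! ### Morphisms between permutation type objects -/

section Permutation

set_option linter.unusedSectionVars false

variable (d : ℕ) [NeZero d]

theorem eval_permPoly (S : Finset (ZMod d)) (j : ZMod d) :
    MvPolynomial.eval ![eta d ^ j.val, 1] (permPoly d S) =
      ∏ i ∈ S, (eta d ^ j.val - eta d ^ i.val) := by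
  simp [permPoly, map_prod]

theorem eta_pow_injective {i j : ZMod d} (h : eta d ^ i.val = eta d ^ j.val) : i = j :=
  ZMod.val_injective d ((eta_isPrimitiveRoot d).pow_inj (ZMod.val_lt i) (ZMod.val_lt j) h)

/-- The powers `η ^ j` with `j` in `ℤ/d` are distinct, so at the point `(η ^ j, 1)` only the factor
with label `j` vanishes. In this way `S` is recovered from `p_S`. -/
theorem eval_permPoly_eq_zero_iff (S : Finset (ZMod d)) (j : ZMod d) :
    MvPolynomial.eval ![eta d ^ j.val, 1] (permPoly d S) = 0 ↔ j ∈ S := by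
  rw [eval_permPoly, Finset.prod_eq_zero_iff]
  constructor
  · rintro ⟨i, hi, h⟩
    rwa [eta_pow_injective d (sub_eq_zero.mp h)]
  · intro h
    exact ⟨j, h, sub_self _⟩

theorem permPoly_ne_zero (S : Finset (ZMod d)) : permPoly d S ≠ 0 := by
  refine Finset.prod_ne_zero_iff.mpr fun j _ h => ?_
  have := congrArg (MvPolynomial.eval ![1, 0]) h
  simp at this

theorem constantCoeff_permPoly {S : Finset (ZMod d)} (h : S.Nonempty) :
    MvPolynomial.constantCoeff (permPoly d S) = 0 := by
  obtain ⟨j, hj⟩ := h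
  rw [permPoly, map_prod]
  exact Finset.prod_eq_zero hj (by simp)

variable {d}

/-- Linear maps between free modules of rank one are multiplications by the image of `1`, whose
degree is the difference of the degrees of the generators. -/
theorem hom_permMF_eq {S T : Finset (ZMod d)} {α β : ℂ} (f : permMF d S α ⟶ permMF d T β) :
    ∃ u ∈ polyDeg d (α - β),
      ∃ w ∈ polyDeg d ((α + 2 / (d : ℂ) * S.card - 1) - (β + 2 / (d : ℂ) * T.card - 1)),
      (∀ p : Poly, f.1.1 p = p * u) ∧ (∀ p : Poly, f.1.2 p = p * w) ∧
        permPoly d S * u = permPoly d T * w := by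
  let g0 : Poly →ₗ[Poly] Poly := f.1.1
  let g1 : Poly →ₗ[Poly] Poly := f.1.2
  have h0 : ∀ p : Poly, g0 p = p * g0 1 := fun p => by
    rw [← smul_eq_mul, ← g0.map_smul, smul_eq_mul, mul_one]
  have h1 : ∀ p : Poly, g1 p = p * g1 1 := fun p => by
    rw [← smul_eq_mul, ← g1.map_smul, smul_eq_mul, mul_one]
  refine ⟨g0 1, f.2.1 α (1 : Poly) ?_, g1 1,
    f.2.2.1 (α + 2 / (d : ℂ) * S.card - 1) (1 : Poly) ?_, h0, h1, ?_⟩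
  · change (1 : Poly) ∈ polyDeg d (α - α)
    rw [sub_self]; exact one_mem_polyDeg d
  · change (1 : Poly) ∈ polyDeg d (_ - _)
    rw [sub_self]; exact one_mem_polyDeg d
  · have h2 : g0 (permPoly d S * (1 : Poly)) = permPoly d T * g1 1 :=
      LinearMap.congr_fun f.2.2.2.1 (1 : Poly)
    rwa [mul_one, h0] at h2

/-- For the shifts `(1 - |S|) / d` the degrees of the two components are opposite. Nonzero
polynomials have degree in `ℕ · (2 / d)`, so both components are constants. -/
theorem hom_hatP_eq {S T : Finset (ZMod d)}
    (f : permMF d S ((1 - S.card) / d) ⟶ permMF d T ((1 - T.card) / d)) :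
    ∃ a b : ℂ, (∀ p : Poly, f.1.1 p = p * MvPolynomial.C a) ∧
      (∀ p : Poly, f.1.2 p = p * MvPolynomial.C b) ∧
        permPoly d S * MvPolynomial.C a = permPoly d T * MvPolynomial.C b := by
  obtain ⟨u, hu, w, hw, h0, h1, h⟩ := hom_permMF_eq f
  by_cases hu0 : u = 0
  · have hw0 : w = 0 := by
      rw [hu0, mul_zero, eq_comm, mul_eq_zero] at h
      exact h.resolve_left (permPoly_ne_zero d T)
    subst hu0 hw0
    rw [← map_zero MvPolynomial.C] at h0 h1
    exact ⟨0, 0, h0, h1, by simp⟩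
  by_cases hw0 : w = 0
  · rw [hw0, mul_zero, mul_eq_zero] at h
    exact absurd (h.resolve_left (permPoly_ne_zero d S)) hu0
  obtain ⟨n, hn⟩ := exists_nat_of_mem_polyDeg hu hu0
  obtain ⟨m, hm⟩ := exists_nat_of_mem_polyDeg hw hw0
  have hd : (d : ℂ) ≠ 0 := NeZero.ne _
  -- The even component has degree `(|T| - |S|) / d` and the odd one `(|S| - |T|) / d`; their sum
  -- vanishes.
  have hnm : ((n + m : ℕ) : ℂ) = 0 := by
    field_simp at hn hm
    push_cast
    linear_combination -(1 / 2) * hn - (1 / 2) * hm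
  have hnm' : n + m = 0 := by exact_mod_cast hnm
  obtain ⟨rfl, rfl⟩ : n = 0 ∧ m = 0 := by omega
  rw [hn, Nat.cast_zero, zero_mul] at hu
  rw [hm, Nat.cast_zero, zero_mul] at hw
  obtain ⟨a, rfl⟩ := eq_C_of_mem_polyDeg_zero hu
  obtain ⟨b, rfl⟩ := eq_C_of_mem_polyDeg_zero hw
  exact ⟨a, b, h0, h1, h⟩

theorem hom_hatP_eq_zero {S T : Finset (ZMod d)} (h : S ≠ T) (f : hatP d S ⟶ hatP d T) :
    f = 0 := by
  obtain ⟨f, rfl⟩ := (toHMF d).map_surjective f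
  obtain ⟨a, b, h0, h1, hab⟩ := hom_hatP_eq f
  have key : a = 0 ∧ b = 0 := by
    have e1 : a = 0 → b = 0 := by
      rintro rfl
      rw [map_zero, mul_zero, eq_comm, mul_eq_zero,
        or_iff_right (permPoly_ne_zero d T)] at hab
      exact MvPolynomial.C_injective _ _ (by rw [hab, map_zero])
    have e2 : b = 0 → a = 0 := by
      rintro rfl
      rw [map_zero, mul_zero, mul_eq_zero, or_iff_right (permPoly_ne_zero d S)] at hab
      exact MvPolynomial.C_injective _ _ (by rw [hab, map_zero])
    -- For a label `j` in exactly one of the two sets, evaluating at `(η ^ j, 1)` kills exactly one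
    -- side of `hab` and hence the constant on the other; the relation then kills the remaining
    -- constant.
    have hj : ∃ j, ¬ (j ∈ S ↔ j ∈ T) := by
      by_contra! hc
      exact h (Finset.ext hc)
    obtain ⟨j, hj⟩ := hj
    have hev := congrArg (MvPolynomial.eval ![eta d ^ j.val, 1]) hab
    rw [map_mul, map_mul, MvPolynomial.eval_C, MvPolynomial.eval_C] at hev
    by_cases hS : j ∈ S
    · have hT : j ∉ T := fun hT => hj ⟨fun _ => hT, fun _ => hS⟩
      rw [(eval_permPoly_eq_zero_iff d S j).mpr hS, zero_mul, eq_comm, mul_eq_zero,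
        or_iff_right (mt (eval_permPoly_eq_zero_iff d T j).mp hT)] at hev
      exact ⟨e2 hev, hev⟩
    · have hT : j ∈ T := by
        by_contra hT
        exact hj ⟨fun h => absurd h hS, fun h => absurd h hT⟩
      rw [(eval_permPoly_eq_zero_iff d T j).mpr hT, zero_mul, mul_eq_zero,
        or_iff_right (mt (eval_permPoly_eq_zero_iff d S j).mp hS)] at hev
      exact ⟨hev, e1 hev⟩
  obtain ⟨rfl, rfl⟩ := key
  have hz : ∀ p : Poly, p * MvPolynomial.C 0 = 0 := by simp
  have hf : f = 0 := Subtype.ext (Prod.ext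
    (LinearMap.ext fun p => (h0 p).trans (hz p)) (LinearMap.ext fun p => (h1 p).trans (hz p)))
  rw [hf]
  exact (toHMF d).map_zero _ _

theorem exists_smul_id_hatP {S : Finset (ZMod d)} (f : hatP d S ⟶ hatP d S) :
    ∃ c : ℂ, f = c • 𝟙 (hatP d S) := by
  obtain ⟨f, rfl⟩ := (toHMF d).map_surjective f
  obtain ⟨a, b, h0, h1, hab⟩ := hom_hatP_eq f
  obtain rfl := MvPolynomial.C_injective _ _ (mul_left_cancel₀ (permPoly_ne_zero d S) hab)
  have ha : ∀ p : Poly, p * MvPolynomial.C a = a • p := fun p => by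
    rw [mul_comm, ← MvPolynomial.smul_eq_C_mul]
  have hf : f = a • 𝟙 (permMF d S ((1 - S.card) / d)) := Subtype.ext (Prod.ext
    (LinearMap.ext fun p => (h0 p).trans (ha p)) (LinearMap.ext fun p => (h1 p).trans (ha p)))
  refine ⟨a, ?_⟩
  rw [hf, (toHMF d).map_smul]
  rfl

/-- A null-homotopy of the identity would write `1` as a combination of `p_S` and `p_{Sᶜ}`. Both
index sets are nonempty, so neither polynomial has a constant term. -/
theorem id_hatP_ne_zero {S : Finset (ZMod d)} (h : S.Nonempty) (h' : Sᶜ.Nonempty) :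
    𝟙 (hatP d S) ≠ 0 := by
  intro h0
  have h1 : (toHMF d).map (𝟙 (permMF d S ((1 - S.card) / d))) = (toHMF d).map 0 := h0
  obtain ⟨k0, k1, -, -, hk, -⟩ := (Quotient.functor_map_eq_iff _ _ _).mp h1
  let g0 : Poly →ₗ[Poly] Poly := k0
  let g1 : Poly →ₗ[Poly] Poly := k1
  have h2 : (1 : Poly) - 0 = permPoly d S * g0 1 + g1 (permPoly d Sᶜ * 1) :=
    LinearMap.congr_fun hk (1 : Poly)
  rw [← smul_eq_mul (permPoly d Sᶜ), g1.map_smul, smul_eq_mul] at h2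
  have h4 := congrArg MvPolynomial.constantCoeff h2
  rw [map_add, map_mul, map_mul, constantCoeff_permPoly d h, constantCoeff_permPoly d h'] at h4
  simp at h4

/-- One half of the differential is multiplication by the empty product `1`, so the identity map is
a contraction. This object and `P̂_S` for `S = ℤ/d` are the degenerate summands in the product with
`P̂_{n:1}`, where they account for the ends of the fusion rule. -/
theorem isZero_hatP_empty : Limits.IsZero (hatP d ∅) := by
  refine (Limits.IsZero.iff_id_eq_zero _).mpr (CategoryTheory.Quotient.sound Homotopic
    (f₁ := 𝟙 (permMF d ∅ _)) (f₂ := 0) ⟨(LinearMap.id : Poly →ₗ[Poly] Poly), 0, ?_, ?_, ?_, ?_⟩)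
  · intro q m hm
    refine (congrArg (m ∈ polyDeg d ·) ?_).mp hm
    simp
    ring
  · exact fun _ _ _ => Submodule.zero_mem _
  · ext
    change (1 : Poly) - 0 = permPoly d ∅ * 1 + 0
    simp [permPoly]
  · ext
    change (1 : Poly) - 0 = permPoly d ∅ᶜ * 0 + permPoly d ∅ * 1
    simp [permPoly]

theorem isZero_hatP_univ : Limits.IsZero (hatP d Finset.univ) := by
  refine (Limits.IsZero.iff_id_eq_zero _).mpr (CategoryTheory.Quotient.sound Homotopic
    (f₁ := 𝟙 (permMF d Finset.univ _)) (f₂ := 0)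
    ⟨0, (LinearMap.id : Poly →ₗ[Poly] Poly), ?_, ?_, ?_, ?_⟩)
  · exact fun _ _ _ => Submodule.zero_mem _
  · intro q m hm
    have hd : (d : ℂ) ≠ 0 := NeZero.ne _
    refine (congrArg (m ∈ polyDeg d ·) ?_).mp hm
    rw [Finset.card_univ, ZMod.card]
    field_simp
    ring
  · ext
    change (1 : Poly) - 0 = permPoly d Finset.univ * 0 + permPoly d Finset.univᶜ * 1
    simp [permPoly]
  · ext
    change (1 : Poly) - 0 = permPoly d Finset.univᶜ * 1 + 0
    simp [permPoly]

end Permutation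

open GrMF

/-! ### The simple objects -/

section Simples

set_option linter.unusedSectionVars false

variable (d : ℕ) [NeZero d]

/-- The set `{a, a + 1, …, a + k - 1}` in `ℤ/d`. -/
def interval (a : ZMod d) (k : ℕ) : Finset (ZMod d) :=
  (Finset.range k).image fun j : ℕ => a + (j : ZMod d)

variable {d}

theorem natCast_inj_of_lt {i j : ℕ} (hi : i < d) (hj : j < d) (h : (i : ZMod d) = j) : i = j := by
  rw [← ZMod.val_cast_of_lt hi, ← ZMod.val_cast_of_lt hj, h]

theorem interval_injOn (a : ZMod d) {k : ℕ} (hk : k ≤ d) :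
    Set.InjOn (fun j : ℕ => a + (j : ZMod d)) (Finset.range k) := by
  intro i hi j hj h
  simp only [Finset.coe_range, Set.mem_Iio] at hi hj
  exact natCast_inj_of_lt (by omega) (by omega) (add_left_cancel h)

theorem card_interval (a : ZMod d) {k : ℕ} (hk : k ≤ d) : (interval d a k).card = k := by
  rw [interval, Finset.card_image_of_injOn (interval_injOn a hk), Finset.card_range]

theorem interval_self (a : ZMod d) : interval d a d = Finset.univ := by
  rw [← Finset.card_eq_iff_eq_univ, card_interval a le_rfl, ZMod.card]

theorem mem_interval {a b : ZMod d} {k : ℕ} :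
    b ∈ interval d a k ↔ ∃ j < k, a + (j : ZMod d) = b := by
  simp [interval]

/-- A nonempty proper cyclic interval determines its starting point as the element whose predecessor
is missing; both conditions on `k` are essential. -/
theorem interval_inj {a b : ZMod d} {k l : ℕ} (hk : k < d) (hl : l < d) (hk0 : 0 < k)
    (h : interval d a k = interval d b l) : a = b ∧ k = l := by
  have hkl : k = l := by
    rw [← card_interval a hk.le, h, card_interval b hl.le]
  subst hkl
  refine ⟨?_, rfl⟩
  have ha : a ∈ interval d b k := h ▸ mem_interval.mpr ⟨0, hk0, by simp⟩
  obtain ⟨j, hj, hja⟩ := mem_interval.mp ha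
  rcases Nat.eq_zero_or_pos j with rfl | hj0
  · simpa using hja.symm
  -- If `a = b + j` with `j > 0`, then `a - 1` lies in the interval too, say `a - 1 = a + i`. So `i
  -- + 1` vanishes in `ℤ/d` although `0 < i + 1 ≤ k < d`.
  · have h1 : a - 1 ∈ interval d a k := by
      rw [h]
      refine mem_interval.mpr ⟨j - 1, by omega, ?_⟩
      rw [← hja, Nat.cast_sub hj0]
      push_cast
      ring
    obtain ⟨i, hi, hia⟩ := mem_interval.mp h1
    have h2 : ((i + 1 : ℕ) : ZMod d) = (0 : ℕ) := by
      push_cast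
      linear_combination hia
    have := natCast_inj_of_lt (by omega) (by omega) h2
    omega

theorem interval_ne_univ (a : ZMod d) {k : ℕ} (hk : k < d) : (interval d a k)ᶜ.Nonempty := by
  rw [← Finset.card_pos, Finset.card_compl, ZMod.card, card_interval a hk.le]
  omega

theorem interval_nonempty (a : ZMod d) {k : ℕ} (hk : 0 < k) : (interval d a k).Nonempty :=
  ⟨a, mem_interval.mpr ⟨0, hk, by simp⟩⟩

variable (d) in
/-- The objects `P̂_{a:l}` with `0 ≤ l ≤ d - 2`. -/
def simples (i : ZMod d × Fin (d - 1)) : HMF d := hatPc d i.1 i.2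

theorem isSchurFamily_simples : IsSchurFamily (simples d) where
  hom_eq_zero i j hij f := by
    refine hom_hatP_eq_zero (fun h => hij ?_) f
    -- `consecutive d a l` unfolds to `interval d a (l + 1)`, and `0 < l + 1 < d` for the labels in
    -- `Fin (d - 1)`.
    have := interval_inj (by omega) (by omega) (by omega) h
    exact Prod.ext this.1 (Fin.ext (by omega))
  exists_smul_id i f := exists_smul_id_hatP f
  id_ne_zero i :=
    id_hatP_ne_zero (interval_nonempty _ (by omega)) (interval_ne_univ _ (by omega))

/-- Direct sums are trivially retracts of direct sums. The converse holds because a retract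
decomposes again over a Schur family, so closure under retracts adds no objects. -/
theorem isPgr_iff (hd : 2 ≤ d) (X : HMF d) : isPgr d X ↔ IsSummand (simples d) X := by
  constructor
  · rintro ⟨n, a, l, hl, h⟩
    exact IsSummand.of_isDirectSum h fun k =>
      IsSummand.self (simples d) (a k, ⟨l k, by have := hl k; omega⟩)
  · intro h
    obtain ⟨n, b, hb⟩ := isSchurFamily_simples.exists_isDirectSum h
    refine ⟨n, fun k => (b k).1, fun k => (b k).2, fun k => Nat.le_of_lt_succ ?_, hb⟩
    exact (b k).2.isLt.trans_le (by omega)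

theorem IsSummand.of_isZero {C : Type*} [Category C] [Preadditive C] {ι : Type} (S : ι → C)
    {X : C} (h : Limits.IsZero X) : IsSummand S X :=
  ⟨Empty, inferInstance, fun e => e.elim, fun e => e.elim, fun e => e.elim, h.eq_of_src _ _⟩

/-- Covers the two extremes `k = 0` and `k = d`, where the object is zero and counts as the empty
sum. The fusion arguments can thus treat all interval lengths uniformly. -/
theorem isSummand_hatP_interval (a : ZMod d) {k : ℕ} (hk : k ≤ d) :
    IsSummand (simples d) (hatP d (interval d a k)) := by
  rcases Nat.eq_zero_or_pos k with rfl | h0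
  · exact .of_isZero _ isZero_hatP_empty
  rcases hk.eq_or_lt with rfl | h1
  · rw [interval_self]
    exact .of_isZero _ isZero_hatP_univ
  · obtain ⟨l, rfl⟩ : ∃ l, k = l + 1 := ⟨k - 1, by omega⟩
    exact IsSummand.self (simples d) (a, ⟨l, by omega⟩)

open Classical in
theorem finrank_hom_hatP (i : ZMod d × Fin (d - 1)) (T : Finset (ZMod d)) :
    Module.finrank ℂ (simples d i ⟶ hatP d T) =
      if interval d i.1 (i.2 + 1) = T then 1 else 0 := by
  split_ifs with h
  · subst h
    exact finrank_eq_one (𝟙 (simples d i)) (isSchurFamily_simples.id_ne_zero i) fun f => by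
      obtain ⟨c, hc⟩ := isSchurFamily_simples.exists_smul_id i f
      exact ⟨c, hc.symm⟩
  · have : Subsingleton (simples d i ⟶ hatP d T) :=
      ⟨fun f g => (hom_hatP_eq_zero h f).trans (hom_hatP_eq_zero h g).symm⟩
    exact Module.finrank_zero_of_subsingleton

instance : Limits.HasFiniteBiproducts (HMF d) := by
  -- The contractible object `P̂_∅` serves as zero object.
  have : Limits.HasZeroObject (HMF d) := ⟨⟨_, isZero_hatP_empty⟩⟩
  have : Limits.HasFiniteProducts (HMF d) := hasFiniteProducts_of_has_binary_and_terminal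
  exact Limits.HasFiniteBiproducts.of_hasFiniteProducts

end Simples

/-! ### Functoriality of the tensor product -/

namespace BTensor

variable {M N M' N' M'' N'' : Type*} [AddCommGroup M] [Module ℂ M] [Module Poly M]
  [IsScalarTower ℂ Poly M] [AddCommGroup N] [Module ℂ N] [Module Poly N] [IsScalarTower ℂ Poly N]
  [AddCommGroup M'] [Module ℂ M'] [Module Poly M'] [IsScalarTower ℂ Poly M']
  [AddCommGroup N'] [Module ℂ N'] [Module Poly N'] [IsScalarTower ℂ Poly N']
  [AddCommGroup M''] [Module ℂ M''] [Module Poly M''] [IsScalarTower ℂ Poly M'']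
  [AddCommGroup N''] [Module ℂ N''] [Module Poly N''] [IsScalarTower ℂ Poly N'']

theorem map_map (f : M →ₗ[Poly] M') (g : N →ₗ[Poly] N') (f' : M' →ₗ[Poly] M'')
    (g' : N' →ₗ[Poly] N'') (t : BTensor M N) :
    map f' g' (map f g t) = map (f' ∘ₗ f) (g' ∘ₗ g) t := by
  induction t using induction_on with
  | h1 m n => rfl
  | h2 s t hs ht => simp only [map_add, hs, ht]

theorem map_id_id (t : BTensor M N) : map LinearMap.id LinearMap.id t = t := by
  induction t using induction_on with
  | h1 m n => rfl
  | h2 s t hs ht => simp only [map_add, hs, ht]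

theorem map_comp_id (f : M →ₗ[Poly] M') (f' : M' →ₗ[Poly] M'') (t : BTensor M N) :
    map (f' ∘ₗ f) LinearMap.id t =
      map f' LinearMap.id (map f (LinearMap.id : N →ₗ[Poly] N) t) := by
  rw [map_map, LinearMap.id_comp]

theorem map_id_comp (g : N →ₗ[Poly] N') (g' : N' →ₗ[Poly] N'') (t : BTensor M N) :
    map LinearMap.id (g' ∘ₗ g) t =
      map LinearMap.id g' (map (LinearMap.id : M →ₗ[Poly] M) g t) := by
  rw [map_map, LinearMap.id_comp]

theorem map_add_left (f f' : M →ₗ[Poly] M') (g : N →ₗ[Poly] N') (t : BTensor M N) :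
    map (f + f') g t = map f g t + map f' g t := by
  induction t using induction_on with
  | h1 m n => exact add_tmul _ _ _
  | h2 s t hs ht => simp only [map_add, hs, ht]; abel

theorem map_add_right (f : M →ₗ[Poly] M') (g g' : N →ₗ[Poly] N') (t : BTensor M N) :
    map f (g + g') t = map f g t + map f g' t := by
  induction t using induction_on with
  | h1 m n => exact tmul_add _ _ _
  | h2 s t hs ht => simp only [map_add, hs, ht]; abel

theorem map_sub_left (f f' : M →ₗ[Poly] M') (g : N →ₗ[Poly] N') (t : BTensor M N) :
    map (f - f') g t = map f g t - map f' g t := by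
  rw [eq_sub_iff_add_eq, ← map_add_left, sub_add_cancel]

theorem map_sub_right (f : M →ₗ[Poly] M') (g g' : N →ₗ[Poly] N') (t : BTensor M N) :
    map f (g - g') t = map f g t - map f g' t := by
  rw [eq_sub_iff_add_eq, ← map_add_right, sub_add_cancel]

end BTensor

theorem GrBimod.HasDegree.neg {d : ℕ} {M N : GrBimod d} {c : ℂ} {f : M →ₗ[Poly] N}
    (h : GrBimod.HasDegree c f) : GrBimod.HasDegree c (-f) :=
  fun q m hm => Submodule.neg_mem _ (h q m hm)

theorem GrBimod.HasDegree.prodMap {d : ℕ} {M M' N N' : GrBimod d} {c : ℂ} {f : M →ₗ[Poly] N}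
    {f' : M' →ₗ[Poly] N'} (h : GrBimod.HasDegree c f) (h' : GrBimod.HasDegree c f') :
    GrBimod.HasDegree (M := M.prod M') (N := N.prod N') c (f.prodMap f') :=
  fun q _ hm => ⟨h q _ hm.1, h' q _ hm.2⟩

theorem GrBimod.hasDegree_zero_iff {d : ℕ} {M N : GrBimod d} {f : M →ₗ[Poly] N} :
    GrBimod.HasDegree 0 f ↔ ∀ q, ∀ m ∈ M.deg q, f m ∈ N.deg q := by
  simp only [GrBimod.HasDegree, add_zero]

namespace GrMF

variable {d : ℕ}

theorem hom_ext {M N : GrMF d} {f g : M ⟶ N} (h0 : ∀ m, f.1.1 m = g.1.1 m)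
    (h1 : ∀ m, f.1.2 m = g.1.2 m) : f = g :=
  Subtype.ext (Prod.ext (LinearMap.ext h0) (LinearMap.ext h1))

/-- The morphism `f ⊗ N`. -/
def tensorMapRight (N : GrMF d) {M M' : GrMF d} (f : M ⟶ M') :
    M.tensor N ⟶ M'.tensor N := ⟨(LinearMap.prodMap (BTensor.map f.1.1 LinearMap.id)
      (BTensor.map f.1.2 LinearMap.id), LinearMap.prodMap (BTensor.map f.1.2 LinearMap.id)
      (BTensor.map f.1.1 LinearMap.id)), by
    have h0 := GrBimod.hasDegree_zero_iff.mpr f.2.1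
    have h1 := GrBimod.hasDegree_zero_iff.mpr f.2.2.1
    refine ⟨GrBimod.hasDegree_zero_iff.mp (h0.map_id_right.prodMap h1.map_id_right),
      GrBimod.hasDegree_zero_iff.mp (h1.map_id_right.prodMap h0.map_id_right), ?_, ?_⟩
    · refine LinearMap.ext ?_
      rintro ⟨s, t⟩
      refine Prod.ext ?_ ?_
      · change BTensor.map f.1.1 LinearMap.id (BTensor.map M.d1 LinearMap.id s +
          BTensor.map LinearMap.id N.d1 t) =
          BTensor.map M'.d1 LinearMap.id (BTensor.map f.1.2 LinearMap.id s) +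
            BTensor.map LinearMap.id N.d1 (BTensor.map f.1.1 LinearMap.id t)
        simp only [map_add, BTensor.map_map, f.2.2.2.1, LinearMap.id_comp, LinearMap.comp_id]
      · change BTensor.map f.1.2 LinearMap.id (-BTensor.map LinearMap.id N.d0 s +
          BTensor.map M.d0 LinearMap.id t) =
          -BTensor.map LinearMap.id N.d0 (BTensor.map f.1.2 LinearMap.id s) +
            BTensor.map M'.d0 LinearMap.id (BTensor.map f.1.1 LinearMap.id t)
        simp only [map_add, map_neg, BTensor.map_map, f.2.2.2.2, LinearMap.id_comp,
          LinearMap.comp_id]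
    · refine LinearMap.ext ?_
      rintro ⟨s, t⟩
      refine Prod.ext ?_ ?_
      · change BTensor.map f.1.2 LinearMap.id (BTensor.map M.d0 LinearMap.id s +
          -BTensor.map LinearMap.id N.d1 t) =
          BTensor.map M'.d0 LinearMap.id (BTensor.map f.1.1 LinearMap.id s) +
            -BTensor.map LinearMap.id N.d1 (BTensor.map f.1.2 LinearMap.id t)
        simp only [map_add, map_neg, BTensor.map_map, f.2.2.2.2, LinearMap.id_comp,
          LinearMap.comp_id]
      · change BTensor.map f.1.1 LinearMap.id (BTensor.map LinearMap.id N.d0 s +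
          BTensor.map M.d1 LinearMap.id t) =
          BTensor.map LinearMap.id N.d0 (BTensor.map f.1.1 LinearMap.id s) +
            BTensor.map M'.d1 LinearMap.id (BTensor.map f.1.2 LinearMap.id t)
        simp only [map_add, BTensor.map_map, f.2.2.2.1, LinearMap.id_comp,
          LinearMap.comp_id]⟩

/-- The functor `- ⊗ N` on cycles. -/
def tensorRight (N : GrMF d) : GrMF d ⥤ GrMF d where
  obj M := M.tensor N
  map f := N.tensorMapRight f
  map_id _ := hom_ext (fun _ => Prod.ext (BTensor.map_id_id _) (BTensor.map_id_id _))
    (fun _ => Prod.ext (BTensor.map_id_id _) (BTensor.map_id_id _))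
  map_comp f g := hom_ext
    (fun s => Prod.ext (BTensor.map_comp_id f.1.1 g.1.1 s.1) (BTensor.map_comp_id f.1.2 g.1.2 s.2))
    (fun s => Prod.ext (BTensor.map_comp_id f.1.2 g.1.2 s.1) (BTensor.map_comp_id f.1.1 g.1.1 s.2))

instance (N : GrMF d) : (tensorRight N).Additive where
  map_add := hom_ext
    (fun _ => Prod.ext (BTensor.map_add_left _ _ _ _) (BTensor.map_add_left _ _ _ _))
    (fun _ => Prod.ext (BTensor.map_add_left _ _ _ _) (BTensor.map_add_left _ _ _ _))

/-- The homotopy is `h ⊗ 1`. No sign appears because the odd map `h` stands to the left; it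
anticommutes with `1 ⊗ d` by the Koszul sign already in the differential. -/
theorem Homotopic.tensorRight {M M' : GrMF d} (N : GrMF d) {f g : M ⟶ M'}
    (h : Homotopic f g) : Homotopic ((tensorRight N).map f) ((tensorRight N).map g) := by
  obtain ⟨h0, h1, ha, hb, hc, he⟩ := h
  refine ⟨LinearMap.prodMap (BTensor.map h0 LinearMap.id) (BTensor.map h1 LinearMap.id),
    LinearMap.prodMap (BTensor.map h1 LinearMap.id) (BTensor.map h0 LinearMap.id),
    ha.map_id_right.prodMap hb.map_id_right, hb.map_id_right.prodMap ha.map_id_right, ?_, ?_⟩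
  · refine LinearMap.ext ?_
    rintro ⟨s, t⟩
    refine Prod.ext ?_ ?_
    · change BTensor.map f.1.1 LinearMap.id s - BTensor.map g.1.1 LinearMap.id s =
        BTensor.map M'.d1 LinearMap.id (BTensor.map h0 LinearMap.id s) +
        BTensor.map LinearMap.id N.d1 (BTensor.map h1 LinearMap.id t) +
        BTensor.map h1 LinearMap.id (BTensor.map M.d0 LinearMap.id s +
          -BTensor.map LinearMap.id N.d1 t)
      rw [← BTensor.map_sub_left, hc]
      simp only [map_add, map_neg, BTensor.map_map, BTensor.map_add_left, LinearMap.id_comp,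
        LinearMap.comp_id]
      abel
    · change BTensor.map f.1.2 LinearMap.id t - BTensor.map g.1.2 LinearMap.id t =
        -BTensor.map LinearMap.id N.d0 (BTensor.map h0 LinearMap.id s) +
        BTensor.map M'.d0 LinearMap.id (BTensor.map h1 LinearMap.id t) +
        BTensor.map h0 LinearMap.id (BTensor.map LinearMap.id N.d0 s +
          BTensor.map M.d1 LinearMap.id t)
      rw [← BTensor.map_sub_left, he]
      simp only [map_add, BTensor.map_map, BTensor.map_add_left, LinearMap.id_comp,
        LinearMap.comp_id]
      abel
  · refine LinearMap.ext ?_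
    rintro ⟨s, t⟩
    refine Prod.ext ?_ ?_
    · change BTensor.map f.1.2 LinearMap.id s - BTensor.map g.1.2 LinearMap.id s =
        BTensor.map M'.d0 LinearMap.id (BTensor.map h1 LinearMap.id s) +
        -BTensor.map LinearMap.id N.d1 (BTensor.map h0 LinearMap.id t) +
        BTensor.map h0 LinearMap.id (BTensor.map M.d1 LinearMap.id s +
          BTensor.map LinearMap.id N.d1 t)
      rw [← BTensor.map_sub_left, he]
      simp only [map_add, BTensor.map_map, BTensor.map_add_left, LinearMap.id_comp,
        LinearMap.comp_id]
      abel
    · change BTensor.map f.1.1 LinearMap.id t - BTensor.map g.1.1 LinearMap.id t =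
        BTensor.map LinearMap.id N.d0 (BTensor.map h1 LinearMap.id s) +
        BTensor.map M'.d1 LinearMap.id (BTensor.map h0 LinearMap.id t) +
        BTensor.map h1 LinearMap.id (-BTensor.map LinearMap.id N.d0 s +
          BTensor.map M.d0 LinearMap.id t)
      rw [← BTensor.map_sub_left, hc]
      simp only [map_add, map_neg, BTensor.map_map, BTensor.map_add_left, LinearMap.id_comp,
        LinearMap.comp_id]
      abel

/-- The morphism `M ⊗ f`. -/
def tensorMapLeft (M : GrMF d) {N N' : GrMF d} (f : N ⟶ N') :
    M.tensor N ⟶ M.tensor N' := ⟨(LinearMap.prodMap (BTensor.map LinearMap.id f.1.1)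
      (BTensor.map LinearMap.id f.1.2), LinearMap.prodMap (BTensor.map LinearMap.id f.1.1)
      (BTensor.map LinearMap.id f.1.2)), by
    have h0 := GrBimod.hasDegree_zero_iff.mpr f.2.1
    have h1 := GrBimod.hasDegree_zero_iff.mpr f.2.2.1
    refine ⟨GrBimod.hasDegree_zero_iff.mp (h0.map_id_left.prodMap h1.map_id_left),
      GrBimod.hasDegree_zero_iff.mp (h0.map_id_left.prodMap h1.map_id_left), ?_, ?_⟩
    · refine LinearMap.ext ?_
      rintro ⟨s, t⟩
      refine Prod.ext ?_ ?_
      · change BTensor.map LinearMap.id f.1.1 (BTensor.map M.d1 LinearMap.id s +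
          BTensor.map LinearMap.id N.d1 t) =
          BTensor.map M.d1 LinearMap.id (BTensor.map LinearMap.id f.1.1 s) +
            BTensor.map LinearMap.id N'.d1 (BTensor.map LinearMap.id f.1.2 t)
        simp only [map_add, BTensor.map_map, f.2.2.2.1, LinearMap.id_comp, LinearMap.comp_id]
      · change BTensor.map LinearMap.id f.1.2 (-BTensor.map LinearMap.id N.d0 s +
          BTensor.map M.d0 LinearMap.id t) =
          -BTensor.map LinearMap.id N'.d0 (BTensor.map LinearMap.id f.1.1 s) +
            BTensor.map M.d0 LinearMap.id (BTensor.map LinearMap.id f.1.2 t)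
        simp only [map_add, map_neg, BTensor.map_map, f.2.2.2.2, LinearMap.id_comp,
          LinearMap.comp_id]
    · refine LinearMap.ext ?_
      rintro ⟨s, t⟩
      refine Prod.ext ?_ ?_
      · change BTensor.map LinearMap.id f.1.1 (BTensor.map M.d0 LinearMap.id s +
          -BTensor.map LinearMap.id N.d1 t) =
          BTensor.map M.d0 LinearMap.id (BTensor.map LinearMap.id f.1.1 s) +
            -BTensor.map LinearMap.id N'.d1 (BTensor.map LinearMap.id f.1.2 t)
        simp only [map_add, map_neg, BTensor.map_map, f.2.2.2.1, LinearMap.id_comp,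
          LinearMap.comp_id]
      · change BTensor.map LinearMap.id f.1.2 (BTensor.map LinearMap.id N.d0 s +
          BTensor.map M.d1 LinearMap.id t) =
          BTensor.map LinearMap.id N'.d0 (BTensor.map LinearMap.id f.1.1 s) +
            BTensor.map M.d1 LinearMap.id (BTensor.map LinearMap.id f.1.2 t)
        simp only [map_add, BTensor.map_map, f.2.2.2.2, LinearMap.id_comp,
          LinearMap.comp_id]⟩

/-- The functor `M ⊗ -` on cycles. -/
def tensorLeft (M : GrMF d) : GrMF d ⥤ GrMF d where
  obj N := M.tensor N
  map f := M.tensorMapLeft f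
  map_id _ := hom_ext (fun _ => Prod.ext (BTensor.map_id_id _) (BTensor.map_id_id _))
    (fun _ => Prod.ext (BTensor.map_id_id _) (BTensor.map_id_id _))
  map_comp f g := hom_ext
    (fun s => Prod.ext (BTensor.map_id_comp f.1.1 g.1.1 s.1) (BTensor.map_id_comp f.1.2 g.1.2 s.2))
    (fun s => Prod.ext (BTensor.map_id_comp f.1.1 g.1.1 s.1) (BTensor.map_id_comp f.1.2 g.1.2 s.2))

instance (M : GrMF d) : (tensorLeft M).Additive where
  map_add := hom_ext
    (fun _ => Prod.ext (BTensor.map_add_right _ _ _ _) (BTensor.map_add_right _ _ _ _))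
    (fun _ => Prod.ext (BTensor.map_add_right _ _ _ _) (BTensor.map_add_right _ _ _ _))

theorem Homotopic.tensorLeft (M : GrMF d) {N N' : GrMF d} {f g : N ⟶ N'}
    (h : Homotopic f g) : Homotopic ((tensorLeft M).map f) ((tensorLeft M).map g) := by
  obtain ⟨h0, h1, ha, hb, hc, he⟩ := h
  -- The homotopy is `1 ⊗ h` with the Koszul sign of moving the odd `h` past `M`: plus on `M₀`,
  -- minus on `M₁`.
  refine ⟨LinearMap.coprod
      (LinearMap.inr _ _ _ ∘ₗ BTensor.map LinearMap.id h0)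
      (LinearMap.inl _ _ _ ∘ₗ (-BTensor.map LinearMap.id h1)),
    LinearMap.coprod
      (LinearMap.inr _ _ _ ∘ₗ (-BTensor.map LinearMap.id h0))
      (LinearMap.inl _ _ _ ∘ₗ BTensor.map LinearMap.id h1), ?_, ?_, ?_, ?_⟩
  · rintro q ⟨s, t⟩ ⟨hs, ht⟩
    exact ⟨Submodule.add_mem _ (Submodule.zero_mem _) (hb.map_id_left.neg q t ht),
      Submodule.add_mem _ (ha.map_id_left q s hs) (Submodule.zero_mem _)⟩
  · rintro q ⟨s, t⟩ ⟨hs, ht⟩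
    exact ⟨Submodule.add_mem _ (Submodule.zero_mem _) (hb.map_id_left q t ht),
      Submodule.add_mem _ (ha.map_id_left.neg q s hs) (Submodule.zero_mem _)⟩
  · refine LinearMap.ext ?_
    rintro ⟨s, t⟩
    refine Prod.ext ?_ ?_
    · change BTensor.map LinearMap.id f.1.1 s - BTensor.map LinearMap.id g.1.1 s =
        BTensor.map M.d1 LinearMap.id (0 + -BTensor.map LinearMap.id h1 t) +
        BTensor.map LinearMap.id N'.d1 (BTensor.map LinearMap.id h0 s + 0) +
        (0 + BTensor.map LinearMap.id h1 (BTensor.map LinearMap.id N.d0 s +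
          BTensor.map M.d1 LinearMap.id t))
      rw [← BTensor.map_sub_right, hc]
      simp only [map_add, map_neg, map_zero, BTensor.map_map, BTensor.map_add_right,
        LinearMap.id_comp, LinearMap.comp_id]
      abel
    · change BTensor.map LinearMap.id f.1.2 t - BTensor.map LinearMap.id g.1.2 t =
        -BTensor.map LinearMap.id N'.d0 (0 + -BTensor.map LinearMap.id h1 t) +
        BTensor.map M.d0 LinearMap.id (BTensor.map LinearMap.id h0 s + 0) +
        (-BTensor.map LinearMap.id h0 (BTensor.map M.d0 LinearMap.id s +
          -BTensor.map LinearMap.id N.d1 t) + 0)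
      rw [← BTensor.map_sub_right, he]
      simp only [map_add, map_neg, map_zero, BTensor.map_map, BTensor.map_add_right,
        LinearMap.id_comp, LinearMap.comp_id]
      abel
  · refine LinearMap.ext ?_
    rintro ⟨s, t⟩
    refine Prod.ext ?_ ?_
    · change BTensor.map LinearMap.id f.1.1 s - BTensor.map LinearMap.id g.1.1 s =
        BTensor.map M.d0 LinearMap.id (0 + BTensor.map LinearMap.id h1 t) +
        -BTensor.map LinearMap.id N'.d1 (-BTensor.map LinearMap.id h0 s + 0) +
        (0 + -BTensor.map LinearMap.id h1 (-BTensor.map LinearMap.id N.d0 s +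
          BTensor.map M.d0 LinearMap.id t))
      rw [← BTensor.map_sub_right, hc]
      simp only [map_add, map_neg, map_zero, BTensor.map_map, BTensor.map_add_right,
        LinearMap.id_comp, LinearMap.comp_id]
      abel
    · change BTensor.map LinearMap.id f.1.2 t - BTensor.map LinearMap.id g.1.2 t =
        BTensor.map LinearMap.id N'.d0 (0 + BTensor.map LinearMap.id h1 t) +
        BTensor.map M.d1 LinearMap.id (-BTensor.map LinearMap.id h0 s + 0) +
        (BTensor.map LinearMap.id h0 (BTensor.map M.d1 LinearMap.id s +
          BTensor.map LinearMap.id N.d1 t) + 0)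
      rw [← BTensor.map_sub_right, he]
      simp only [map_add, map_neg, map_zero, BTensor.map_map, BTensor.map_add_right,
        LinearMap.id_comp, LinearMap.comp_id]
      abel

end GrMF

open GrMF

/-- The functor `- ⊗ N` on `HMF^gr_bi`. -/
def HMF.tensorRight {d : ℕ} (N : HMF d) : HMF d ⥤ HMF d :=
  CategoryTheory.Quotient.lift _ (GrMF.tensorRight N.as ⋙ toHMF d) fun _ _ _ _ h =>
    CategoryTheory.Quotient.sound _ (h.tensorRight N.as)

/-- The functor `M ⊗ -` on `HMF^gr_bi`. -/
def HMF.tensorLeft {d : ℕ} (M : HMF d) : HMF d ⥤ HMF d :=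
  CategoryTheory.Quotient.lift _ (GrMF.tensorLeft M.as ⋙ toHMF d) fun _ _ _ _ h =>
    CategoryTheory.Quotient.sound _ (h.tensorLeft M.as)

instance {d : ℕ} (N : HMF d) : (HMF.tensorRight N).Additive where
  map_add {X Y f g} := by
    obtain ⟨f, rfl⟩ := (toHMF d).map_surjective f
    obtain ⟨g, rfl⟩ := (toHMF d).map_surjective g
    exact (GrMF.tensorRight N.as ⋙ toHMF d).map_add

instance {d : ℕ} (M : HMF d) : (HMF.tensorLeft M).Additive where
  map_add {X Y f g} := by
    obtain ⟨f, rfl⟩ := (toHMF d).map_surjective f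
    obtain ⟨g, rfl⟩ := (toHMF d).map_surjective g
    exact (GrMF.tensorLeft M.as ⋙ toHMF d).map_add

theorem IsDirectSum.tensor_right {d : ℕ} {K : Type} [Finite K] {X : HMF d} {F : K → HMF d}
    (h : IsDirectSum X F) (N : HMF d) : IsDirectSum (X.tensor N) fun k => (F k).tensor N :=
  h.map (HMF.tensorRight N)

theorem IsDirectSum.tensor_left {d : ℕ} {K : Type} [Finite K] {X : HMF d} {F : K → HMF d}
    (h : IsDirectSum X F) (M : HMF d) : IsDirectSum (M.tensor X) fun k => M.tensor (F k) :=
  h.map (HMF.tensorLeft M)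

/-! ### Associativity of the tensor product -/

/-- A `ℂ`-linear map that commutes with `x` and `y` is a bimodule map. -/
def polyLinearMap {V W : Type*} [AddCommGroup V] [Module ℂ V] [Module Poly V]
    [IsScalarTower ℂ Poly V] [AddCommGroup W] [Module ℂ W] [Module Poly W]
    [IsScalarTower ℂ Poly W] (f : V →ₗ[ℂ] W) (hx : ∀ v, f (vx • v) = vx • f v)
    (hy : ∀ v, f (vy • v) = vy • f v) : V →ₗ[Poly] W where
  toFun := f
  map_add' := map_add f
  map_smul' p v := by
    induction p using MvPolynomial.induction_on generalizing v with
    | C a =>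
      rw [← MvPolynomial.algebraMap_eq, RingHom.id_apply, algebraMap_smul, algebraMap_smul,
        map_smul]
    | add p q hp hq => simp only [add_smul, map_add, hp, hq, RingHom.id_apply]
    | mul_X p i hp =>
      simp only [RingHom.id_apply] at hp ⊢
      rw [mul_smul, mul_smul, hp]
      fin_cases i
      · exact congrArg (p • ·) (hx v)
      · exact congrArg (p • ·) (hy v)

namespace BTensor

variable {M N V : Type*} [AddCommGroup M] [Module ℂ M] [Module Poly M]
  [IsScalarTower ℂ Poly M] [AddCommGroup N] [Module ℂ N] [Module Poly N] [IsScalarTower ℂ Poly N]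
  [AddCommGroup V] [Module ℂ V] [Module Poly V] [IsScalarTower ℂ Poly V]

variable (M N) in
/-- The universal balanced map. -/
def mk : M →ₗ[ℂ] N →ₗ[ℂ] BTensor M N :=
  LinearMap.mk₂ ℂ tmul add_tmul smul_tmul_complex tmul_add tmul_smul_complex

theorem zero_tmul (n : N) : tmul (0 : M) n = 0 := (mk M N).map_zero₂ n

theorem tmul_zero (m : M) : tmul m (0 : N) = 0 := (mk M N m).map_zero

theorem neg_tmul (m : M) (n : N) : tmul (-m) n = -tmul m n := (mk M N).map_neg₂ m n

theorem tmul_neg (m : M) (n : N) : tmul m (-n) = -tmul m n := (mk M N m).map_neg n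

/-- Descent of a balanced bilinear map of bimodules to a bimodule map. -/
def liftPoly (φ : M →ₗ[ℂ] N →ₗ[ℂ] V) (h : ∀ m n, φ (vy • m) n = φ m (vx • n))
    (hx : ∀ m n, φ (vx • m) n = vx • φ m n) (hy : ∀ m n, φ m (vy • n) = vy • φ m n) :
    BTensor M N →ₗ[Poly] V :=
  polyLinearMap (lift (TensorProduct.lift φ) fun m n => by simpa using h m n)
    (fun t => by
      induction t using induction_on with
      | h1 m n => rw [vx_smul_tmul, lift_tmul, lift_tmul]; simpa using hx m n
      | h2 s t hs ht => rw [smul_add, map_add, hs, ht, map_add, smul_add])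
    (fun t => by
      induction t using induction_on with
      | h1 m n => rw [vy_smul_tmul, lift_tmul, lift_tmul]; simpa using hy m n
      | h2 s t hs ht => rw [smul_add, map_add, hs, ht, map_add, smul_add])

variable {A B C : Type*} [AddCommGroup A] [Module ℂ A] [Module Poly A] [IsScalarTower ℂ Poly A]
  [AddCommGroup B] [Module ℂ B] [Module Poly B] [IsScalarTower ℂ Poly B]
  [AddCommGroup C] [Module ℂ C] [Module Poly C] [IsScalarTower ℂ Poly C]

variable (A B C) in
/-- The map `(a ⊗ b) ⊗ c ↦ a ⊗ (b ⊗ c)`. -/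
def assoc : BTensor (BTensor A B) C →ₗ[Poly] BTensor A (BTensor B C) :=
  let φ : BTensor A B →ₗ[ℂ] C →ₗ[ℂ] BTensor A (BTensor B C) :=
    lift (TensorProduct.lift (LinearMap.mk₂ ℂ (fun a b => mk A (BTensor B C) a ∘ₗ mk B C b)
      (fun a a' b => by rw [map_add, LinearMap.add_comp])
      (fun c a b => by rw [map_smul, LinearMap.smul_comp])
      (fun a b b' => by rw [map_add, LinearMap.comp_add])
      (fun c a b => by rw [map_smul, LinearMap.comp_smul])))
      (fun a b => by
        ext c
        change tmul (vy • a) (tmul b c) = tmul a (tmul (vx • b) c)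
        rw [smul_vy_tmul, vx_smul_tmul])
  have hφ : ∀ a b c, φ (tmul a b) c = tmul a (tmul b c) := fun a b c => rfl
  liftPoly φ
    (fun t c => by
      induction t using induction_on with
      | h1 a b => rw [vy_smul_tmul, hφ, hφ, smul_vy_tmul]
      | h2 s t hs ht => simp only [smul_add, map_add, LinearMap.add_apply, hs, ht])
    (fun t c => by
      induction t using induction_on with
      | h1 a b => rw [vx_smul_tmul, hφ, hφ, vx_smul_tmul]
      | h2 s t hs ht => simp only [smul_add, map_add, LinearMap.add_apply, hs, ht])
    (fun t c => by
      induction t using induction_on with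
      | h1 a b => rw [hφ, hφ, vy_smul_tmul, vy_smul_tmul]
      | h2 s t hs ht => simp only [smul_add, map_add, LinearMap.add_apply, hs, ht])

theorem assoc_tmul (a : A) (b : B) (c : C) :
    assoc A B C (tmul (tmul a b) c) = tmul a (tmul b c) := rfl

variable (A B C) in
/-- The map `a ⊗ (b ⊗ c) ↦ (a ⊗ b) ⊗ c`. -/
def assocInv : BTensor A (BTensor B C) →ₗ[Poly] BTensor (BTensor A B) C :=
  let φ : BTensor B C →ₗ[ℂ] A →ₗ[ℂ] BTensor (BTensor A B) C :=
    lift (TensorProduct.lift (LinearMap.mk₂ ℂ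
      (fun b c => (mk (BTensor A B) C).flip c ∘ₗ (mk A B).flip b)
      (fun a a' b => by rw [map_add, LinearMap.comp_add])
      (fun c a b => by rw [map_smul, LinearMap.comp_smul])
      (fun a b b' => by rw [map_add, LinearMap.add_comp])
      (fun c a b => by rw [map_smul, LinearMap.smul_comp])))
      (fun b c => by
        ext a
        change tmul (tmul a (vy • b)) c = tmul (tmul a b) (vx • c)
        rw [← smul_vy_tmul, vy_smul_tmul])
  have hφ : ∀ a b c, φ (tmul b c) a = tmul (tmul a b) c := fun a b c => rfl
  liftPoly φ.flip
    (fun a t => by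
      simp only [LinearMap.flip_apply]
      induction t using induction_on with
      | h1 b c => rw [vx_smul_tmul, hφ, hφ, smul_vy_tmul]
      | h2 s t hs ht => simp only [smul_add, map_add, LinearMap.add_apply, hs, ht])
    (fun a t => by
      simp only [LinearMap.flip_apply]
      induction t using induction_on with
      | h1 b c => rw [hφ, hφ, vx_smul_tmul, vx_smul_tmul]
      | h2 s t hs ht => simp only [smul_add, map_add, LinearMap.add_apply, hs, ht])
    (fun a t => by
      simp only [LinearMap.flip_apply]
      induction t using induction_on with
      | h1 b c => rw [vy_smul_tmul, hφ, hφ, vy_smul_tmul]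
      | h2 s t hs ht => simp only [smul_add, map_add, LinearMap.add_apply, hs, ht])

theorem assocInv_tmul (a : A) (b : B) (c : C) :
    assocInv A B C (tmul a (tmul b c)) = tmul (tmul a b) c := rfl

end BTensor

/-- Homogeneous pieces of a tensor product are spanned by homogeneous pure tensors, so degree
conditions need to be tested only on these. -/
theorem BTensor.deg_le {M N V : Type*} [AddCommGroup M] [Module ℂ M] [Module Poly M]
    [IsScalarTower ℂ Poly M] [AddCommGroup N] [Module ℂ N] [Module Poly N]
    [IsScalarTower ℂ Poly N] [AddCommGroup V] [Module ℂ V] {GM : ℂ → Submodule ℂ M}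
    {GN : ℂ → Submodule ℂ N} {q : ℂ} (f : BTensor M N →ₗ[ℂ] V) (G : Submodule ℂ V)
    (h : ∀ a b, ∀ m ∈ GM a, ∀ n ∈ GN b, a + b = q → f (tmul m n) ∈ G) :
    ∀ t ∈ BTensor.deg GM GN q, f t ∈ G := by
  change BTensor.deg GM GN q ≤ G.comap f
  refine Submodule.span_le.mpr ?_
  rintro _ ⟨a, b, m, hm, n, hn, hq, rfl⟩
  exact h a b m hm n hn hq

theorem BTensor.tmul_mem_deg {M N : Type*} [AddCommGroup M] [Module ℂ M] [Module Poly M]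
    [IsScalarTower ℂ Poly M] [AddCommGroup N] [Module ℂ N] [Module Poly N]
    [IsScalarTower ℂ Poly N] {GM : ℂ → Submodule ℂ M} {GN : ℂ → Submodule ℂ N} {a b q : ℂ}
    {m : M} {n : N} (hm : m ∈ GM a) (hn : n ∈ GN b) (h : a + b = q) :
    tmul m n ∈ BTensor.deg GM GN q :=
  Submodule.subset_span ⟨a, b, m, hm, n, hn, h, rfl⟩

theorem GrBimod.hasDegree_assoc {d : ℕ} (A B C : GrBimod d) :
    GrBimod.HasDegree (M := (A.tensor B).tensor C) (N := A.tensor (B.tensor C)) 0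
      (BTensor.assoc A B C) := by
  refine GrBimod.hasDegree_zero_iff.mpr fun q => BTensor.deg_le
    ((BTensor.assoc A B C).restrictScalars ℂ) _ fun u c s hs k hk huc => ?_
  refine BTensor.deg_le (((BTensor.assoc A B C).restrictScalars ℂ) ∘ₗ
    (BTensor.mk (BTensor A B) C).flip k) (BTensor.deg A.deg (BTensor.deg B.deg C.deg) q)
    (fun a b m hm n hn hab => ?_) s hs
  exact BTensor.tmul_mem_deg hm (BTensor.tmul_mem_deg hn hk rfl) (by rw [← huc, ← hab]; ring)

theorem GrBimod.hasDegree_assocInv {d : ℕ} (A B C : GrBimod d) :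
    GrBimod.HasDegree (M := A.tensor (B.tensor C)) (N := (A.tensor B).tensor C) 0
      (BTensor.assocInv A B C) := by
  refine GrBimod.hasDegree_zero_iff.mpr fun q => BTensor.deg_le
    ((BTensor.assocInv A B C).restrictScalars ℂ) _ fun a u m hm s hs hau => ?_
  refine BTensor.deg_le (((BTensor.assocInv A B C).restrictScalars ℂ) ∘ₗ
    BTensor.mk A (BTensor B C) m) (BTensor.deg (BTensor.deg A.deg B.deg) C.deg q)
    (fun b c n hn k hk hbc => ?_) s hs
  exact BTensor.tmul_mem_deg (BTensor.tmul_mem_deg hm hn rfl) hk (by rw [← hau, ← hbc]; ring)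

namespace BTensor

/-! ### Triple tensor products of `ℤ/2`-graded bimodules -/

section AssocSum

variable {A B C A' B' : Type*} [AddCommGroup A] [Module ℂ A] [Module Poly A]
  [IsScalarTower ℂ Poly A]
  [AddCommGroup B] [Module ℂ B] [Module Poly B] [IsScalarTower ℂ Poly B]
  [AddCommGroup C] [Module ℂ C] [Module Poly C] [IsScalarTower ℂ Poly C]
  [AddCommGroup A'] [Module ℂ A'] [Module Poly A'] [IsScalarTower ℂ Poly A']
  [AddCommGroup B'] [Module ℂ B'] [Module Poly B'] [IsScalarTower ℂ Poly B']

@[elab_as_elim]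
theorem induction_on_prod_left {P : BTensor (BTensor A B × BTensor A' B') C → Prop}
    (t : BTensor (BTensor A B × BTensor A' B') C)
    (hl : ∀ a b c, P (tmul (tmul a b, 0) c)) (hr : ∀ a b c, P (tmul (0, tmul a b) c))
    (h2 : ∀ s t, P s → P t → P (s + t)) : P t := by
  induction t using induction_on with
  | h2 s t hs ht => exact h2 s t hs ht
  | h1 s c =>
    obtain ⟨s, t⟩ := s
    rw [← Prod.fst_add_snd (s, t), add_tmul]
    refine h2 _ _ ?_ ?_
    · induction s using induction_on with
      | h1 a b => exact hl a b c
      | h2 s t hs ht => exact (by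
          simp only [← add_tmul, Prod.mk_add_mk, add_zero] :
          tmul (s, (0 : BTensor A' B')) c + tmul (t, 0) c = tmul (s + t, 0) c) ▸ h2 _ _ hs ht
    · induction t using induction_on with
      | h1 a b => exact hr a b c
      | h2 s t hs ht => exact (by
          simp only [← add_tmul, Prod.mk_add_mk, add_zero] :
          tmul ((0 : BTensor A B), s) c + tmul (0, t) c = tmul (0, s + t) c) ▸ h2 _ _ hs ht

@[elab_as_elim]
theorem induction_on_prod_right {P : BTensor C (BTensor A B × BTensor A' B') → Prop}
    (t : BTensor C (BTensor A B × BTensor A' B'))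
    (hl : ∀ a b c, P (tmul c (tmul a b, 0))) (hr : ∀ a b c, P (tmul c (0, tmul a b)))
    (h2 : ∀ s t, P s → P t → P (s + t)) : P t := by
  induction t using induction_on with
  | h2 s t hs ht => exact h2 s t hs ht
  | h1 c s =>
    obtain ⟨s, t⟩ := s
    rw [← Prod.fst_add_snd (s, t), tmul_add]
    refine h2 _ _ ?_ ?_
    · induction s using induction_on with
      | h1 a b => exact hl a b c
      | h2 s t hs ht => exact (by
          simp only [← tmul_add, Prod.mk_add_mk, add_zero] :
          tmul c (s, (0 : BTensor A' B')) + tmul c (t, 0) = tmul c (s + t, 0)) ▸ h2 _ _ hs ht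
    · induction t using induction_on with
      | h1 a b => exact hr a b c
      | h2 s t hs ht => exact (by
          simp only [← tmul_add, Prod.mk_add_mk, add_zero] :
          tmul c ((0 : BTensor A B), s) + tmul c (0, t) = tmul c (0, s + t)) ▸ h2 _ _ hs ht

variable (M0 M1 N0 N1 K0 K1 : Type*) [AddCommGroup M0] [Module ℂ M0] [Module Poly M0]
  [IsScalarTower ℂ Poly M0] [AddCommGroup M1] [Module ℂ M1] [Module Poly M1]
  [IsScalarTower ℂ Poly M1]
  [AddCommGroup N0] [Module ℂ N0] [Module Poly N0] [IsScalarTower ℂ Poly N0]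
  [AddCommGroup N1] [Module ℂ N1] [Module Poly N1] [IsScalarTower ℂ Poly N1]
  [AddCommGroup K0] [Module ℂ K0] [Module Poly K0] [IsScalarTower ℂ Poly K0]
  [AddCommGroup K1] [Module ℂ K1] [Module Poly K1] [IsScalarTower ℂ Poly K1]

/-- Reassociation of the homogeneous components of a triple tensor product. -/
def assocSum : BTensor (BTensor M0 N0 × BTensor M1 N1) K0 ×
      BTensor (BTensor M1 N0 × BTensor M0 N1) K1 →ₗ[Poly]
    BTensor M0 (BTensor N0 K0 × BTensor N1 K1) × BTensor M1 (BTensor N1 K0 × BTensor N0 K1) :=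
  -- No signs are needed. The map is set up on the even part of the triple product; exchanging the
  -- roles of `M0` and `M1` gives the odd part, so one definition serves both parities.
  LinearMap.prod
    (LinearMap.coprod
      (map LinearMap.id (LinearMap.inl _ _ _) ∘ₗ assoc _ _ _ ∘ₗ
        map (LinearMap.fst _ _ _) LinearMap.id)
      (map LinearMap.id (LinearMap.inr _ _ _) ∘ₗ assoc _ _ _ ∘ₗ
        map (LinearMap.snd _ _ _) LinearMap.id))
    (LinearMap.coprod
      (map LinearMap.id (LinearMap.inl _ _ _) ∘ₗ assoc _ _ _ ∘ₗ
        map (LinearMap.snd _ _ _) LinearMap.id)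
      (map LinearMap.id (LinearMap.inr _ _ _) ∘ₗ assoc _ _ _ ∘ₗ
        map (LinearMap.fst _ _ _) LinearMap.id))

/-- The inverse of `assocSum`. -/
def assocSumInv : BTensor M0 (BTensor N0 K0 × BTensor N1 K1) ×
      BTensor M1 (BTensor N1 K0 × BTensor N0 K1) →ₗ[Poly]
    BTensor (BTensor M0 N0 × BTensor M1 N1) K0 × BTensor (BTensor M1 N0 × BTensor M0 N1) K1 :=
  LinearMap.prod
    (LinearMap.coprod
      (map (LinearMap.inl _ _ _) LinearMap.id ∘ₗ assocInv _ _ _ ∘ₗ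
        map LinearMap.id (LinearMap.fst _ _ _))
      (map (LinearMap.inr _ _ _) LinearMap.id ∘ₗ assocInv _ _ _ ∘ₗ
        map LinearMap.id (LinearMap.fst _ _ _)))
    (LinearMap.coprod
      (map (LinearMap.inr _ _ _) LinearMap.id ∘ₗ assocInv _ _ _ ∘ₗ
        map LinearMap.id (LinearMap.snd _ _ _))
      (map (LinearMap.inl _ _ _) LinearMap.id ∘ₗ assocInv _ _ _ ∘ₗ
        map LinearMap.id (LinearMap.snd _ _ _)))

variable {M0 M1 N0 N1 K0 K1}

theorem assocSum_inl_fst (m : M0) (n : N0) (k : K0) :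
    assocSum M0 M1 N0 N1 K0 K1 (tmul (tmul m n, 0) k, 0) = (tmul m (tmul n k, 0), 0) := by
  simp [assocSum, map_tmul, assoc_tmul, zero_tmul]

theorem assocSum_inl_snd (m : M1) (n : N1) (k : K0) :
    assocSum M0 M1 N0 N1 K0 K1 (tmul (0, tmul m n) k, 0) = (0, tmul m (tmul n k, 0)) := by
  simp [assocSum, map_tmul, assoc_tmul, zero_tmul]

theorem assocSum_inr_fst (m : M1) (n : N0) (k : K1) :
    assocSum M0 M1 N0 N1 K0 K1 (0, tmul (tmul m n, 0) k) = (0, tmul m (0, tmul n k)) := by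
  simp [assocSum, map_tmul, assoc_tmul, zero_tmul]

theorem assocSum_inr_snd (m : M0) (n : N1) (k : K1) :
    assocSum M0 M1 N0 N1 K0 K1 (0, tmul (0, tmul m n) k) = (tmul m (0, tmul n k), 0) := by
  simp [assocSum, map_tmul, assoc_tmul, zero_tmul]

theorem assocSumInv_inl_fst (m : M0) (n : N0) (k : K0) :
    assocSumInv M0 M1 N0 N1 K0 K1 (tmul m (tmul n k, 0), 0) = (tmul (tmul m n, 0) k, 0) := by
  simp [assocSumInv, map_tmul, assocInv_tmul, tmul_zero]

theorem assocSumInv_inl_snd (m : M0) (n : N1) (k : K1) :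
    assocSumInv M0 M1 N0 N1 K0 K1 (tmul m (0, tmul n k), 0) = (0, tmul (0, tmul m n) k) := by
  simp [assocSumInv, map_tmul, assocInv_tmul, tmul_zero]

theorem assocSumInv_inr_fst (m : M1) (n : N1) (k : K0) :
    assocSumInv M0 M1 N0 N1 K0 K1 (0, tmul m (tmul n k, 0)) = (tmul (0, tmul m n) k, 0) := by
  simp [assocSumInv, map_tmul, assocInv_tmul, tmul_zero]

theorem assocSumInv_inr_snd (m : M1) (n : N0) (k : K1) :
    assocSumInv M0 M1 N0 N1 K0 K1 (0, tmul m (0, tmul n k)) = (0, tmul (tmul m n, 0) k) := by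
  simp [assocSumInv, map_tmul, assocInv_tmul, tmul_zero]

/-- Two additive maps out of a sum of double tensor products agree if they agree on
homogeneous pure tensors. -/
theorem prod_left_ext {W : Type*} [AddCommGroup W] [Module Poly W]
    {f g : BTensor (BTensor M0 N0 × BTensor M1 N1) K0 ×
      BTensor (BTensor M1 N0 × BTensor M0 N1) K1 →ₗ[Poly] W}
    (h1 : ∀ m n k, f (tmul (tmul m n, 0) k, 0) = g (tmul (tmul m n, 0) k, 0))
    (h2 : ∀ m n k, f (tmul (0, tmul m n) k, 0) = g (tmul (0, tmul m n) k, 0))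
    (h3 : ∀ m n k, f (0, tmul (tmul m n, 0) k) = g (0, tmul (tmul m n, 0) k))
    (h4 : ∀ m n k, f (0, tmul (0, tmul m n) k) = g (0, tmul (0, tmul m n) k)) : f = g := by
  refine LinearMap.prod_ext (LinearMap.ext fun t => ?_) (LinearMap.ext fun t => ?_)
  · induction t using induction_on_prod_left with
    | hl m n k => exact h1 m n k
    | hr m n k => exact h2 m n k
    | h2 s t hs ht => rw [map_add, map_add, hs, ht]
  · induction t using induction_on_prod_left with
    | hl m n k => exact h3 m n k
    | hr m n k => exact h4 m n k
    | h2 s t hs ht => rw [map_add, map_add, hs, ht]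

theorem prod_right_ext {W : Type*} [AddCommGroup W] [Module Poly W]
    {f g : BTensor M0 (BTensor N0 K0 × BTensor N1 K1) ×
      BTensor M1 (BTensor N1 K0 × BTensor N0 K1) →ₗ[Poly] W}
    (h1 : ∀ m n k, f (tmul m (tmul n k, 0), 0) = g (tmul m (tmul n k, 0), 0))
    (h2 : ∀ m n k, f (tmul m (0, tmul n k), 0) = g (tmul m (0, tmul n k), 0))
    (h3 : ∀ m n k, f (0, tmul m (tmul n k, 0)) = g (0, tmul m (tmul n k, 0)))
    (h4 : ∀ m n k, f (0, tmul m (0, tmul n k)) = g (0, tmul m (0, tmul n k))) : f = g := by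
  refine LinearMap.prod_ext (LinearMap.ext fun t => ?_) (LinearMap.ext fun t => ?_)
  · induction t using induction_on_prod_right with
    | hl n k m => exact h1 m n k
    | hr n k m => exact h2 m n k
    | h2 s t hs ht => rw [map_add, map_add, hs, ht]
  · induction t using induction_on_prod_right with
    | hl n k m => exact h3 m n k
    | hr n k m => exact h4 m n k
    | h2 s t hs ht => rw [map_add, map_add, hs, ht]

theorem assocSumInv_comp_assocSum :
    assocSumInv M0 M1 N0 N1 K0 K1 ∘ₗ assocSum M0 M1 N0 N1 K0 K1 = LinearMap.id :=
  prod_left_ext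
    (fun m n k => by
      rw [LinearMap.comp_apply, assocSum_inl_fst, assocSumInv_inl_fst, LinearMap.id_apply])
    (fun m n k => by
      rw [LinearMap.comp_apply, assocSum_inl_snd, assocSumInv_inr_fst, LinearMap.id_apply])
    (fun m n k => by
      rw [LinearMap.comp_apply, assocSum_inr_fst, assocSumInv_inr_snd, LinearMap.id_apply])
    (fun m n k => by
      rw [LinearMap.comp_apply, assocSum_inr_snd, assocSumInv_inl_snd, LinearMap.id_apply])

theorem assocSum_comp_assocSumInv :
    assocSum M0 M1 N0 N1 K0 K1 ∘ₗ assocSumInv M0 M1 N0 N1 K0 K1 = LinearMap.id :=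
  prod_right_ext
    (fun m n k => by
      rw [LinearMap.comp_apply, assocSumInv_inl_fst, assocSum_inl_fst, LinearMap.id_apply])
    (fun m n k => by
      rw [LinearMap.comp_apply, assocSumInv_inl_snd, assocSum_inr_snd, LinearMap.id_apply])
    (fun m n k => by
      rw [LinearMap.comp_apply, assocSumInv_inr_fst, assocSum_inl_snd, LinearMap.id_apply])
    (fun m n k => by
      rw [LinearMap.comp_apply, assocSumInv_inr_snd, assocSum_inr_fst, LinearMap.id_apply])

end AssocSum

end BTensor

/-! ### Bimodule maps of degree zero -/

namespace GrBimod

variable {d : ℕ}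

/-- A bimodule map of degree zero. -/
abbrev PreservesDeg {M N : GrBimod d} (f : M →ₗ[Poly] N) : Prop :=
  ∀ q, ∀ m ∈ M.deg q, f m ∈ N.deg q

theorem preservesDeg_map {M M' N N' : GrBimod d} {f : M →ₗ[Poly] M'} {g : N →ₗ[Poly] N'}
    (hf : PreservesDeg f) (hg : PreservesDeg g) :
    PreservesDeg (M := M.tensor N) (N := M'.tensor N') (BTensor.map f g) := by
  have := (hasDegree_zero_iff.mpr hf).map (hasDegree_zero_iff.mpr hg)
  rw [add_zero] at this
  exact hasDegree_zero_iff.mp this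

theorem preservesDeg_id (M : GrBimod d) :
    PreservesDeg (M := M) (N := M) LinearMap.id := fun _ _ h => h

theorem preservesDeg_fst (M N : GrBimod d) :
    PreservesDeg (M := M.prod N) (N := M) (LinearMap.fst Poly M N) := fun _ _ h => h.1

theorem preservesDeg_snd (M N : GrBimod d) :
    PreservesDeg (M := M.prod N) (N := N) (LinearMap.snd Poly M N) := fun _ _ h => h.2

theorem preservesDeg_inl (M N : GrBimod d) :
    PreservesDeg (M := M) (N := M.prod N) (LinearMap.inl Poly M N) :=
  fun _ _ h => ⟨h, Submodule.zero_mem _⟩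

theorem preservesDeg_inr (M N : GrBimod d) :
    PreservesDeg (M := N) (N := M.prod N) (LinearMap.inr Poly M N) :=
  fun _ _ h => ⟨Submodule.zero_mem _, h⟩

theorem preservesDeg_assoc (A B C : GrBimod d) :
    PreservesDeg (M := (A.tensor B).tensor C) (N := A.tensor (B.tensor C))
      (BTensor.assoc A B C) :=
  hasDegree_zero_iff.mp (hasDegree_assoc A B C)

theorem preservesDeg_assocInv (A B C : GrBimod d) :
    PreservesDeg (M := A.tensor (B.tensor C)) (N := (A.tensor B).tensor C)
      (BTensor.assocInv A B C) :=
  hasDegree_zero_iff.mp (hasDegree_assocInv A B C)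

theorem preservesDeg_assocSum (M0 M1 N0 N1 K0 K1 : GrBimod d) :
    PreservesDeg
      (M := (((M0.tensor N0).prod (M1.tensor N1)).tensor K0).prod
        (((M1.tensor N0).prod (M0.tensor N1)).tensor K1))
      (N := (M0.tensor ((N0.tensor K0).prod (N1.tensor K1))).prod
        (M1.tensor ((N1.tensor K0).prod (N0.tensor K1))))
      (BTensor.assocSum M0 M1 N0 N1 K0 K1) := by
  rintro q ⟨s, t⟩ ⟨hs, ht⟩
  have fs := preservesDeg_map (preservesDeg_fst (M0.tensor N0) (M1.tensor N1))
    (preservesDeg_id K0) q s hs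
  have ss := preservesDeg_map (preservesDeg_snd (M0.tensor N0) (M1.tensor N1))
    (preservesDeg_id K0) q s hs
  have ft := preservesDeg_map (preservesDeg_fst (M1.tensor N0) (M0.tensor N1))
    (preservesDeg_id K1) q t ht
  have st := preservesDeg_map (preservesDeg_snd (M1.tensor N0) (M0.tensor N1))
    (preservesDeg_id K1) q t ht
  exact ⟨Submodule.add_mem _
      (preservesDeg_map (preservesDeg_id M0) (preservesDeg_inl (N0.tensor K0) (N1.tensor K1))
        q _ (preservesDeg_assoc M0 N0 K0 q _ fs))
      (preservesDeg_map (preservesDeg_id M0) (preservesDeg_inr (N0.tensor K0) (N1.tensor K1))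
        q _ (preservesDeg_assoc M0 N1 K1 q _ st)),
    Submodule.add_mem _
      (preservesDeg_map (preservesDeg_id M1) (preservesDeg_inl (N1.tensor K0) (N0.tensor K1))
        q _ (preservesDeg_assoc M1 N1 K0 q _ ss))
      (preservesDeg_map (preservesDeg_id M1) (preservesDeg_inr (N1.tensor K0) (N0.tensor K1))
        q _ (preservesDeg_assoc M1 N0 K1 q _ ft))⟩

theorem preservesDeg_assocSumInv (M0 M1 N0 N1 K0 K1 : GrBimod d) :
    PreservesDeg
      (M := (M0.tensor ((N0.tensor K0).prod (N1.tensor K1))).prod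
        (M1.tensor ((N1.tensor K0).prod (N0.tensor K1))))
      (N := (((M0.tensor N0).prod (M1.tensor N1)).tensor K0).prod
        (((M1.tensor N0).prod (M0.tensor N1)).tensor K1))
      (BTensor.assocSumInv M0 M1 N0 N1 K0 K1) := by
  rintro q ⟨s, t⟩ ⟨hs, ht⟩
  have fs := preservesDeg_map (preservesDeg_id M0)
    (preservesDeg_fst (N0.tensor K0) (N1.tensor K1)) q s hs
  have ss := preservesDeg_map (preservesDeg_id M0)
    (preservesDeg_snd (N0.tensor K0) (N1.tensor K1)) q s hs
  have ft := preservesDeg_map (preservesDeg_id M1)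
    (preservesDeg_fst (N1.tensor K0) (N0.tensor K1)) q t ht
  have st := preservesDeg_map (preservesDeg_id M1)
    (preservesDeg_snd (N1.tensor K0) (N0.tensor K1)) q t ht
  exact ⟨Submodule.add_mem _
      (preservesDeg_map (preservesDeg_inl (M0.tensor N0) (M1.tensor N1)) (preservesDeg_id K0)
        q _ (preservesDeg_assocInv M0 N0 K0 q _ fs))
      (preservesDeg_map (preservesDeg_inr (M0.tensor N0) (M1.tensor N1)) (preservesDeg_id K0)
        q _ (preservesDeg_assocInv M1 N1 K0 q _ ft)),
    Submodule.add_mem _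
      (preservesDeg_map (preservesDeg_inr (M1.tensor N0) (M0.tensor N1)) (preservesDeg_id K1)
        q _ (preservesDeg_assocInv M0 N1 K1 q _ ss))
      (preservesDeg_map (preservesDeg_inl (M1.tensor N0) (M0.tensor N1)) (preservesDeg_id K1)
        q _ (preservesDeg_assocInv M1 N0 K1 q _ st))⟩

end GrBimod

/-! ### Compatibility of the reassociation with the differentials -/

namespace BTensor

section

variable {M0 M1 N0 N1 K0 K1 : Type*} [AddCommGroup M0] [Module ℂ M0] [Module Poly M0]
  [IsScalarTower ℂ Poly M0] [AddCommGroup M1] [Module ℂ M1] [Module Poly M1]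
  [IsScalarTower ℂ Poly M1]
  [AddCommGroup N0] [Module ℂ N0] [Module Poly N0] [IsScalarTower ℂ Poly N0]
  [AddCommGroup N1] [Module ℂ N1] [Module Poly N1] [IsScalarTower ℂ Poly N1]
  [AddCommGroup K0] [Module ℂ K0] [Module Poly K0] [IsScalarTower ℂ Poly K0]
  [AddCommGroup K1] [Module ℂ K1] [Module Poly K1] [IsScalarTower ℂ Poly K1]

/-- The component `(M ⊗ N)₁ → (M ⊗ N)₀` of the differential `d ⊗ 1 + 1 ⊗ d`. -/
def totalOdd (m1 : M1 →ₗ[Poly] M0) (m0 : M0 →ₗ[Poly] M1) (n1 : N1 →ₗ[Poly] N0)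
    (n0 : N0 →ₗ[Poly] N1) :
    BTensor M1 N0 × BTensor M0 N1 →ₗ[Poly] BTensor M0 N0 × BTensor M1 N1 :=
  -- The formula of `GrMF.tensor`, stated for bare linear maps so that it can be nested to describe
  -- iterated tensor products.
  LinearMap.prod
    (LinearMap.coprod (map m1 LinearMap.id) (map LinearMap.id n1))
    (LinearMap.coprod (-map LinearMap.id n0) (map m0 LinearMap.id))

/-- The component `(M ⊗ N)₀ → (M ⊗ N)₁` of the differential `d ⊗ 1 + 1 ⊗ d`. -/
def totalEven (m1 : M1 →ₗ[Poly] M0) (m0 : M0 →ₗ[Poly] M1) (n1 : N1 →ₗ[Poly] N0)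
    (n0 : N0 →ₗ[Poly] N1) :
    BTensor M0 N0 × BTensor M1 N1 →ₗ[Poly] BTensor M1 N0 × BTensor M0 N1 :=
  LinearMap.prod
    (LinearMap.coprod (map m0 LinearMap.id) (-map LinearMap.id n1))
    (LinearMap.coprod (map LinearMap.id n0) (map m1 LinearMap.id))

variable (m1 : M1 →ₗ[Poly] M0) (m0 : M0 →ₗ[Poly] M1) (n1 : N1 →ₗ[Poly] N0)
    (n0 : N0 →ₗ[Poly] N1) (k1 : K1 →ₗ[Poly] K0) (k0 : K0 →ₗ[Poly] K1)

theorem tmul_mk {A B C : Type*} [AddCommGroup A] [Module ℂ A] [Module Poly A]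
    [IsScalarTower ℂ Poly A] [AddCommGroup B] [Module ℂ B] [Module Poly B]
    [IsScalarTower ℂ Poly B] [AddCommGroup C] [Module ℂ C] [Module Poly C]
    [IsScalarTower ℂ Poly C] (c : C) (a : A) (b : B) :
    tmul c (a, b) = tmul c (a, 0) + tmul c (0, b) := by
  rw [← tmul_add, Prod.mk_add_mk, add_zero, zero_add]

theorem totalOdd_apply (s : BTensor M1 N0) (t : BTensor M0 N1) :
    totalOdd m1 m0 n1 n0 (s, t) = (map m1 LinearMap.id s + map LinearMap.id n1 t,
      -map LinearMap.id n0 s + map m0 LinearMap.id t) := rfl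

theorem totalEven_apply (s : BTensor M0 N0) (t : BTensor M1 N1) :
    totalEven m1 m0 n1 n0 (s, t) = (map m0 LinearMap.id s + -map LinearMap.id n1 t,
      map LinearMap.id n0 s + map m1 LinearMap.id t) := rfl

theorem assocSum_apply (s : BTensor (BTensor M0 N0 × BTensor M1 N1) K0)
    (t : BTensor (BTensor M1 N0 × BTensor M0 N1) K1) :
    assocSum M0 M1 N0 N1 K0 K1 (s, t) =
      (map LinearMap.id (LinearMap.inl _ _ _)
          (assoc _ _ _ (map (LinearMap.fst Poly _ _) LinearMap.id s)) +
        map LinearMap.id (LinearMap.inr _ _ _)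
          (assoc _ _ _ (map (LinearMap.snd Poly _ _) LinearMap.id t)),
       map LinearMap.id (LinearMap.inl _ _ _)
          (assoc _ _ _ (map (LinearMap.snd Poly _ _) LinearMap.id s)) +
        map LinearMap.id (LinearMap.inr _ _ _)
          (assoc _ _ _ (map (LinearMap.fst Poly _ _) LinearMap.id t))) := rfl

theorem tmul_mk_neg_left {A B C : Type*} [AddCommGroup A] [Module ℂ A] [Module Poly A]
    [IsScalarTower ℂ Poly A] [AddCommGroup B] [Module ℂ B] [Module Poly B]
    [IsScalarTower ℂ Poly B] [AddCommGroup C] [Module ℂ C] [Module Poly C]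
    [IsScalarTower ℂ Poly C] (c : C) (a : A) :
    tmul c (-a, (0 : B)) = -tmul c (a, 0) := by
  rw [← tmul_neg, Prod.neg_mk, neg_zero]

theorem tmul_mk_neg_right {A B C : Type*} [AddCommGroup A] [Module ℂ A] [Module Poly A]
    [IsScalarTower ℂ Poly A] [AddCommGroup B] [Module ℂ B] [Module Poly B]
    [IsScalarTower ℂ Poly B] [AddCommGroup C] [Module ℂ C] [Module Poly C]
    [IsScalarTower ℂ Poly C] (c : C) (b : B) :
    tmul c ((0 : A), -b) = -tmul c (0, b) := by
  rw [← tmul_neg, Prod.neg_mk, neg_zero]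

/-- Both sides are `d ⊗ 1 ⊗ 1 + 1 ⊗ d ⊗ 1 + 1 ⊗ 1 ⊗ d` with Koszul signs depending only on the
parities to the left. This is checked on the four parity types of pure tensors. -/
theorem assocSum_totalOdd :
    assocSum M0 M1 N0 N1 K0 K1 ∘ₗ
        totalOdd (totalOdd m1 m0 n1 n0) (totalEven m1 m0 n1 n0) k1 k0 =
      totalOdd m1 m0 (totalOdd n1 n0 k1 k0) (totalEven n1 n0 k1 k0) ∘ₗ
        assocSum M1 M0 N0 N1 K0 K1 := by
  refine prod_left_ext (fun m n k => ?_) (fun m n k => ?_) (fun m n k => ?_) (fun m n k => ?_)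
  all_goals
    simp only [LinearMap.comp_apply, assocSum_inl_fst, assocSum_inl_snd, assocSum_inr_fst,
      assocSum_inr_snd]
    simp only [assocSum_apply, totalOdd_apply, totalEven_apply, map_tmul, map_zero, map_neg,
      assoc_tmul, LinearMap.fst_apply, LinearMap.snd_apply, LinearMap.inl_apply,
      LinearMap.inr_apply, LinearMap.id_apply, add_zero, zero_add, neg_zero, zero_tmul, neg_tmul]
  · rw [tmul_mk m (tmul (n0 n) k) (tmul n (k0 k)), neg_add]
  · rw [tmul_mk m (tmul (n1 n) k) (-tmul n (k0 k)), tmul_mk_neg_right]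
  · rw [tmul_mk m (tmul n (k1 k)) (tmul (n0 n) k)]
  · rw [tmul_mk m (-tmul n (k1 k)) (tmul (n1 n) k), neg_add, tmul_mk_neg_left, neg_neg]

theorem assocSum_totalEven :
    assocSum M1 M0 N0 N1 K0 K1 ∘ₗ
        totalEven (totalOdd m1 m0 n1 n0) (totalEven m1 m0 n1 n0) k1 k0 =
      totalEven m1 m0 (totalOdd n1 n0 k1 k0) (totalEven n1 n0 k1 k0) ∘ₗ
        assocSum M0 M1 N0 N1 K0 K1 := by
  refine prod_left_ext (fun m n k => ?_) (fun m n k => ?_) (fun m n k => ?_) (fun m n k => ?_)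
  all_goals
    simp only [LinearMap.comp_apply, assocSum_inl_fst, assocSum_inl_snd, assocSum_inr_fst,
      assocSum_inr_snd]
    simp only [assocSum_apply, totalOdd_apply, totalEven_apply, map_tmul, map_zero, map_neg,
      assoc_tmul, LinearMap.fst_apply, LinearMap.snd_apply, LinearMap.inl_apply,
      LinearMap.inr_apply, LinearMap.id_apply, add_zero, zero_add, neg_zero, zero_tmul, neg_tmul]
  · rw [tmul_mk m (tmul (n0 n) k) (tmul n (k0 k))]
  · rw [tmul_mk m (tmul (n1 n) k) (-tmul n (k0 k)), tmul_mk_neg_right, neg_add, neg_neg]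
  · rw [tmul_mk m (tmul n (k1 k)) (tmul (n0 n) k), neg_add]
  · rw [tmul_mk m (-tmul n (k1 k)) (tmul (n1 n) k), tmul_mk_neg_left]

end

end BTensor

/-! ### The associator of matrix bifactorisations -/

namespace GrMF

variable {d : ℕ}

/-- A cycle with a degree-preserving two-sided inverse is an isomorphism. -/
def isoOfInverse {M N : GrMF d} (f : M ⟶ N) (g0 : N.M0 →ₗ[Poly] M.M0) (g1 : N.M1 →ₗ[Poly] M.M1)
    (h0 : GrBimod.PreservesDeg g0) (h1 : GrBimod.PreservesDeg g1)
    (gf0 : g0 ∘ₗ f.1.1 = LinearMap.id) (gf1 : g1 ∘ₗ f.1.2 = LinearMap.id)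
    (fg0 : f.1.1 ∘ₗ g0 = LinearMap.id) (fg1 : f.1.2 ∘ₗ g1 = LinearMap.id) : M ≅ N where
  hom := f
  inv := ⟨(g0, g1), h0, h1, by
      rw [← LinearMap.comp_id N.d1, ← fg1, ← LinearMap.comp_assoc _ _ N.d1, ← f.2.2.2.1,
        LinearMap.comp_assoc, ← LinearMap.comp_assoc _ _ g0, gf0, LinearMap.id_comp], by
      rw [← LinearMap.comp_id N.d0, ← fg0, ← LinearMap.comp_assoc _ _ N.d0, ← f.2.2.2.2,
        LinearMap.comp_assoc, ← LinearMap.comp_assoc _ _ g1, gf1, LinearMap.id_comp]⟩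
  hom_inv_id := Subtype.ext (Prod.ext gf0 gf1)
  inv_hom_id := Subtype.ext (Prod.ext fg0 fg1)

/-- Associativity of the tensor product. -/
def associator (M N K : GrMF d) : (M.tensor N).tensor K ≅ M.tensor (N.tensor K) :=
  isoOfInverse
    ⟨(BTensor.assocSum M.M0 M.M1 N.M0 N.M1 K.M0 K.M1,
      BTensor.assocSum M.M1 M.M0 N.M0 N.M1 K.M0 K.M1),
      GrBimod.preservesDeg_assocSum _ _ _ _ _ _, GrBimod.preservesDeg_assocSum _ _ _ _ _ _,
      BTensor.assocSum_totalOdd M.d1 M.d0 N.d1 N.d0 K.d1 K.d0,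
      BTensor.assocSum_totalEven M.d1 M.d0 N.d1 N.d0 K.d1 K.d0⟩
    (BTensor.assocSumInv M.M0 M.M1 N.M0 N.M1 K.M0 K.M1)
    (BTensor.assocSumInv M.M1 M.M0 N.M0 N.M1 K.M0 K.M1)
    (GrBimod.preservesDeg_assocSumInv _ _ _ _ _ _)
    (GrBimod.preservesDeg_assocSumInv _ _ _ _ _ _)
    BTensor.assocSumInv_comp_assocSum BTensor.assocSumInv_comp_assocSum
    BTensor.assocSum_comp_assocSumInv BTensor.assocSum_comp_assocSumInv

end GrMF

/-- Associativity of the tensor product in `HMF^gr_bi`. -/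
def HMF.associator {d : ℕ} (M N K : HMF d) :
    (M.tensor N).tensor K ≅ M.tensor (N.tensor K) :=
  (GrMF.toHMF d).mapIso (GrMF.associator M.as N.as K.as)

/-! ### The polynomial model of `ℂ[x, y] ⊗_{ℂ[y]} ℂ[y, z]` -/

/-- `ℂ[x, z][y]`, where `x` and `z` are the two variables of `Poly`. -/
abbrev Poly3 : Type := Polynomial Poly

/-- The embedding `p(x, y)` of the left factor. -/
def leftEmb : Poly →ₐ[ℂ] Poly3 := MvPolynomial.aeval ![Polynomial.C vx, Polynomial.X]

/-- The embedding `p(y, z)` of the right factor. -/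
def rightEmb : Poly →ₐ[ℂ] Poly3 := MvPolynomial.aeval ![Polynomial.X, Polynomial.C vy]

theorem leftEmb_vx : leftEmb vx = Polynomial.C vx := by simp [leftEmb]

theorem leftEmb_vy : leftEmb vy = Polynomial.X := by simp [leftEmb]

theorem rightEmb_vx : rightEmb vx = Polynomial.X := by simp [rightEmb]

theorem rightEmb_vy : rightEmb vy = Polynomial.C vy := by simp [rightEmb]

namespace BTensor

/-- The map `p ⊗ q ↦ p(x, y) q(y, z)`. -/
def toPoly3 : BTensor Poly Poly →ₗ[Poly] Poly3 :=
  liftPoly ((LinearMap.mul ℂ Poly3).compl₁₂ leftEmb.toLinearMap rightEmb.toLinearMap)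
    (fun m n => by
      simp only [smul_eq_mul, LinearMap.compl₁₂_apply, AlgHom.toLinearMap_apply, map_mul,
        LinearMap.mul_apply', leftEmb_vy, rightEmb_vx]
      ring)
    (fun m n => by
      simp only [smul_eq_mul, LinearMap.compl₁₂_apply, AlgHom.toLinearMap_apply, map_mul,
        LinearMap.mul_apply', leftEmb_vx, Polynomial.smul_eq_C_mul]
      ring)
    (fun m n => by
      simp only [smul_eq_mul, LinearMap.compl₁₂_apply, AlgHom.toLinearMap_apply, map_mul,
        LinearMap.mul_apply', rightEmb_vy, Polynomial.smul_eq_C_mul]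
      ring)

theorem toPoly3_tmul (p q : Poly) : toPoly3 (tmul p q) = leftEmb p * rightEmb q := rfl

/-- The inverse of `toPoly3`. -/
def ofPoly3 : Poly3 →ₗ[Poly] BTensor Poly Poly :=
  -- The middle variable is the left variable of the second factor, so `y ^ k` corresponds to `1 ⊗ x
  -- ^ k`.
  (Polynomial.basisMonomials Poly).constr Poly fun k => tmul 1 (vx ^ k)

theorem ofPoly3_monomial (k : ℕ) (p : Poly) :
    ofPoly3 (Polynomial.monomial k p) = p • tmul 1 (vx ^ k) := by
  have h : Polynomial.monomial k p = p • Polynomial.basisMonomials Poly k := by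
    simp [Polynomial.smul_monomial]
  rw [h, map_smul, ofPoly3, Module.Basis.constr_basis]

theorem toPoly3_ofPoly3 (f : Poly3) : toPoly3 (ofPoly3 f) = f := by
  induction f using Polynomial.induction_on' with
  | add f g hf hg => rw [map_add, map_add, hf, hg]
  | monomial k p =>
    rw [ofPoly3_monomial, map_smul, toPoly3_tmul, map_one, one_mul, map_pow, rightEmb_vx,
      Polynomial.smul_eq_C_mul, Polynomial.C_mul_X_pow_eq_monomial]

theorem ofPoly3_toPoly3 (t : BTensor Poly Poly) : ofPoly3 (toPoly3 t) = t := by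
  induction t using induction_on with
  | h2 s t hs ht => rw [map_add, map_add, hs, ht]
  | h1 p q =>
    induction p using MvPolynomial.induction_on' with
    | add p p' h h' => rw [add_tmul, map_add, map_add, h, h']
    | monomial s a =>
      induction q using MvPolynomial.induction_on' with
      | add q q' h h' => rw [tmul_add, map_add, map_add, h, h']
      | monomial t b =>
        have hm : ∀ (s : Fin 2 →₀ ℕ) (a : ℂ),
            MvPolynomial.monomial s a = a • mon s • (1 : Poly) := by
          intro s a
          rw [mon, smul_eq_mul, mul_one, MvPolynomial.smul_monomial, smul_eq_mul, mul_one]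
        rw [hm, hm, smul_tmul_complex, tmul_smul_complex, mon_tmul_mon, smul_eq_mul, mul_one,
          ← algebraMap_smul Poly a, ← algebraMap_smul Poly b, map_smul, map_smul, map_smul,
          map_smul, map_smul, map_smul]
        congr 3
        rw [toPoly3_tmul, map_one, one_mul, map_pow, rightEmb_vx, Polynomial.X_pow_eq_monomial,
          ofPoly3_monomial, one_smul]

/-- In the polynomial model the differential of the first factor becomes multiplication by `p(x,
y)`; `toPoly3_map_right` gives `p(y, z)` for the second factor. -/
theorem toPoly3_map_left (p : Poly) (t : BTensor Poly Poly) :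
    toPoly3 (map (LinearMap.lsmul Poly Poly p) LinearMap.id t) = leftEmb p * toPoly3 t := by
  induction t using induction_on with
  | h2 s t hs ht => rw [map_add, map_add, hs, ht, map_add, mul_add]
  | h1 m n =>
    rw [map_tmul, toPoly3_tmul, toPoly3_tmul, LinearMap.lsmul_apply, smul_eq_mul, map_mul,
      mul_assoc, LinearMap.id_apply]

theorem toPoly3_map_right (p : Poly) (t : BTensor Poly Poly) :
    toPoly3 (map LinearMap.id (LinearMap.lsmul Poly Poly p) t) = rightEmb p * toPoly3 t := by
  induction t using induction_on with
  | h2 s t hs ht => rw [map_add, map_add, hs, ht, map_add, mul_add]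
  | h1 m n =>
    rw [map_tmul, toPoly3_tmul, toPoly3_tmul, LinearMap.lsmul_apply, smul_eq_mul, map_mul,
      LinearMap.id_apply]
    ring

theorem map_left_ofPoly3 (p : Poly) (f : Poly3) :
    map (LinearMap.lsmul Poly Poly p) LinearMap.id (ofPoly3 f) = ofPoly3 (leftEmb p * f) := by
  rw [← ofPoly3_toPoly3 (map _ _ _), toPoly3_map_left, toPoly3_ofPoly3]

theorem map_right_ofPoly3 (p : Poly) (f : Poly3) :
    map LinearMap.id (LinearMap.lsmul Poly Poly p) (ofPoly3 f) = ofPoly3 (rightEmb p * f) := by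
  rw [← ofPoly3_toPoly3 (map _ _ _), toPoly3_map_right, toPoly3_ofPoly3]

end BTensor

/-! ### The grading of the polynomial model -/

/-- The elements of `ℂ[x, z][y]` of degree `q`, where each variable has degree `2 / d`. -/
def poly3Deg (d : ℕ) (q : ℂ) : Submodule ℂ Poly3 where
  carrier := {f | ∀ k : ℕ, f.coeff k ∈ polyDeg d (q - k * (2 / (d : ℂ)))}
  zero_mem' k := by rw [Polynomial.coeff_zero]; exact Submodule.zero_mem _
  add_mem' hf hg k := by rw [Polynomial.coeff_add]; exact Submodule.add_mem _ (hf k) (hg k)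
  smul_mem' c f hf k := by rw [Polynomial.coeff_smul]; exact Submodule.smul_mem _ _ (hf k)

section Degrees

variable {d : ℕ}

theorem mul_mem_polyDeg {a b : ℂ} {p q : Poly} (hp : p ∈ polyDeg d a) (hq : q ∈ polyDeg d b) :
    p * q ∈ polyDeg d (a + b) :=
  MvPolynomial.IsWeightedHomogeneous.mul hp hq

theorem mul_mem_poly3Deg {a b : ℂ} {f g : Poly3} (hf : f ∈ poly3Deg d a)
    (hg : g ∈ poly3Deg d b) : f * g ∈ poly3Deg d (a + b) := by
  intro k
  rw [Polynomial.coeff_mul]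
  refine Submodule.sum_mem _ fun ij hij => ?_
  have := mul_mem_polyDeg (hf ij.1) (hg ij.2)
  convert this using 2
  rw [← Finset.HasAntidiagonal.mem_antidiagonal.mp hij]
  push_cast
  ring

theorem C_mem_poly3Deg {a : ℂ} {p : Poly} (hp : p ∈ polyDeg d a) :
    Polynomial.C p ∈ poly3Deg d a := by
  intro k
  rw [Polynomial.coeff_C]
  split_ifs with h
  · subst h; simpa using hp
  · exact Submodule.zero_mem _

theorem X_mem_poly3Deg : (Polynomial.X : Poly3) ∈ poly3Deg d (2 / (d : ℂ)) := by
  intro k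
  rw [Polynomial.coeff_X]
  split_ifs with h
  · subst h; simpa using one_mem_polyDeg d
  · exact Submodule.zero_mem _

theorem one_mem_poly3Deg : (1 : Poly3) ∈ poly3Deg d 0 :=
  C_mem_poly3Deg (one_mem_polyDeg d)

theorem pow_mem_poly3Deg {a : ℂ} {f : Poly3} (hf : f ∈ poly3Deg d a) (n : ℕ) :
    f ^ n ∈ poly3Deg d (n * a) := by
  induction n with
  | zero => simpa using one_mem_poly3Deg
  | succ n ih =>
    rw [pow_succ]
    convert mul_mem_poly3Deg ih hf using 2
    push_cast; ring

theorem aeval_mem_poly3Deg {a : ℂ} {p : Poly} (hp : p ∈ polyDeg d a) (v : Fin 2 → Poly3)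
    (hv : ∀ i, v i ∈ poly3Deg d (2 / (d : ℂ))) :
    MvPolynomial.aeval v p ∈ poly3Deg d a := by
  rw [MvPolynomial.aeval_def, MvPolynomial.eval₂_eq']
  refine Submodule.sum_mem _ fun s hs => ?_
  rw [← Algebra.smul_def]
  refine Submodule.smul_mem _ _ ?_
  rw [Fin.prod_univ_two]
  have := mul_mem_poly3Deg (pow_mem_poly3Deg (hv 0) (s 0)) (pow_mem_poly3Deg (hv 1) (s 1))
  rwa [← nsmul_eq_mul, ← nsmul_eq_mul, ← Fin.sum_univ_two (fun i => s i • (2 / (d : ℂ))),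
    ← Finsupp.sum_fintype s (fun _ c => c • (2 / (d : ℂ))) (by simp), ← Finsupp.weight_apply,
    hp (MvPolynomial.mem_support_iff.mp hs)] at this

theorem leftEmb_mem_poly3Deg {a : ℂ} {p : Poly} (hp : p ∈ polyDeg d a) :
    leftEmb p ∈ poly3Deg d a :=
  aeval_mem_poly3Deg hp _ fun i => by
    fin_cases i
    · exact C_mem_poly3Deg (GrBimod.vx_mem_polyDeg d)
    · exact X_mem_poly3Deg

theorem rightEmb_mem_poly3Deg {a : ℂ} {p : Poly} (hp : p ∈ polyDeg d a) :
    rightEmb p ∈ poly3Deg d a :=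
  aeval_mem_poly3Deg hp _ fun i => by
    fin_cases i
    · exact X_mem_poly3Deg
    · exact C_mem_poly3Deg (GrBimod.vy_mem_polyDeg d)

/-- The model has its generator in degree zero, while `1 ⊗ 1` has degree `α + β` in the tensor
product; hence the shift. -/
theorem toPoly3_mem {α β q : ℂ} {t : BTensor Poly Poly}
    (ht : t ∈ ((GrBimod.shift d α).tensor (GrBimod.shift d β)).deg q) :
    BTensor.toPoly3 t ∈ poly3Deg d (q - α - β) := by
  refine BTensor.deg_le (BTensor.toPoly3.restrictScalars ℂ) _ (fun a b m hm n hn hab => ?_) t ht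
  have := mul_mem_poly3Deg (leftEmb_mem_poly3Deg hm) (rightEmb_mem_poly3Deg hn)
  change BTensor.toPoly3 (BTensor.tmul m n) ∈ _
  rw [BTensor.toPoly3_tmul]
  convert this using 2
  rw [← hab]
  ring

theorem ofPoly3_mem {α β q : ℂ} {f : Poly3} (hf : f ∈ poly3Deg d (q - α - β)) :
    BTensor.ofPoly3 f ∈ ((GrBimod.shift d α).tensor (GrBimod.shift d β)).deg q := by
  rw [← Polynomial.sum_monomial_eq f, Polynomial.sum, map_sum]
  refine Submodule.sum_mem _ fun k _ => ?_
  rw [BTensor.ofPoly3_monomial]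
  have h1 : BTensor.tmul (1 : Poly) (vx ^ k) ∈
      ((GrBimod.shift d α).tensor (GrBimod.shift d β)).deg (α + (k * (2 / (d : ℂ)) + β)) := by
    refine BTensor.tmul_mem_deg (a := α) (b := k * (2 / (d : ℂ)) + β) ?_ ?_ rfl
    · change (1 : Poly) ∈ polyDeg d (α - α)
      rw [sub_self]
      exact one_mem_polyDeg d
    · change vx ^ k ∈ polyDeg d (_ - β)
      rw [add_sub_cancel_right]
      have := MvPolynomial.IsWeightedHomogeneous.pow (GrBimod.vx_mem_polyDeg d) k
      rwa [nsmul_eq_mul] at this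
  have := ((GrBimod.shift d α).tensor (GrBimod.shift d β)).smul_mem _ _ _ (hf k) _ h1
  convert this using 2
  ring

end Degrees

/-! ### Splitting a tensor product of permutation type matrix bifactorisations -/

/-- The data that decompose `P̂_S ⊗ P̂_T` as the direct sum of the `P̂_{Z k}`: two bases `u`, `v`
(with coordinate functions `cu`, `cv`) of `ℂ[x, y, z]` modulo `p_T(y, z)` that diagonalise the
multiplication with `p_S(x, y)`, and the quotient `D` of the division by `p_T(y, z)`. -/
structure Splitting {d : ℕ} [NeZero d] (S T : Finset (ZMod d)) {κ : Type} [Fintype κ]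
    [DecidableEq κ] (Z : κ → Finset (ZMod d)) where
  u : κ → Poly3
  v : κ → Poly3
  cu : κ → Poly3 →ₗ[Poly] Poly
  cv : κ → Poly3 →ₗ[Poly] Poly
  D : Poly3 →ₗ[Poly] Poly3
  D_mul (f : Poly3) : D (rightEmb (permPoly d T) * f) = f
  eq_sum_u (f : Poly3) : f = ∑ k, cu k f • u k + rightEmb (permPoly d T) * D f
  eq_sum_v (f : Poly3) : f = ∑ k, cv k f • v k + rightEmb (permPoly d T) * D f
  cu_u (k j : κ) : cu k (u j) = if j = k then 1 else 0
  cv_v (k j : κ) : cv k (v j) = if j = k then 1 else 0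
  -- Only the relation `p_S u_k ≡ p_{Z k} v_k` is demanded; the one for the complementary
  -- polynomials is derived from it in `left_mul_v`.
  dvd (k : κ) : rightEmb (permPoly d T) ∣
    leftEmb (permPoly d S) * u k - permPoly d (Z k) • v k
  degU : κ → ℂ
  degV : κ → ℂ
  u_mem (k : κ) : u k ∈ poly3Deg d (degU k)
  v_mem (k : κ) : v k ∈ poly3Deg d (degV k)
  cu_mem (k : κ) (q : ℂ) (f : Poly3) : f ∈ poly3Deg d q → cu k f ∈ polyDeg d (q - degU k)
  cv_mem (k : κ) (q : ℂ) (f : Poly3) : f ∈ poly3Deg d q → cv k f ∈ polyDeg d (q - degV k)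
  D_mem (q : ℂ) (f : Poly3) : f ∈ poly3Deg d q → D f ∈ poly3Deg d (q - 2 / (d : ℂ) * T.card)
  -- These degrees make the inclusion of `P̂_{Z k}` homogeneous of degree zero: its even generator
  -- goes to `v k` in `M₀ ⊗ N₀` and its odd generator to `u k` in `M₁ ⊗ N₀`.
  degV_eq (k : κ) : degV k = (1 - (Z k).card) / d - (1 - S.card) / d - (1 - T.card) / d
  degU_eq (k : κ) : degU k = degV k + 2 / (d : ℂ) * (Z k).card - 2 / (d : ℂ) * S.card

namespace Splitting

variable {d : ℕ} [NeZero d] {S T : Finset (ZMod d)} {κ : Type} [Fintype κ] [DecidableEq κ]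
  {Z : κ → Finset (ZMod d)} (A : Splitting S T Z)

theorem mul_right_injective (A : Splitting S T Z) {f g : Poly3}
    (h : rightEmb (permPoly d T) * f = rightEmb (permPoly d T) * g) : f = g := by
  rw [← A.D_mul f, h, A.D_mul]

/-- A basis element is its own remainder modulo `p_T`, so the quotient vanishes. -/
theorem D_u (k : κ) : A.D (A.u k) = 0 := by
  have h := A.eq_sum_u (A.u k)
  simp only [A.cu_u, ite_smul, one_smul, zero_smul, Finset.sum_ite_eq, Finset.mem_univ,
    if_true] at h
  rw [left_eq_add] at h
  exact A.mul_right_injective (h.trans (mul_zero _).symm)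

theorem D_v (k : κ) : A.D (A.v k) = 0 := by
  have h := A.eq_sum_v (A.v k)
  simp only [A.cv_v, ite_smul, one_smul, zero_smul, Finset.sum_ite_eq, Finset.mem_univ,
    if_true] at h
  rw [left_eq_add] at h
  exact A.mul_right_injective (h.trans (mul_zero _).symm)

theorem cu_sum (k : κ) (c : κ → Poly) : A.cu k (∑ j, c j • A.u j) = c k := by
  simp [map_sum, A.cu_u]

theorem cv_sum (k : κ) (c : κ → Poly) : A.cv k (∑ j, c j • A.v j) = c k := by
  simp [map_sum, A.cv_v]

theorem cu_mul (k : κ) (f : Poly3) : A.cu k (rightEmb (permPoly d T) * f) = 0 := by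
  have h := A.eq_sum_u (rightEmb (permPoly d T) * f)
  rw [A.D_mul, right_eq_add] at h
  rw [← A.cu_sum k fun j => A.cu j (rightEmb (permPoly d T) * f), h, map_zero]

theorem cv_mul (k : κ) (f : Poly3) : A.cv k (rightEmb (permPoly d T) * f) = 0 := by
  have h := A.eq_sum_v (rightEmb (permPoly d T) * f)
  rw [A.D_mul, right_eq_add] at h
  rw [← A.cv_sum k fun j => A.cv j (rightEmb (permPoly d T) * f), h, map_zero]

/-- The potentials telescope: `(x ^ d - y ^ d) + (y ^ d - z ^ d) = x ^ d - z ^ d`, and the last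
difference factors as `p_X p_{Xᶜ}` for every `X`. -/
theorem mul_compl (X : Finset (ZMod d)) :
    leftEmb (permPoly d S) * leftEmb (permPoly d Sᶜ) +
      rightEmb (permPoly d T) * rightEmb (permPoly d Tᶜ) =
      Polynomial.C (permPoly d X) * Polynomial.C (permPoly d Xᶜ) := by
  rw [← map_mul, ← map_mul, ← map_mul, permPoly_mul_compl, permPoly_mul_compl,
    permPoly_mul_compl]
  simp only [map_sub, map_pow, leftEmb_vx, leftEmb_vy, rightEmb_vx, rightEmb_vy]
  ring

theorem left_mul_u (k : κ) : leftEmb (permPoly d S) * A.u k = permPoly d (Z k) • A.v k +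
    rightEmb (permPoly d T) * A.D (leftEmb (permPoly d S) * A.u k) := by
  obtain ⟨w, hw⟩ := A.dvd k
  have h := congrArg A.D hw
  rw [map_sub, map_smul, A.D_v, smul_zero, sub_zero, A.D_mul] at h
  rw [h, ← hw]
  ring

/-- Modulo `p_T(y, z)`, multiplication by `p_S(x, y)` from the basis `u` to the basis `v` has the
diagonal matrix with entries `p_{Z k}`. -/
theorem cv_left_mul (k : κ) (f : Poly3) :
    A.cv k (leftEmb (permPoly d S) * f) = permPoly d (Z k) * A.cu k f := by
  have h : ∀ j, A.cv k (leftEmb (permPoly d S) * A.u j) =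
      if j = k then permPoly d (Z k) else 0 := by
    intro j
    rw [A.left_mul_u, map_add, A.cv_mul, add_zero, map_smul, A.cv_v, smul_eq_mul]
    split_ifs with h
    · rw [h, mul_one]
    · rw [mul_zero]
  conv_lhs => rw [A.eq_sum_u f]
  rw [mul_add, Finset.mul_sum, map_add, mul_left_comm, A.cv_mul, add_zero, map_sum]
  simp only [mul_smul_comm, map_smul, h]
  simp [mul_comm]

/-- Modulo `p_T`, `p_S p_{Sᶜ}` equals `x ^ d - z ^ d = p_{Z k} p_{(Z k)ᶜ}`, so the difference `f` of
the two sides is annihilated by `p_S`. As `p_S` is diagonal with nonzero entries over a domain, `f`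
vanishes modulo `p_T`. -/
theorem left_mul_v (k : κ) : leftEmb (permPoly d Sᶜ) * A.v k = permPoly d (Z k)ᶜ • A.u k +
    rightEmb (permPoly d T) * A.D (leftEmb (permPoly d Sᶜ) * A.v k) := by
  set f := leftEmb (permPoly d Sᶜ) * A.v k - permPoly d (Z k)ᶜ • A.u k with hf
  have h1 : leftEmb (permPoly d S) * f = rightEmb (permPoly d T) *
      (-(rightEmb (permPoly d Tᶜ) * A.v k) -
        permPoly d (Z k)ᶜ • A.D (leftEmb (permPoly d S) * A.u k)) := by
    have e1 := mul_compl (S := S) (T := T) (Z k)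
    have e2 := A.left_mul_u k
    rw [hf]
    simp only [Polynomial.smul_eq_C_mul] at e2 ⊢
    linear_combination A.v k * e1 - Polynomial.C (permPoly d (Z k)ᶜ) * e2
  have h2 : ∀ j, A.cu j f = 0 := by
    intro j
    have h := A.cv_left_mul j f
    rw [h1, A.cv_mul] at h
    exact (mul_eq_zero.mp h.symm).resolve_left (permPoly_ne_zero d _)
  have h3 := A.eq_sum_u f
  simp only [h2, zero_smul, Finset.sum_const_zero, zero_add] at h3
  have h4 : A.D f = A.D (leftEmb (permPoly d Sᶜ) * A.v k) := by
    rw [hf, map_sub, map_smul, A.D_u, smul_zero, sub_zero]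
  rw [← h4, ← h3, hf]
  ring

theorem cu_left_mul (k : κ) (f : Poly3) :
    A.cu k (leftEmb (permPoly d Sᶜ) * f) = permPoly d (Z k)ᶜ * A.cv k f := by
  have h : ∀ j, A.cu k (leftEmb (permPoly d Sᶜ) * A.v j) =
      if j = k then permPoly d (Z k)ᶜ else 0 := by
    intro j
    rw [A.left_mul_v, map_add, A.cu_mul, add_zero, map_smul, A.cu_u, smul_eq_mul]
    split_ifs with h
    · rw [h, mul_one]
    · rw [mul_zero]
  conv_lhs => rw [A.eq_sum_v f]
  rw [mul_add, Finset.mul_sum, map_add, mul_left_comm, A.cu_mul, add_zero, map_sum]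
  simp only [mul_smul_comm, map_smul, h]
  simp [mul_comm]

/-- After multiplication by `p_T`, which is cancellable, this follows from the relations for `u` and
`v` and the identity of potentials. It is the second coordinate of the cycle condition for `incl`.
-/
theorem smul_D_v (k : κ) : permPoly d (Z k) • A.D (leftEmb (permPoly d Sᶜ) * A.v k) =
    -(rightEmb (permPoly d Tᶜ) * A.u k) -
      leftEmb (permPoly d Sᶜ) * A.D (leftEmb (permPoly d S) * A.u k) := by
  refine A.mul_right_injective ?_
  have e1 := mul_compl (S := S) (T := T) (Z k)
  have e2 := A.left_mul_u k
  have e3 := A.left_mul_v k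
  simp only [Polynomial.smul_eq_C_mul] at e2 e3 ⊢
  linear_combination A.u k * e1 - leftEmb (permPoly d Sᶜ) * e2 -
    Polynomial.C (permPoly d (Z k)) * e3

theorem smul_D_u (k : κ) : permPoly d (Z k)ᶜ • A.D (leftEmb (permPoly d S) * A.u k) =
    -(rightEmb (permPoly d Tᶜ) * A.v k) -
      leftEmb (permPoly d S) * A.D (leftEmb (permPoly d Sᶜ) * A.v k) := by
  refine A.mul_right_injective ?_
  have e1 := mul_compl (S := S) (T := T) (Z k)
  have e2 := A.left_mul_u k
  have e3 := A.left_mul_v k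
  simp only [Polynomial.smul_eq_C_mul] at e2 e3 ⊢
  linear_combination A.v k * e1 - leftEmb (permPoly d S) * e3 -
    Polynomial.C (permPoly d (Z k)ᶜ) * e2

/-- Quotient by quotient, along `f = ∑ cv k f • v k + p_T D f`. It measures how division fails to
commute with `p_{Sᶜ}`, the defect that the second coordinate of `incl` absorbs. -/
theorem D_left_mul_v (f : Poly3) : A.D (leftEmb (permPoly d Sᶜ) * f) =
    leftEmb (permPoly d Sᶜ) * A.D f +
      ∑ k, A.cv k f • A.D (leftEmb (permPoly d Sᶜ) * A.v k) := by
  conv_lhs => rw [A.eq_sum_v f]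
  rw [mul_add, Finset.mul_sum, map_add, mul_left_comm, A.D_mul, map_sum, add_comm]
  simp only [mul_smul_comm, map_smul]

theorem D_left_mul_u (f : Poly3) : A.D (leftEmb (permPoly d S) * f) =
    leftEmb (permPoly d S) * A.D f +
      ∑ k, A.cu k f • A.D (leftEmb (permPoly d S) * A.u k) := by
  conv_lhs => rw [A.eq_sum_u f]
  rw [mul_add, Finset.mul_sum, map_add, mul_left_comm, A.D_mul, map_sum, add_comm]
  simp only [mul_smul_comm, map_smul]

end Splitting

theorem smul_ofPoly3_mem {d : ℕ} {α β q b : ℂ} {p : Poly} {f : Poly3} {a : ℂ} (hp : p ∈ polyDeg d a)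
    (hf : f ∈ poly3Deg d b) (h : a + b = q - α - β) :
    p • BTensor.ofPoly3 f ∈ ((GrBimod.shift d α).tensor (GrBimod.shift d β)).deg q := by
  rw [← map_smul, Polynomial.smul_eq_C_mul]
  refine ofPoly3_mem ?_
  rw [← h]
  exact mul_mem_poly3Deg (C_mem_poly3Deg hp) hf

theorem card_compl_cast {d : ℕ} [NeZero d] (S : Finset (ZMod d)) :
    ((Sᶜ.card : ℕ) : ℂ) = d - S.card := by
  have := Finset.card_add_card_compl S
  rw [ZMod.card] at this
  rw [eq_sub_iff_add_eq, add_comm]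
  exact_mod_cast this

theorem GrMF.sum_even_apply {d : ℕ} {κ : Type} [Fintype κ] {M N : GrMF d} (f : κ → (M ⟶ N))
    (m : M.M0) :
    (∑ k, f k).1.1 m = ∑ k, (f k).1.1 m :=
  map_sum (AddMonoidHom.mk' (fun g : M ⟶ N => g.1.1 m) fun _ _ => rfl) f Finset.univ

theorem GrMF.sum_odd_apply {d : ℕ} {κ : Type} [Fintype κ] {M N : GrMF d} (f : κ → (M ⟶ N))
    (m : M.M1) :
    (∑ k, f k).1.2 m = ∑ k, (f k).1.2 m :=
  map_sum (AddMonoidHom.mk' (fun g : M ⟶ N => g.1.2 m) fun _ _ => rfl) f Finset.univ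

theorem BTensor.toPoly3_injective : Function.Injective BTensor.toPoly3 :=
  Function.LeftInverse.injective BTensor.ofPoly3_toPoly3

/-! ### The direct sum decomposition given by a splitting -/

namespace Splitting

variable {d : ℕ} [NeZero d] {S T : Finset (ZMod d)} {κ : Type} [Fintype κ] [DecidableEq κ]
  {Z : κ → Finset (ZMod d)} (A : Splitting S T Z)

theorem D_left_u_mem (k : κ) : A.D (leftEmb (permPoly d S) * A.u k) ∈
    poly3Deg d (2 / (d : ℂ) * S.card + A.degU k - 2 / (d : ℂ) * T.card) :=
  A.D_mem _ _ (mul_mem_poly3Deg (leftEmb_mem_poly3Deg (permPoly_mem d S)) (A.u_mem k))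

theorem D_left_v_mem (k : κ) : A.D (leftEmb (permPoly d Sᶜ) * A.v k) ∈
    poly3Deg d (2 - 2 / (d : ℂ) * S.card + A.degV k - 2 / (d : ℂ) * T.card) := by
  have h := A.D_mem _ _ (mul_mem_poly3Deg (leftEmb_mem_poly3Deg (permPoly_mem d Sᶜ)) (A.v_mem k))
  have hd : (d : ℂ) ≠ 0 := NeZero.ne _
  convert h using 4
  rw [card_compl_cast]
  field_simp

/-- The inclusion of a summand. -/
def incl (k : κ) : permMF d (Z k) ((1 - (Z k).card) / d) ⟶
    (permMF d S ((1 - S.card) / d)).tensor (permMF d T ((1 - T.card) / d)) :=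
  -- The second coordinates are forced by the cycle condition: they remove the multiples of `p_T` by
  -- which `p_{Sᶜ} v_k` and `p_S u_k` differ from `p_{(Z k)ᶜ} u_k` and `p_{Z k} v_k`.
  ⟨(LinearMap.toSpanSingleton Poly (BTensor Poly Poly × BTensor Poly Poly)
      (BTensor.ofPoly3 (A.v k), BTensor.ofPoly3 (A.D (leftEmb (permPoly d Sᶜ) * A.v k))),
    LinearMap.toSpanSingleton Poly (BTensor Poly Poly × BTensor Poly Poly)
      (BTensor.ofPoly3 (A.u k), BTensor.ofPoly3 (-A.D (leftEmb (permPoly d S) * A.u k)))),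
    fun q p hp => by
      constructor
      · refine smul_ofPoly3_mem hp (A.v_mem k) ?_
        rw [A.degV_eq]
        ring
      · refine smul_ofPoly3_mem hp (A.D_left_v_mem k) ?_
        rw [A.degV_eq]
        ring,
    fun q p hp => by
      constructor
      · refine smul_ofPoly3_mem hp (A.u_mem k) ?_
        rw [A.degU_eq, A.degV_eq]
        ring
      · refine smul_ofPoly3_mem hp (Submodule.neg_mem _ (A.D_left_u_mem k)) ?_
        rw [A.degU_eq, A.degV_eq]
        ring,
    by
      refine LinearMap.ext_ring (R := Poly) (Prod.ext ?_ ?_)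
      · change (permPoly d (Z k) * 1) • BTensor.ofPoly3 (A.v k) =
          BTensor.map (LinearMap.lsmul Poly Poly (permPoly d S)) LinearMap.id
            ((1 : Poly) • BTensor.ofPoly3 (A.u k)) +
          BTensor.map LinearMap.id (LinearMap.lsmul Poly Poly (permPoly d T))
            ((1 : Poly) • BTensor.ofPoly3 (-A.D (leftEmb (permPoly d S) * A.u k)))
        rw [mul_one, one_smul, one_smul, BTensor.map_left_ofPoly3, BTensor.map_right_ofPoly3,
          ← map_smul, ← map_add]
        refine congrArg _ ?_
        linear_combination -A.left_mul_u k
      · change (permPoly d (Z k) * 1) •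
            BTensor.ofPoly3 (A.D (leftEmb (permPoly d Sᶜ) * A.v k)) =
          -BTensor.map LinearMap.id (LinearMap.lsmul Poly Poly (permPoly d Tᶜ))
            ((1 : Poly) • BTensor.ofPoly3 (A.u k)) +
          BTensor.map (LinearMap.lsmul Poly Poly (permPoly d Sᶜ)) LinearMap.id
            ((1 : Poly) • BTensor.ofPoly3 (-A.D (leftEmb (permPoly d S) * A.u k)))
        rw [mul_one, one_smul, one_smul, BTensor.map_left_ofPoly3, BTensor.map_right_ofPoly3,
          ← map_smul, ← map_neg, ← map_add, A.smul_D_v]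
        refine congrArg _ ?_
        ring,
    by
      refine LinearMap.ext_ring (R := Poly) (Prod.ext ?_ ?_)
      · change (permPoly d (Z k)ᶜ * 1) • BTensor.ofPoly3 (A.u k) =
          BTensor.map (LinearMap.lsmul Poly Poly (permPoly d Sᶜ)) LinearMap.id
            ((1 : Poly) • BTensor.ofPoly3 (A.v k)) +
          -BTensor.map LinearMap.id (LinearMap.lsmul Poly Poly (permPoly d T))
            ((1 : Poly) • BTensor.ofPoly3 (A.D (leftEmb (permPoly d Sᶜ) * A.v k)))
        rw [mul_one, one_smul, one_smul, BTensor.map_left_ofPoly3, BTensor.map_right_ofPoly3,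
          ← map_smul, ← map_neg, ← map_add]
        refine congrArg _ ?_
        linear_combination -A.left_mul_v k
      · change (permPoly d (Z k)ᶜ * 1) •
            BTensor.ofPoly3 (-A.D (leftEmb (permPoly d S) * A.u k)) =
          BTensor.map LinearMap.id (LinearMap.lsmul Poly Poly (permPoly d Tᶜ))
            ((1 : Poly) • BTensor.ofPoly3 (A.v k)) +
          BTensor.map (LinearMap.lsmul Poly Poly (permPoly d S)) LinearMap.id
            ((1 : Poly) • BTensor.ofPoly3 (A.D (leftEmb (permPoly d Sᶜ) * A.v k)))
        rw [mul_one, one_smul, one_smul, BTensor.map_left_ofPoly3, BTensor.map_right_ofPoly3,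
          ← map_smul, ← map_add, smul_neg, A.smul_D_u]
        refine congrArg _ ?_
        ring⟩

/-- The projection to a summand. -/
def proj (k : κ) : (permMF d S ((1 - S.card) / d)).tensor (permMF d T ((1 - T.card) / d)) ⟶
    permMF d (Z k) ((1 - (Z k).card) / d) :=
  -- The blocks containing `N₁` are forgotten and coordinates are read modulo `p_T`. This commutes
  -- with the differentials since `N₁` maps to `N₀` by multiples of `p_T`.
  ⟨(A.cv k ∘ₗ BTensor.toPoly3 ∘ₗ
      LinearMap.fst Poly (BTensor Poly Poly) (BTensor Poly Poly),
    A.cu k ∘ₗ BTensor.toPoly3 ∘ₗ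
      LinearMap.fst Poly (BTensor Poly Poly) (BTensor Poly Poly)),
    fun q s hs => by
      have h := A.cv_mem k _ _ (toPoly3_mem hs.1)
      rw [A.degV_eq] at h
      refine (congrArg (_ ∈ polyDeg d ·) ?_).mp h
      ring,
    fun q s hs => by
      have h := A.cu_mem k _ _ (toPoly3_mem hs.1)
      rw [A.degU_eq, A.degV_eq] at h
      refine (congrArg (_ ∈ polyDeg d ·) ?_).mp h
      ring,
    by
      refine LinearMap.ext fun (s : BTensor Poly Poly × BTensor Poly Poly) => ?_
      change A.cv k (BTensor.toPoly3
          (BTensor.map (LinearMap.lsmul Poly Poly (permPoly d S)) LinearMap.id s.1 +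
          BTensor.map LinearMap.id (LinearMap.lsmul Poly Poly (permPoly d T)) s.2)) =
        permPoly d (Z k) * A.cu k (BTensor.toPoly3 s.1)
      rw [map_add, BTensor.toPoly3_map_left, BTensor.toPoly3_map_right, map_add, A.cv_mul,
        add_zero, A.cv_left_mul],
    by
      refine LinearMap.ext fun (s : BTensor Poly Poly × BTensor Poly Poly) => ?_
      change A.cu k (BTensor.toPoly3
          (BTensor.map (LinearMap.lsmul Poly Poly (permPoly d Sᶜ)) LinearMap.id s.1 +
          -BTensor.map LinearMap.id (LinearMap.lsmul Poly Poly (permPoly d T)) s.2)) =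
        permPoly d (Z k)ᶜ * A.cv k (BTensor.toPoly3 s.1)
      rw [map_add, map_neg, BTensor.toPoly3_map_left, BTensor.toPoly3_map_right, map_add, map_neg,
        A.cu_mul, neg_zero, add_zero, A.cu_left_mul]⟩

theorem incl_proj_self (k : κ) : A.incl k ≫ A.proj k = 𝟙 _ := by
  refine GrMF.hom_ext (fun (p : Poly) => ?_) (fun (p : Poly) => ?_)
  · change A.cv k (BTensor.toPoly3 (p • BTensor.ofPoly3 (A.v k))) = p
    rw [map_smul, BTensor.toPoly3_ofPoly3, map_smul, A.cv_v, if_pos rfl, smul_eq_mul, mul_one]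
  · change A.cu k (BTensor.toPoly3 (p • BTensor.ofPoly3 (A.u k))) = p
    rw [map_smul, BTensor.toPoly3_ofPoly3, map_smul, A.cu_u, if_pos rfl, smul_eq_mul, mul_one]

theorem incl_proj_of_ne {j k : κ} (h : j ≠ k) : A.incl j ≫ A.proj k = 0 := by
  refine GrMF.hom_ext (fun (p : Poly) => ?_) (fun (p : Poly) => ?_)
  · change A.cv k (BTensor.toPoly3 (p • BTensor.ofPoly3 (A.v j))) = 0
    rw [map_smul, BTensor.toPoly3_ofPoly3, map_smul, A.cv_v, if_neg h, smul_zero]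
  · change A.cu k (BTensor.toPoly3 (p • BTensor.ofPoly3 (A.u j))) = 0
    rw [map_smul, BTensor.toPoly3_ofPoly3, map_smul, A.cu_u, if_neg h, smul_zero]

theorem sum_proj_incl_even (s : BTensor Poly Poly × BTensor Poly Poly) :
    (∑ k, A.proj k ≫ A.incl k).1.1 s =
      (BTensor.ofPoly3 (∑ k, A.cv k (BTensor.toPoly3 s.1) • A.v k),
        BTensor.ofPoly3 (∑ k, A.cv k (BTensor.toPoly3 s.1) •
          A.D (leftEmb (permPoly d Sᶜ) * A.v k))) := by
  refine (GrMF.sum_even_apply (fun k => A.proj k ≫ A.incl k) s).trans ?_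
  rw [map_sum, map_sum]
  simp only [map_smul]
  rw [prod_mk_sum]
  rfl

theorem sum_proj_incl_odd (s : BTensor Poly Poly × BTensor Poly Poly) :
    (∑ k, A.proj k ≫ A.incl k).1.2 s =
      (BTensor.ofPoly3 (∑ k, A.cu k (BTensor.toPoly3 s.1) • A.u k),
        BTensor.ofPoly3 (∑ k, A.cu k (BTensor.toPoly3 s.1) •
          -A.D (leftEmb (permPoly d S) * A.u k))) := by
  refine (GrMF.sum_odd_apply (fun k => A.proj k ≫ A.incl k) s).trans ?_
  rw [map_sum, map_sum]
  simp only [map_smul]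
  rw [prod_mk_sum]
  rfl

/-- Division by `p_T` contracts the kernel of the projection. In the first coordinate the homotopy
formula is division with remainder; in the second it is the commutation defect of `D`. -/
theorem homotopic_id : GrMF.Homotopic (𝟙 _) (∑ k, A.proj k ≫ A.incl k) := by
  let h : BTensor Poly Poly →ₗ[Poly] BTensor Poly Poly :=
    BTensor.ofPoly3 ∘ₗ A.D ∘ₗ BTensor.toPoly3
  -- The quotient goes from the `N₀` blocks to the `N₁` blocks, with the Koszul sign on `M₁`.
  refine ⟨(LinearMap.prod 0 (h ∘ₗ LinearMap.fst Poly _ (BTensor Poly Poly)) :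
      BTensor Poly Poly × BTensor Poly Poly →ₗ[Poly] BTensor Poly Poly × BTensor Poly Poly),
    (LinearMap.prod 0 (-h ∘ₗ LinearMap.fst Poly _ (BTensor Poly Poly)) :
      BTensor Poly Poly × BTensor Poly Poly →ₗ[Poly] BTensor Poly Poly × BTensor Poly Poly),
    ?_, ?_, ?_, ?_⟩
  · intro q s hs
    refine ⟨Submodule.zero_mem _, ofPoly3_mem ?_⟩
    refine (congrArg (_ ∈ poly3Deg d ·) ?_).mp (A.D_mem _ _ (toPoly3_mem hs.1))
    ring
  · intro q s hs
    refine ⟨Submodule.zero_mem _, Submodule.neg_mem _ (ofPoly3_mem ?_)⟩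
    refine (congrArg (_ ∈ poly3Deg d ·) ?_).mp (A.D_mem _ _ (toPoly3_mem hs.1))
    ring
  · refine LinearMap.ext fun (s : BTensor Poly Poly × BTensor Poly Poly) => ?_
    refine (congrArg (fun t : BTensor Poly Poly × BTensor Poly Poly => s - t)
      (A.sum_proj_incl_even s)).trans ?_
    change _ =
      (BTensor.map (LinearMap.lsmul Poly Poly (permPoly d S)) LinearMap.id 0 +
          BTensor.map LinearMap.id (LinearMap.lsmul Poly Poly (permPoly d T)) (h s.1),
        -BTensor.map LinearMap.id (LinearMap.lsmul Poly Poly (permPoly d Tᶜ)) 0 +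
          BTensor.map (LinearMap.lsmul Poly Poly (permPoly d Sᶜ)) LinearMap.id (h s.1)) +
      (0, -h (BTensor.map (LinearMap.lsmul Poly Poly (permPoly d Sᶜ)) LinearMap.id s.1 +
          -BTensor.map LinearMap.id (LinearMap.lsmul Poly Poly (permPoly d T)) s.2))
    refine Prod.ext (BTensor.toPoly3_injective ?_) (BTensor.toPoly3_injective ?_)
    · simp only [Prod.fst_sub, Prod.fst_add, map_zero, map_sub, map_add, zero_add, add_zero,
        BTensor.toPoly3_map_right, BTensor.toPoly3_ofPoly3, h, LinearMap.comp_apply]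
      rw [sub_eq_iff_eq_add']
      exact A.eq_sum_v _
    · simp only [Prod.snd_sub, Prod.snd_add, map_zero, map_sub, map_add, map_neg, zero_add,
        neg_zero, BTensor.toPoly3_map_right, BTensor.toPoly3_map_left,
        BTensor.toPoly3_ofPoly3, h, LinearMap.comp_apply, A.D_mul]
      rw [A.D_left_mul_v (BTensor.toPoly3 s.1)]
      ring
  · refine LinearMap.ext fun (s : BTensor Poly Poly × BTensor Poly Poly) => ?_
    refine (congrArg (fun t : BTensor Poly Poly × BTensor Poly Poly => s - t)
      (A.sum_proj_incl_odd s)).trans ?_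
    change _ =
      (BTensor.map (LinearMap.lsmul Poly Poly (permPoly d Sᶜ)) LinearMap.id 0 +
          -BTensor.map LinearMap.id (LinearMap.lsmul Poly Poly (permPoly d T)) (-h s.1),
        BTensor.map LinearMap.id (LinearMap.lsmul Poly Poly (permPoly d Tᶜ)) 0 +
          BTensor.map (LinearMap.lsmul Poly Poly (permPoly d S)) LinearMap.id (-h s.1)) +
      (0, h (BTensor.map (LinearMap.lsmul Poly Poly (permPoly d S)) LinearMap.id s.1 +
          BTensor.map LinearMap.id (LinearMap.lsmul Poly Poly (permPoly d T)) s.2))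
    refine Prod.ext (BTensor.toPoly3_injective ?_) (BTensor.toPoly3_injective ?_)
    · simp only [Prod.fst_sub, Prod.fst_add, map_zero, map_sub, map_add, map_neg, neg_neg,
        zero_add, add_zero,
        BTensor.toPoly3_map_right, BTensor.toPoly3_ofPoly3, h, LinearMap.comp_apply]
      rw [sub_eq_iff_eq_add']
      exact A.eq_sum_u _
    · simp only [Prod.snd_sub, Prod.snd_add, map_zero, map_sub, map_add, map_neg, zero_add,
        BTensor.toPoly3_map_right, BTensor.toPoly3_map_left, smul_neg,
        Finset.sum_neg_distrib,
        BTensor.toPoly3_ofPoly3, h, LinearMap.comp_apply, A.D_mul]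
      rw [A.D_left_mul_u (BTensor.toPoly3 s.1)]
      ring

/-- Inclusions and projections are orthogonal on the nose; completeness holds only up to homotopy,
hence in `HMF^gr_bi`. -/
theorem isDirectSum (A : Splitting S T Z) : IsDirectSum ((hatP d S).tensor (hatP d T))
    fun k => hatP d (Z k) := by
  refine isDirectSum_of_maps (fun k => (GrMF.toHMF d).map (A.incl k))
    (fun k => (GrMF.toHMF d).map (A.proj k))
    (fun k => congrArg (GrMF.toHMF d).map (A.incl_proj_self k))
    (fun j k h => (congrArg (GrMF.toHMF d).map (A.incl_proj_of_ne h)).trans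
      ((GrMF.toHMF d).map_zero _ _)) ?_
  exact ((GrMF.toHMF d).map_sum (fun k => A.proj k ≫ A.incl k) Finset.univ).symm.trans
    (CategoryTheory.Quotient.sound _ A.homotopic_id).symm

end Splitting

/-! ### Division by a monic linear factor -/

theorem eval_add_mul_divByMonic (a : Poly) (f : Poly3) : f = Polynomial.C (f.eval a) +
    (Polynomial.X - Polynomial.C a) * (f /ₘ (Polynomial.X - Polynomial.C a)) := by
  rw [← Polynomial.modByMonic_X_sub_C_eq_C_eval, Polynomial.modByMonic_add_div]

theorem divByMonic_eq_of_eq {a p : Poly} {f g : Poly3}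
    (h : f = Polynomial.C p + (Polynomial.X - Polynomial.C a) * g) :
    f /ₘ (Polynomial.X - Polynomial.C a) = g :=
  (Polynomial.div_modByMonic_unique _ _ (Polynomial.monic_X_sub_C a) ⟨h.symm, by
    rw [Polynomial.degree_X_sub_C]
    exact Polynomial.degree_C_le.trans_lt (by norm_num)⟩).1

/-- The quotient of the division by `X - a`, as a linear map. -/
def divLin (a : Poly) : Poly3 →ₗ[Poly] Poly3 where
  toFun f := f /ₘ (Polynomial.X - Polynomial.C a)
  map_add' f g := by
    refine divByMonic_eq_of_eq (p := f.eval a + g.eval a) ?_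
    conv_lhs => rw [eval_add_mul_divByMonic a f, eval_add_mul_divByMonic a g]
    rw [map_add]
    ring
  map_smul' p f := by
    refine divByMonic_eq_of_eq (p := p * f.eval a) ?_
    conv_lhs => rw [eval_add_mul_divByMonic a f]
    rw [RingHom.id_apply, map_mul, Polynomial.smul_eq_C_mul, Polynomial.smul_eq_C_mul]
    ring

theorem eval_add_mul_divLin (a : Poly) (f : Poly3) : f = Polynomial.C (f.eval a) +
    (Polynomial.X - Polynomial.C a) * divLin a f :=
  eval_add_mul_divByMonic a f

theorem divLin_mul (a : Poly) (f : Poly3) :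
    divLin a ((Polynomial.X - Polynomial.C a) * f) = f :=
  Polynomial.mul_divByMonic_cancel_left f (Polynomial.monic_X_sub_C a)

theorem divLin_C_add_mul (a p : Poly) (f : Poly3) :
    divLin a (Polynomial.C p + (Polynomial.X - Polynomial.C a) * f) = f :=
  divByMonic_eq_of_eq rfl

theorem divLin_C (a p : Poly) : divLin a (Polynomial.C p) = 0 :=
  divByMonic_eq_of_eq (p := p) (by rw [mul_zero, add_zero])

theorem dvd_of_eval_eq_zero {a b : Poly} (hab : b ≠ a) {f : Poly3} (ha : f.eval a = 0)
    (hb : f.eval b = 0) :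
    (Polynomial.X - Polynomial.C a) * (Polynomial.X - Polynomial.C b) ∣ f := by
  obtain ⟨g, rfl⟩ := Polynomial.dvd_iff_isRoot.mpr ha
  refine mul_dvd_mul_left _ (Polynomial.dvd_iff_isRoot.mpr ?_)
  rw [Polynomial.eval_mul, Polynomial.eval_sub, Polynomial.eval_X, Polynomial.eval_C] at hb
  exact (mul_eq_zero.mp hb).resolve_left (sub_ne_zero.mpr hab)

section Degrees

variable {d : ℕ} {a : Poly}

theorem C_mem_polyDeg_zero (c : ℂ) : (MvPolynomial.C c : Poly) ∈ polyDeg d 0 :=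
  MvPolynomial.isWeightedHomogeneous_C _ c

theorem pow_mem_polyDeg {b : ℂ} (ha : a ∈ polyDeg d b) (k : ℕ) : a ^ k ∈ polyDeg d (k * b) := by
  have := MvPolynomial.IsWeightedHomogeneous.pow ha k
  rwa [nsmul_eq_mul] at this

theorem eval_mem_polyDeg (ha : a ∈ polyDeg d (2 / (d : ℂ))) {q : ℂ} {f : Poly3}
    (hf : f ∈ poly3Deg d q) : f.eval a ∈ polyDeg d q := by
  rw [Polynomial.eval_eq_sum, Polynomial.sum]
  refine Submodule.sum_mem _ fun k _ => ?_
  have := mul_mem_polyDeg (hf k) (pow_mem_polyDeg ha k)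
  rwa [sub_add_cancel] at this

theorem divLin_mem_poly3Deg (ha : a ∈ polyDeg d (2 / (d : ℂ))) {q : ℂ} {f : Poly3}
    (hf : f ∈ poly3Deg d q) : divLin a f ∈ poly3Deg d (q - 2 / (d : ℂ)) := by
  intro n
  change (f /ₘ _).coeff n ∈ _
  rw [Polynomial.coeff_divByMonic_X_sub_C]
  refine Submodule.sum_mem _ fun i hi => ?_
  have := mul_mem_polyDeg (pow_mem_polyDeg ha (i - (n + 1))) (hf i)
  convert this using 2
  rw [Nat.cast_sub (Finset.mem_Icc.mp hi).1]
  push_cast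
  ring

end Degrees

/-! ### The roots of the permutation polynomials -/

section Roots

variable {d : ℕ}

variable (d) in
/-- The root `η ^ j y` of the linear factor `x - η ^ j y`. -/
def root (j : ZMod d) : Poly := MvPolynomial.C (eta d ^ j.val) * vy

theorem root_mem (j : ZMod d) : root d j ∈ polyDeg d (2 / (d : ℂ)) := by
  rw [root, ← MvPolynomial.smul_eq_C_mul]
  exact Submodule.smul_mem _ _ (GrBimod.vy_mem_polyDeg d)

theorem permPoly_eq (S : Finset (ZMod d)) : permPoly d S = ∏ j ∈ S, (vx - root d j) := rfl

theorem root_sub_root (i j : ZMod d) :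
    root d i - root d j = MvPolynomial.C (eta d ^ i.val - eta d ^ j.val) * vy := by
  rw [root, root, map_sub, sub_mul]

theorem leftEmb_root (j : ZMod d) :
    leftEmb (root d j) = Polynomial.C (MvPolynomial.C (eta d ^ j.val)) * Polynomial.X := by
  rw [root, map_mul, leftEmb_vy, ← MvPolynomial.algebraMap_eq, AlgHom.commutes]
  rfl

theorem rightEmb_root (j : ZMod d) : rightEmb (root d j) = Polynomial.C (root d j) := by
  rw [root, map_mul, rightEmb_vy, map_mul, ← MvPolynomial.algebraMap_eq, AlgHom.commutes]
  rfl

theorem rightEmb_permPoly (S : Finset (ZMod d)) :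
    rightEmb (permPoly d S) = ∏ j ∈ S, (Polynomial.X - Polynomial.C (root d j)) := by
  rw [permPoly_eq, map_prod]
  exact Finset.prod_congr rfl fun j _ => by rw [map_sub, rightEmb_vx, rightEmb_root]

variable [NeZero d]

theorem eta_pow_add (i j : ZMod d) :
    eta d ^ (i + j).val = eta d ^ i.val * eta d ^ j.val := by
  rw [← pow_add, ZMod.val_add]
  exact (pow_eq_pow_mod _ (eta_isPrimitiveRoot d).pow_eq_one).symm

/-- Setting `y = η ^ n z` turns `x - η ^ j y` into `x - η ^ (j + n) z`, so the labels are shifted by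
`n`. -/
theorem eval_leftEmb_permPoly (S : Finset (ZMod d)) (n : ZMod d) :
    (leftEmb (permPoly d S)).eval (root d n) = ∏ j ∈ S, (vx - root d (j + n)) := by
  rw [permPoly_eq, map_prod, Polynomial.eval_prod]
  refine Finset.prod_congr rfl fun j _ => ?_
  rw [map_sub, leftEmb_vx, leftEmb_root, Polynomial.eval_sub, Polynomial.eval_C,
    Polynomial.eval_mul, Polynomial.eval_C, Polynomial.eval_X, root, root, eta_pow_add, map_mul,
    mul_assoc]

theorem permPoly_interval (a : ZMod d) {k : ℕ} (hk : k ≤ d) :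
    permPoly d (interval d a k) = ∏ i ∈ Finset.range k, (vx - root d (a + (i : ZMod d))) := by
  rw [permPoly_eq, interval, Finset.prod_image]
  exact fun i hi j hj h => interval_injOn a hk hi hj h

theorem permPoly_interval_succ (a : ZMod d) {k : ℕ} (hk : k + 1 ≤ d) :
    permPoly d (interval d a (k + 1)) =
      permPoly d (interval d a k) * (vx - root d (a + (k : ZMod d))) := by
  rw [permPoly_interval a hk, permPoly_interval a (by omega), Finset.prod_range_succ]

theorem permPoly_interval_succ' (a : ZMod d) {k : ℕ} (hk : k + 1 ≤ d) :
    permPoly d (interval d a (k + 1)) =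
      (vx - root d a) * permPoly d (interval d (a + 1) k) := by
  rw [permPoly_interval a hk, permPoly_interval _ (by omega), Finset.prod_range_succ', mul_comm,
    Nat.cast_zero, add_zero]
  refine congrArg _ (Finset.prod_congr rfl fun i _ => ?_)
  rw [Nat.cast_add, Nat.cast_one, add_comm (i : ZMod d), add_assoc]

theorem eval_leftEmb_permPoly_interval (a n : ZMod d) {k : ℕ} (hk : k ≤ d) :
    (leftEmb (permPoly d (interval d a k))).eval (root d n) =
      permPoly d (interval d (a + n) k) := by
  rw [eval_leftEmb_permPoly, permPoly_interval _ hk, interval, Finset.prod_image]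
  · exact Finset.prod_congr rfl fun i _ => by rw [add_right_comm]
  · exact fun i hi j hj h => interval_injOn a hk hi hj h

end Roots

/-! ### The tensor product with `P̂_{n:0}` and `P̂_{n:1}` -/

section Instances

variable {d : ℕ} [NeZero d]

/-- The splitting of `P̂_{m:k-1} ⊗ P̂_{n:0}`, with one summand. -/
def splittingSingleton (m n : ZMod d) {k : ℕ} (hk : k ≤ d) :
    Splitting (interval d m k) (interval d n 1) (fun _ : Unit => interval d (m + n) k) where
  -- Modulo `y - η ^ n z` the quotient is `ℂ[x, z]` itself, with basis `1` and evaluation at the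
  -- root as coordinate.
  u _ := 1
  v _ := 1
  cu _ := Polynomial.leval (root d n)
  cv _ := Polynomial.leval (root d n)
  D := divLin (root d n)
  D_mul f := by
    rw [rightEmb_permPoly, interval]
    simpa using divLin_mul _ f
  eq_sum_u f := by
    rw [rightEmb_permPoly, interval]
    simpa [Polynomial.smul_eq_C_mul] using eval_add_mul_divLin (root d n) f
  eq_sum_v f := by
    rw [rightEmb_permPoly, interval]
    simpa [Polynomial.smul_eq_C_mul] using eval_add_mul_divLin (root d n) f
  cu_u _ _ := by simp [Polynomial.leval]
  cv_v _ _ := by simp [Polynomial.leval]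
  dvd _ := by
    rw [rightEmb_permPoly, interval]
    simp [Polynomial.dvd_iff_isRoot, eval_leftEmb_permPoly_interval m n hk]
  degU _ := 0
  degV _ := 0
  u_mem _ := one_mem_poly3Deg
  v_mem _ := one_mem_poly3Deg
  cu_mem _ q f hf := by rw [sub_zero]; exact eval_mem_polyDeg (root_mem n) hf
  cv_mem _ q f hf := by rw [sub_zero]; exact eval_mem_polyDeg (root_mem n) hf
  D_mem q f hf := by
    rw [card_interval n (NeZero.one_le), Nat.cast_one, mul_one]
    exact divLin_mem_poly3Deg (root_mem n) hf
  degV_eq _ := by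
    rw [card_interval n (NeZero.one_le), card_interval _ hk, card_interval _ hk]; simp
  degU_eq _ := by
    rw [card_interval _ hk, card_interval _ hk]; simp

theorem isDirectSum_tensor_singleton (m n : ZMod d) {k : ℕ} (hk : k ≤ d) :
    IsDirectSum ((hatP d (interval d m k)).tensor (hatP d (interval d n 1)))
      fun _ : Unit => hatP d (interval d (m + n) k) :=
  (splittingSingleton m n hk).isDirectSum

theorem rightEmb_permPoly_interval_two (hd : 2 ≤ d) (n : ZMod d) :
    rightEmb (permPoly d (interval d n 2)) = (Polynomial.X - Polynomial.C (root d n)) *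
      (Polynomial.X - Polynomial.C (root d (n + 1))) := by
  rw [permPoly_interval n hd, Finset.prod_range_succ, Finset.prod_range_one, map_mul, map_sub,
    map_sub, rightEmb_vx, rightEmb_root, rightEmb_root, Nat.cast_zero, add_zero, Nat.cast_one]

theorem root_injective : Function.Injective (root d) := by
  intro i j h
  refine eta_pow_injective d (sub_eq_zero.mp ?_)
  have h' := congrArg (MvPolynomial.eval ![0, 1])
      ((sub_eq_zero.mpr h).symm.trans (root_sub_root i j))
  simpa using h'.symm

/-- Any difference of two distinct roots is a nonzero scalar times the same variable, so ratios of
such differences are scalars. -/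
theorem exists_C_mul_sub {i j k l : ZMod d} (hij : i ≠ j) (hkl : k ≠ l) :
    ∃ c : ℂ, c ≠ 0 ∧ root d i - root d j = MvPolynomial.C c * (root d k - root d l) := by
  have h1 : eta d ^ i.val - eta d ^ j.val ≠ 0 :=
    sub_ne_zero.mpr fun h => hij (eta_pow_injective d h)
  have h2 : eta d ^ k.val - eta d ^ l.val ≠ 0 :=
    sub_ne_zero.mpr fun h => hkl (eta_pow_injective d h)
  refine ⟨_, div_ne_zero h1 h2, ?_⟩
  rw [root_sub_root, root_sub_root, ← mul_assoc, ← map_mul, div_mul_cancel₀ _ h2]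

/-- Let `a`, `b` be the two roots of `p_T` in `y`. Then `p_S` takes the values `A R` at `a` and `R
B` at `b`: the two shifted intervals share the middle `R` and differ by one end factor each. So `p_S
· 1 ≡ R v` if `v` has values `A`, `B` at `a`, `b`, and `p_S u ≡ A R B · 1` if `u` has values `B`,
`A`. These are the intervals of `l` and `l + 2` elements. -/
theorem exists_splitting_two (m n : ZMod d) {l : ℕ} (hl : l + 2 ≤ d) :
    Nonempty (Splitting (interval d m (l + 1)) (interval d n 2)
      ![interval d (m + n) (l + 2), interval d (m + n + 1) l]) := by
  have hd2 : 2 ≤ d := by omega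
  -- The scalar with `b - a = c (B - A)`. Linear interpolation then needs only division by the
  -- constant `c`, and the pairs `(u, 1)`, `(1, v)` are bases because the coefficient of `y` in `u`
  -- and `v` is a unit.
  obtain ⟨c, hc, hcr⟩ := exists_C_mul_sub (i := n + 1) (j := n) (k := m + n)
    (l := m + n + ((l + 1 : ℕ) : ZMod d))
    (fun h => by
      have : ((1 : ℕ) : ZMod d) = (0 : ℕ) := by simpa using h
      have := natCast_inj_of_lt (by omega) (by omega) this
      omega)
    (fun h => by
      have : ((l + 1 : ℕ) : ZMod d) = (0 : ℕ) := by rw [left_eq_add] at h; rw [h, Nat.cast_zero]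
      have := natCast_inj_of_lt (by omega) (by omega) this
      omega)
  set a := root d n with ha
  set b := root d (n + 1) with hb
  set A := vx - root d (m + n) with hA
  set B := vx - root d (m + n + ((l + 1 : ℕ) : ZMod d)) with hB
  have hcAB : b - a = MvPolynomial.C c * (B - A) := by rw [hcr, hA, hB]; ring
  have ham : a ∈ polyDeg d (2 / (d : ℂ)) := root_mem n
  have hbm : b ∈ polyDeg d (2 / (d : ℂ)) := root_mem (n + 1)
  have hAm : A ∈ polyDeg d (2 / (d : ℂ)) :=
    Submodule.sub_mem _ (GrBimod.vx_mem_polyDeg d) (root_mem _)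
  have hBm : B ∈ polyDeg d (2 / (d : ℂ)) :=
    Submodule.sub_mem _ (GrBimod.vx_mem_polyDeg d) (root_mem _)
  have hab : b ≠ a := fun h => by
    have : ((1 : ℕ) : ZMod d) = (0 : ℕ) := by simpa using root_injective h
    have := natCast_inj_of_lt (by omega) (by omega) this
    omega
  have hcc : (MvPolynomial.C c * MvPolynomial.C c⁻¹ : Poly) = 1 := by
    rw [← map_mul, mul_inv_cancel₀ hc, map_one]
  set R := permPoly d (interval d (m + n + 1) l) with hR
  have hSa : (leftEmb (permPoly d (interval d m (l + 1)))).eval a = A * R := by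
    rw [ha, eval_leftEmb_permPoly_interval m n (by omega), permPoly_interval_succ' _ (by omega)]
  have hSb : (leftEmb (permPoly d (interval d m (l + 1)))).eval b = R * B := by
    rw [hb, eval_leftEmb_permPoly_interval m (n + 1) (by omega), ← add_assoc,
      permPoly_interval_succ _ (by omega), hB, Nat.cast_add, Nat.cast_one, add_right_comm (m + n),
      ← add_assoc (m + n)]
  have hZ : permPoly d (interval d (m + n) (l + 2)) = A * R * B := by
    rw [permPoly_interval_succ _ (by omega), permPoly_interval_succ' _ (by omega)]
  have hT := rightEmb_permPoly_interval_two hd2 n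
  rw [← ha, ← hb] at hT
  have hf : ∀ f : Poly3, f = Polynomial.C (f.eval a) + (Polynomial.X - Polynomial.C a) *
      (Polynomial.C ((divLin a f).eval b) + (Polynomial.X - Polynomial.C b) *
        divLin b (divLin a f)) := fun f => by
    rw [← eval_add_mul_divLin b, ← eval_add_mul_divLin a]
  have hcc3 :
      (Polynomial.C (MvPolynomial.C c) * Polynomial.C (MvPolynomial.C c⁻¹) : Poly3) = 1 := by
    rw [← map_mul, hcc, map_one]
  let v : Poly3 := Polynomial.C A + (Polynomial.X - Polynomial.C a) *
    Polynomial.C (MvPolynomial.C c⁻¹)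
  let u : Poly3 := Polynomial.C B + (Polynomial.X - Polynomial.C a) *
    Polynomial.C (-MvPolynomial.C c⁻¹)
  -- The divided difference at `a`, `b`: the second coefficient in Newton's form `f = f(a) + (y - a)
  -- e(f) + (y - a)(y - b) D f`.
  let e : Poly3 →ₗ[Poly] Poly := Polynomial.leval b ∘ₗ divLin a
  have he : ∀ f, e f = (divLin a f).eval b := fun f => rfl
  have ev : e v = MvPolynomial.C c⁻¹ := by
    rw [he, divLin_C_add_mul, Polynomial.eval_C]
  have eu : e u = -MvPolynomial.C c⁻¹ := by
    rw [he, divLin_C_add_mul, Polynomial.eval_C]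
  have e1 : e 1 = 0 := by
    rw [he, ← map_one Polynomial.C, divLin_C, Polynomial.eval_zero]
  have hva : v.eval a = A := by simp [v]
  have hua : u.eval a = B := by simp [u]
  have hvb : v.eval b = B := by
    simp only [v, Polynomial.eval_add, Polynomial.eval_C, Polynomial.eval_mul,
      Polynomial.eval_sub, Polynomial.eval_X, hcAB]
    linear_combination (B - A) * hcc
  have hub : u.eval b = A := by
    simp only [u, Polynomial.eval_add, Polynomial.eval_C, Polynomial.eval_mul,
      Polynomial.eval_sub, Polynomial.eval_X, hcAB]
    linear_combination (A - B) * hcc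
  have hem : ∀ q f, f ∈ poly3Deg d q → e f ∈ polyDeg d (q - 2 / (d : ℂ)) := fun q f h =>
    eval_mem_polyDeg hbm (divLin_mem_poly3Deg ham h)
  have hlin : ∀ (C' : Poly), C' ∈ polyDeg d (2 / (d : ℂ)) → ∀ c' : ℂ,
      Polynomial.C C' + (Polynomial.X - Polynomial.C a) * Polynomial.C (MvPolynomial.C c') ∈
        poly3Deg d (2 / (d : ℂ)) := fun C' h c' => by
    refine Submodule.add_mem _ (C_mem_poly3Deg h) ?_
    have := mul_mem_poly3Deg (Submodule.sub_mem _ X_mem_poly3Deg (C_mem_poly3Deg ham))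
      (C_mem_poly3Deg (C_mem_polyDeg_zero (d := d) c'))
    rwa [add_zero] at this
  have hmulm : ∀ (C' : Poly), C' ∈ polyDeg d (2 / (d : ℂ)) → ∀ q f, f ∈ poly3Deg d q →
      C' * e f ∈ polyDeg d q := fun C' h q f hf => by
    have := mul_mem_polyDeg h (hem q f hf)
    rwa [add_sub_cancel] at this
  have hcm : ∀ (C' : Poly), C' ∈ polyDeg d (2 / (d : ℂ)) →
      MvPolynomial.C c * C' ∈ polyDeg d (2 / (d : ℂ)) := fun C' h => by
    rw [← MvPolynomial.smul_eq_C_mul]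
    exact Submodule.smul_mem _ _ h
  refine ⟨{
    u := ![u, 1]
    v := ![1, v]
    -- Newton's form rewritten with `y - a = c (B - u)`, and below with `y - a = c (v - A)`.
    cu := ![(-MvPolynomial.C c : Poly) • e, Polynomial.leval a + (MvPolynomial.C c * B) • e]
    cv := ![Polynomial.leval a - (MvPolynomial.C c * A) • e, (MvPolynomial.C c : Poly) • e]
    D := divLin b ∘ₗ divLin a
    D_mul := fun f => by
      rw [hT, mul_assoc, LinearMap.comp_apply, divLin_mul, divLin_mul]
    eq_sum_u := fun f => ?_
    eq_sum_v := fun f => ?_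
    cu_u := ?_
    cv_v := ?_
    dvd := ?_
    degU := ![2 / (d : ℂ), 0]
    degV := ![0, 2 / (d : ℂ)]
    u_mem := ?_
    v_mem := ?_
    cu_mem := ?_
    cv_mem := ?_
    D_mem := ?_
    degV_eq := ?_
    degU_eq := ?_ }⟩
  · rw [hT, Fin.sum_univ_two]
    change f = (-MvPolynomial.C c * e f) • u + (f.eval a + MvPolynomial.C c * B * e f) • 1 +
      _ * divLin b (divLin a f)
    simp only [u, Polynomial.smul_eq_C_mul, map_add, map_mul, map_neg, he]
    linear_combination hf f - (Polynomial.X - Polynomial.C a) *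
      Polynomial.C ((divLin a f).eval b) * hcc3
  · rw [hT, Fin.sum_univ_two]
    change f = (f.eval a - MvPolynomial.C c * A * e f) • 1 + (MvPolynomial.C c * e f) • v +
      _ * divLin b (divLin a f)
    simp only [v, Polynomial.smul_eq_C_mul, map_sub, map_mul, he]
    linear_combination hf f - (Polynomial.X - Polynomial.C a) *
      Polynomial.C ((divLin a f).eval b) * hcc3
  · rw [Fin.forall_fin_two]
    constructor <;> rw [Fin.forall_fin_two] <;> constructor
    · change -MvPolynomial.C c * e u = 1
      rw [eu]
      linear_combination hcc
    · change -MvPolynomial.C c * e 1 = 0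
      rw [e1, mul_zero]
    · change u.eval a + MvPolynomial.C c * B * e u = 0
      rw [eu, hua]
      linear_combination -B * hcc
    · change (1 : Poly3).eval a + MvPolynomial.C c * B * e 1 = 1
      rw [e1, mul_zero, add_zero, Polynomial.eval_one]
  · rw [Fin.forall_fin_two]
    constructor <;> rw [Fin.forall_fin_two] <;> constructor
    · change (1 : Poly3).eval a - MvPolynomial.C c * A * e 1 = 1
      rw [e1, mul_zero, sub_zero, Polynomial.eval_one]
    · change v.eval a - MvPolynomial.C c * A * e v = 0
      rw [ev, hva]
      linear_combination -A * hcc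
    · change MvPolynomial.C c * e 1 = 0
      rw [e1, mul_zero]
    · change MvPolynomial.C c * e v = 1
      rw [ev, hcc]
  · rw [Fin.forall_fin_two, hT]
    constructor <;> refine dvd_of_eval_eq_zero hab ?_ ?_
    · change (_ * u - permPoly d (interval d (m + n) (l + 2)) • (1 : Poly3)).eval a = 0
      rw [Polynomial.eval_sub, Polynomial.eval_mul, hSa, hua, Polynomial.eval_smul,
        Polynomial.eval_one, hZ, smul_eq_mul]
      ring
    · change (_ * u - permPoly d (interval d (m + n) (l + 2)) • (1 : Poly3)).eval b = 0
      rw [Polynomial.eval_sub, Polynomial.eval_mul, hSb, hub, Polynomial.eval_smul,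
        Polynomial.eval_one, hZ, smul_eq_mul]
      ring
    · change (_ * 1 - R • v).eval a = 0
      rw [Polynomial.eval_sub, Polynomial.eval_mul, hSa, Polynomial.eval_smul, hva,
        Polynomial.eval_one, smul_eq_mul]
      ring
    · change (_ * 1 - R • v).eval b = 0
      rw [Polynomial.eval_sub, Polynomial.eval_mul, hSb, Polynomial.eval_smul, hvb,
        Polynomial.eval_one, smul_eq_mul]
      ring
  · rw [Fin.forall_fin_two]
    refine ⟨?_, one_mem_poly3Deg⟩
    have := hlin B hBm (-c⁻¹)
    rwa [map_neg] at this
  · rw [Fin.forall_fin_two]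
    exact ⟨one_mem_poly3Deg, hlin A hAm c⁻¹⟩
  · rw [Fin.forall_fin_two]
    refine ⟨fun q f h => ?_, fun q f h => ?_⟩
    · change -MvPolynomial.C c * e f ∈ polyDeg d (q - 2 / (d : ℂ))
      have := mul_mem_polyDeg (Submodule.neg_mem _ (C_mem_polyDeg_zero (d := d) c)) (hem q f h)
      rwa [zero_add] at this
    · change f.eval a + MvPolynomial.C c * B * e f ∈ polyDeg d (q - 0)
      rw [sub_zero]
      exact Submodule.add_mem _ (eval_mem_polyDeg ham h) (hmulm _ (hcm B hBm) q f h)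
  · rw [Fin.forall_fin_two]
    refine ⟨fun q f h => ?_, fun q f h => ?_⟩
    · change f.eval a - MvPolynomial.C c * A * e f ∈ polyDeg d (q - 0)
      rw [sub_zero]
      exact Submodule.sub_mem _ (eval_mem_polyDeg ham h) (hmulm _ (hcm A hAm) q f h)
    · change MvPolynomial.C c * e f ∈ polyDeg d (q - 2 / (d : ℂ))
      have := mul_mem_polyDeg (C_mem_polyDeg_zero (d := d) c) (hem q f h)
      rwa [zero_add] at this
  · intro q f h
    have := divLin_mem_poly3Deg hbm (divLin_mem_poly3Deg ham h)
    rw [card_interval n hd2]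
    refine (congrArg (_ ∈ poly3Deg d ·) ?_).mp this
    push_cast
    ring
  · rw [Fin.forall_fin_two, card_interval n hd2, card_interval m (by omega)]
    constructor
    · change (0 : ℂ) = (1 - (interval d (m + n) (l + 2)).card) / d - _ - _
      rw [card_interval _ hl]
      push_cast
      ring
    · change (2 / (d : ℂ)) = (1 - (interval d (m + n + 1) l).card) / d - _ - _
      rw [card_interval _ (by omega)]
      push_cast
      ring
  · rw [Fin.forall_fin_two, card_interval m (by omega)]
    constructor
    · change (2 / (d : ℂ)) = 0 + 2 / (d : ℂ) * (interval d (m + n) (l + 2)).card - _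
      rw [card_interval _ hl]
      push_cast
      ring
    · change (0 : ℂ) = 2 / (d : ℂ) + 2 / (d : ℂ) * (interval d (m + n + 1) l).card - _
      rw [card_interval _ (by omega)]
      push_cast
      ring

theorem isDirectSum_tensor_two (m n : ZMod d) {l : ℕ} (hl : l + 2 ≤ d) :
    IsDirectSum ((hatP d (interval d m (l + 1))).tensor (hatP d (interval d n 2)))
      fun k => hatP d ((![interval d (m + n) (l + 2), interval d (m + n + 1) l] :
        Fin 2 → Finset (ZMod d)) k) :=
  (exists_splitting_two m n hl).some.isDirectSum

end Instances

/-! ### The fusion rules -/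

section Fusion

theorem mem_fusionLabels {d l m ν : ℕ} : ν ∈ fusionLabels d l m ↔
    (max l m - min l m ≤ ν ∧ ν ≤ min (l + m) (2 * d - 4 - l - m)) ∧ ν % 2 = (l + m) % 2 := by
  rw [fusionLabels, Finset.mem_filter, Finset.mem_Icc]

/-- The symmetric form: triangle inequalities, the level bound and parity. The bound on `l + m`
keeps the truncated subtraction in the definition exact. -/
theorem mem_fusionLabels_iff {d l m ν : ℕ} (h : l + m ≤ 2 * d - 4) : ν ∈ fusionLabels d l m ↔
    (l ≤ m + ν ∧ m ≤ l + ν ∧ ν ≤ l + m ∧ l + m + ν ≤ 2 * d - 4) ∧ ν % 2 = (l + m) % 2 := by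
  rw [mem_fusionLabels]
  refine and_congr_left fun _ => ?_
  rw [le_min_iff]
  omega

theorem le_of_mem_fusionLabels {d l m ν : ℕ} (h : ν ∈ fusionLabels d l m) : ν ≤ d - 2 := by
  rw [mem_fusionLabels] at h
  omega

variable {d : ℕ} [NeZero d]

/-- For `k = 0` and `k = d` the right side is automatically zero, in accordance with the
contractible objects. -/
theorem finrank_hom_interval (i : ZMod d × Fin (d - 1)) (c : ZMod d) {k : ℕ} (hk : k ≤ d) :
    Module.finrank ℂ (simples d i ⟶ hatP d (interval d c k)) =
      if i.1 = c ∧ (i.2 : ℕ) + 1 = k then 1 else 0 := by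
  rw [finrank_hom_hatP]
  refine if_congr ⟨fun h => ?_, fun h => by rw [h.1, h.2]⟩ rfl rfl
  have hc : (i.2 : ℕ) + 1 = k := by
    rw [← card_interval i.1 (k := (i.2 : ℕ) + 1) (by omega), h, card_interval c hk]
  exact ⟨(interval_inj (by omega) (by omega) (by omega) h).1, hc⟩

theorem finrank_hom_of_isDirectSum' {K : Type} [Fintype K] {X : HMF d} {F : K → HMF d}
    (h : IsDirectSum X F) (hF : ∀ k, IsSummand (simples d) (F k))
    (i : ZMod d × Fin (d - 1)) :
    Module.finrank ℂ (simples d i ⟶ X) = ∑ k, Module.finrank ℂ (simples d i ⟶ F k) := by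
  have : ∀ k, Module.Finite ℂ (simples d i ⟶ F k) := fun k =>
    isSchurFamily_simples.finite_hom (hF k) i
  exact IsSchurFamily.finrank_hom_of_isDirectSum h

/-- The Clebsch–Gordan recursion with truncation: tensoring with the label `1` moves each label of
`(l, m)` one step up or down, which gives the labels of `(l, m + 1)` together with those of `(l, m -
1)`. The guard `1 ≤ t` excludes the spurious value of `t - 1` at `t = 0`. -/
theorem fusionLabels_recursion {d l m t : ℕ} (hm : 1 ≤ m) (hl : l ≤ d - 2)
    (hm' : m + 1 ≤ d - 2) (ht : t ≤ d - 2) :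
    ((if t - 1 ∈ fusionLabels d l m then (if 1 ≤ t then 1 else 0) else 0) +
      if t + 1 ∈ fusionLabels d l m then 1 else 0) =
    (if t ∈ fusionLabels d l (m + 1) then 1 else 0) +
      if t ∈ fusionLabels d l (m - 1) then 1 else 0 := by
  rw [← ite_and]
  have hA : t - 1 ∈ fusionLabels d l m ∧ 1 ≤ t ↔
      (l + 1 ≤ m + t ∧ m + 1 ≤ l + t ∧ t ≤ l + m + 1 ∧ l + m + t ≤ 2 * d - 3) ∧ 1 ≤ t ∧
        t % 2 = (l + m + 1) % 2 := by
    rw [mem_fusionLabels_iff (by omega)]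
    omega
  have hB : t + 1 ∈ fusionLabels d l m ↔
      (l ≤ m + t + 1 ∧ m ≤ l + t + 1 ∧ t + 1 ≤ l + m ∧ l + m + t + 1 ≤ 2 * d - 4) ∧
        t % 2 = (l + m + 1) % 2 := by
    rw [mem_fusionLabels_iff (by omega)]
    omega
  have hC : t ∈ fusionLabels d l (m + 1) ↔
      (l ≤ m + 1 + t ∧ m + 1 ≤ l + t ∧ t ≤ l + m + 1 ∧ l + m + 1 + t ≤ 2 * d - 4) ∧
        t % 2 = (l + m + 1) % 2 := by
    rw [mem_fusionLabels_iff (by omega)]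
    omega
  have hD : t ∈ fusionLabels d l (m - 1) ↔
      (l + 1 ≤ m + t ∧ m ≤ l + t + 1 ∧ t + 1 ≤ l + m ∧ l + m + t ≤ 2 * d - 3) ∧
        t % 2 = (l + m + 1) % 2 := by
    rw [mem_fusionLabels_iff (by omega)]
    omega
  simp only [hA, hB, hC, hD]
  by_cases hp : t % 2 = (l + m + 1) % 2
  · simp only [hp, and_true]
    split_ifs <;> omega
  · simp only [hp, and_false, if_false]

variable (d) in
/-- The multiplicity of `P̂_{i}` in the direct sum of the `P̂_{b + (l + m - ν) / 2 : ν}`. -/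
def fusionMult (b : ZMod d) (l m : ℕ) (i : ZMod d × Fin (d - 1)) : ℕ :=
  if (i.2 : ℕ) ∈ fusionLabels d l m ∧ i.1 = b + (((l + m - i.2) / 2 : ℕ) : ZMod d) then 1 else 0

theorem isSummand_of_fusion (hd : 2 ≤ d) {b : ZMod d} {l m : ℕ} {X : HMF d}
    (h : IsDirectSum X fun ν : fusionLabels d l m =>
      hatPc d (b + (((l + m - (ν : ℕ)) / 2 : ℕ) : ZMod d)) ν) : IsSummand (simples d) X :=
  .of_isDirectSum h fun ν => isSummand_hatP_interval _ (by
    have := le_of_mem_fusionLabels ν.2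
    omega)

theorem finrank_hom_fusion (hd : 2 ≤ d) {b : ZMod d} {l m : ℕ} {X : HMF d}
    (h : IsDirectSum X fun ν : fusionLabels d l m =>
      hatPc d (b + (((l + m - (ν : ℕ)) / 2 : ℕ) : ZMod d)) ν) (i : ZMod d × Fin (d - 1)) :
    Module.finrank ℂ (simples d i ⟶ X) = fusionMult d b l m i := by
  have hν : ∀ ν : fusionLabels d l m, (ν : ℕ) + 1 ≤ d := fun ν => by
    have := le_of_mem_fusionLabels ν.2
    omega
  rw [finrank_hom_of_isDirectSum' h fun ν => isSummand_hatP_interval _ (hν ν)]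
  have h1 : ∀ ν : fusionLabels d l m, Module.finrank ℂ (simples d i ⟶
      hatPc d (b + (((l + m - (ν : ℕ)) / 2 : ℕ) : ZMod d)) ν) =
      if (ν : ℕ) = i.2 then
        (if i.1 = b + (((l + m - i.2) / 2 : ℕ) : ZMod d) then 1 else 0) else 0 := by
    intro ν
    refine (finrank_hom_interval i _ (hν ν)).trans ?_
    by_cases h : (ν : ℕ) = i.2
    · simp [h]
    · rw [if_neg h, if_neg]
      omega
  rw [Finset.sum_congr rfl fun ν _ => h1 ν, Finset.sum_coe_sort (fusionLabels d l m) fun ν =>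
    if ν = (i.2 : ℕ) then
      (if i.1 = b + (((l + m - i.2) / 2 : ℕ) : ZMod d) then 1 else 0) else 0,
    Finset.sum_ite_eq', ← ite_and, fusionMult]

/-- Each simple object occurs at most once in the fusion sum, so agreement of dimensions with
`fusionMult` suffices. -/
theorem isDirectSum_fusion (hd : 2 ≤ d) {b : ZMod d} {l m : ℕ} {X : HMF d}
    (hX : IsSummand (simples d) X)
    (h : ∀ i, Module.finrank ℂ (simples d i ⟶ X) = fusionMult d b l m i) :
    IsDirectSum X fun ν : fusionLabels d l m =>
      hatPc d (b + (((l + m - (ν : ℕ)) / 2 : ℕ) : ZMod d)) ν := by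
  have hν : ∀ ν : fusionLabels d l m, (ν : ℕ) < d - 1 := fun ν => by
    have := le_of_mem_fusionLabels ν.2
    omega
  refine isSchurFamily_simples.isDirectSum hX (fun ν : fusionLabels d l m =>
    ((b + (((l + m - (ν : ℕ)) / 2 : ℕ) : ZMod d)), (⟨ν, hν ν⟩ : Fin (d - 1)))) fun i => ?_
  rw [h, fusionMult]
  split_ifs with hi
  · symm
    rw [Nat.card_eq_one_iff_unique]
    refine ⟨⟨fun x y => ?_⟩, ⟨⟨⟨i.2, hi.1⟩, Prod.ext hi.2.symm rfl⟩⟩⟩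
    have hx := congrArg (fun i : ZMod d × Fin (d - 1) => (i.2 : ℕ)) (x.2.trans y.2.symm)
    exact Subtype.ext (Subtype.ext hx)
  · symm
    rw [Nat.card_eq_zero]
    refine .inl ⟨fun x => hi ?_⟩
    obtain ⟨x, rfl⟩ := x
    exact ⟨x.2, rfl⟩

theorem isSummand_tensor_two (m n : ZMod d) {l : ℕ} (hl : l + 2 ≤ d) :
    IsSummand (simples d) ((hatPc d m l).tensor (hatPc d n 1)) :=
  .of_isDirectSum (isDirectSum_tensor_two m n hl) fun k => by
    fin_cases k
    · exact isSummand_hatP_interval _ hl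
    · exact isSummand_hatP_interval _ (by omega)

theorem finrank_hom_tensor_two (m n : ZMod d) {l : ℕ} (hl : l + 2 ≤ d)
    (i : ZMod d × Fin (d - 1)) :
    Module.finrank ℂ (simples d i ⟶ (hatPc d m l).tensor (hatPc d n 1)) =
      (if i.1 = m + n ∧ (i.2 : ℕ) + 1 = l + 2 then 1 else 0) +
      (if i.1 = m + n + 1 ∧ (i.2 : ℕ) + 1 = l then 1 else 0) := by
  refine (finrank_hom_of_isDirectSum' (isDirectSum_tensor_two m n hl) (fun k => ?_) i).trans ?_
  · fin_cases k
    · exact isSummand_hatP_interval _ hl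
    · exact isSummand_hatP_interval _ (by omega)
  · rw [Fin.sum_univ_two]
    exact congrArg₂ (· + ·) (finrank_hom_interval i _ hl) (finrank_hom_interval i _ (by omega))

/-- The multiplicities of the triple product with `P̂_{0:1}`: the recursion on labels with the
offsets in `ℤ/d` kept track of. The terms `+ 0` come from the label `0` of that factor. -/
theorem sum_fusionLabels (b : ZMod d) (l m : ℕ) (i : ZMod d × Fin (d - 1)) (hm : 1 ≤ m)
    (hl : l ≤ d - 2)
    (hm' : m + 1 ≤ d - 2) :
    ∑ ν : fusionLabels d l m,
      ((if i.1 = b + (((l + m - (ν : ℕ)) / 2 : ℕ) : ZMod d) + 0 ∧ (i.2 : ℕ) + 1 = ν + 2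
          then 1 else 0) +
        (if i.1 = b + (((l + m - (ν : ℕ)) / 2 : ℕ) : ZMod d) + 0 + 1 ∧ (i.2 : ℕ) + 1 = ν
          then 1 else 0)) =
      fusionMult d b l (m + 1) i + fusionMult d (b + 1) l (m - 1) i := by
  set t : ℕ := i.2.val with ht
  have htd : t ≤ d - 2 := by omega
  -- The common offset of all contributions to label `t`: `ν = t - 1` has offset `e` already, while
  -- `ν = t + 1` has offset `e - 1` and gains `1` on going down.
  set e : ℕ := (l + (m + 1) - t) / 2 with he
  have h1 : ∀ ν ∈ fusionLabels d l m,
      ((if i.1 = b + (((l + m - ν) / 2 : ℕ) : ZMod d) + 0 ∧ t + 1 = ν + 2 then 1 else 0) +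
        (if i.1 = b + (((l + m - ν) / 2 : ℕ) : ZMod d) + 0 + 1 ∧ t + 1 = ν then 1 else 0)) =
      if i.1 = b + (e : ZMod d) then
        ((if ν = t - 1 then (if 1 ≤ t then 1 else 0) else 0) + if ν = t + 1 then 1 else 0)
      else 0 := by
    intro ν hν
    rw [mem_fusionLabels] at hν
    by_cases ha : t + 1 = ν + 2
    · have h1 : (l + m - ν) / 2 = e := by omega
      have h2 : ¬ t + 1 = ν := by omega
      have h3 : ν = t - 1 := by omega
      have h4 : ¬ ν = t + 1 := by omega
      have h5 : 1 ≤ t := by omega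
      rw [if_neg (not_and_of_not_right _ h2), if_pos h3, if_pos h5, if_neg h4, h1, add_zero,
          add_zero, add_zero]
      exact if_congr (and_iff_left ha) rfl rfl
    · rw [if_neg (not_and_of_not_right _ ha), zero_add]
      by_cases hb : t + 1 = ν
      · have h1 : e = (l + m - ν) / 2 + 1 := by omega
        have h2 : ¬ ν = t - 1 := by omega
        rw [if_neg h2, if_pos hb.symm, zero_add, add_zero, h1, Nat.cast_add, Nat.cast_one,
          ← add_assoc]
        exact if_congr (and_iff_left hb) rfl rfl
      · have h1 : (if ν = t - 1 then (if 1 ≤ t then 1 else 0) else 0) = 0 := by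
          split_ifs
          · omega
          · rfl
          · rfl
        rw [if_neg (not_and_of_not_right _ hb), h1, if_neg (Ne.symm hb), add_zero, ite_self]
  rw [Finset.sum_coe_sort (fusionLabels d l m) fun ν =>
      ((if i.1 = b + (((l + m - ν) / 2 : ℕ) : ZMod d) + 0 ∧ t + 1 = ν + 2 then 1 else 0) +
        (if i.1 = b + (((l + m - ν) / 2 : ℕ) : ZMod d) + 0 + 1 ∧ t + 1 = ν then 1 else 0)),
    Finset.sum_congr rfl h1, fusionMult, fusionMult, ← ht, ← he]
  have h2 : (t ∈ fusionLabels d l (m - 1) ∧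
      i.1 = b + 1 + (((l + (m - 1) - t) / 2 : ℕ) : ZMod d)) ↔
      (t ∈ fusionLabels d l (m - 1) ∧ i.1 = b + (e : ZMod d)) := by
    refine and_congr_right fun h => ?_
    rw [mem_fusionLabels] at h
    have : e = (l + (m - 1) - t) / 2 + 1 := by omega
    rw [this, Nat.cast_add, Nat.cast_one, add_assoc, add_comm (1 : ZMod d)]
  rw [if_congr h2 rfl rfl]
  by_cases h : i.1 = b + (e : ZMod d)
  · simp only [h, if_true, and_true]
    rw [Finset.sum_add_distrib, Finset.sum_ite_eq', Finset.sum_ite_eq']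
    exact fusionLabels_recursion hm hl hm' htd
  · simp only [h, if_false, and_false, Finset.sum_const_zero, add_zero]

/-- Induction in steps of two. The triple product with `P̂_{0:1}` is computed once from the left
bracketing, by the case `μ + 1`, and once from the right one, where the wanted product appears
beside the known case `μ` at `n + 1`. -/
theorem fusion (hd : 2 ≤ d) (m n : ZMod d) (l μ : ℕ) (hl : l ≤ d - 2) (hμ : μ ≤ d - 2) :
    IsDirectSum ((hatPc d m l).tensor (hatPc d n μ)) fun ν : fusionLabels d l μ =>
      hatPc d (m + n + (((l + μ - (ν : ℕ)) / 2 : ℕ) : ZMod d)) ν := by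
  induction μ using Nat.twoStepInduction generalizing m n l with
  | zero =>
    have h0 := isDirectSum_tensor_singleton m n (k := l + 1) (by omega)
    have hs := isSummand_hatP_interval (m + n) (k := l + 1) (by omega)
    refine isDirectSum_fusion hd (.of_isDirectSum h0 fun _ => hs) fun i => ?_
    refine (finrank_hom_of_isDirectSum' h0 (fun _ => hs) i).trans ?_
    rw [Fintype.sum_unique, finrank_hom_interval _ _ (by omega), fusionMult]
    refine if_congr ?_ rfl rfl
    rw [mem_fusionLabels, and_comm]
    constructor
    · rintro ⟨h1, h2⟩
      refine ⟨by omega, ?_⟩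
      rw [h2, ← Nat.succ.inj h1, add_zero, Nat.sub_self, Nat.zero_div, Nat.cast_zero, add_zero]
    · rintro ⟨h1, h2⟩
      have h3 : (i.2 : ℕ) = l := by omega
      refine ⟨by omega, ?_⟩
      rw [h2, h3, add_zero, Nat.sub_self, Nat.zero_div, Nat.cast_zero, add_zero]
  | one =>
    refine isDirectSum_fusion hd (isSummand_tensor_two m n (by omega)) fun i => ?_
    rw [finrank_hom_tensor_two m n (by omega), fusionMult]
    have ht : (i.2 : ℕ) ≤ d - 2 := by omega
    by_cases h1 : (i.2 : ℕ) + 1 = l + 2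
    · have h2 : ¬ (i.2 : ℕ) + 1 = l := by omega
      have h3 : (l + 1 - (i.2 : ℕ)) / 2 = 0 := by omega
      rw [if_neg (not_and_of_not_right _ h2), add_zero, h3, Nat.cast_zero, add_zero]
      exact if_congr ⟨fun h => ⟨mem_fusionLabels.mpr (by omega), h.1⟩, fun h => ⟨h.2, h1⟩⟩ rfl rfl
    · rw [if_neg (not_and_of_not_right _ h1), zero_add]
      refine if_congr ⟨fun h => ?_, fun h => ?_⟩ rfl rfl
      · have h3 : (l + 1 - (i.2 : ℕ)) / 2 = 1 := by omega
        rw [h3, Nat.cast_one]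
        exact ⟨mem_fusionLabels.mpr (by omega), h.1⟩
      · have h4 := mem_fusionLabels.mp h.1
        have h3 : (l + 1 - (i.2 : ℕ)) / 2 = 1 := by omega
        rw [h3, Nat.cast_one] at h
        exact ⟨h.2, by omega⟩
  | more μ ih ih' =>
    have h1 := (ih' m n l hl (by omega))
    have hX1 := h1.tensor_right (hatPc d 0 1)
    have hX2 := ((isDirectSum_tensor_two n 0 (l := μ + 1) (by omega)).tensor_left
      (hatPc d m l)).of_iso (HMF.associator (hatPc d m l) (hatPc d n (μ + 1)) (hatPc d 0 1))
    have hν : ∀ ν : fusionLabels d l (μ + 1), (ν : ℕ) + 2 ≤ d := fun ν => by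
      have := le_of_mem_fusionLabels ν.2
      omega
    have hsX : IsSummand (simples d)
        (((hatPc d m l).tensor (hatPc d n (μ + 1))).tensor (hatPc d 0 1)) :=
      .of_isDirectSum hX1 fun ν => isSummand_tensor_two _ _ (hν ν)
    simp only [add_zero] at hX2
    have h0 := ih m (n + 1) l hl (by omega)
    -- The wanted product is a retract of the triple product, so it is a sum of simples before its
    -- multiplicities are known.
    have hs : IsSummand (simples d) ((hatPc d m l).tensor (hatPc d n (μ + 2))) := by
      obtain ⟨i, p, hip, -⟩ := hX2.exists_maps
      exact hsX.of_retract (p 0) (i 0) (hip 0)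
    refine isDirectSum_fusion hd hs fun i => ?_
    have e1 := finrank_hom_of_isDirectSum' hX1 (fun ν => isSummand_tensor_two _ _ (hν ν)) i
    rw [Finset.sum_congr rfl fun ν _ => finrank_hom_tensor_two _ _ (hν ν) i,
      sum_fusionLabels _ _ _ _ (by omega) hl hμ] at e1
    have e2 := finrank_hom_of_isDirectSum' hX2 (fun k => by
      fin_cases k
      · exact hs
      · exact isSummand_of_fusion hd h0) i
    have e3 := finrank_hom_fusion hd h0 i
    rw [Fin.sum_univ_two, e1] at e2
    have e4 : fusionMult d (m + n) l (μ + 1 + 1) i + fusionMult d (m + n + 1) l μ i =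
      Module.finrank ℂ (simples d i ⟶ (hatPc d m l).tensor (hatPc d n (μ + 2))) +
      Module.finrank ℂ (simples d i ⟶ (hatPc d m l).tensor (hatPc d (n + 1) μ)) := e2
    rw [e3, ← add_assoc m n 1] at e4
    -- Multiplicities are natural numbers, so the known summand can be subtracted.
    exact (Nat.add_right_cancel e4).symm

end Fusion

end BiMF

end

/-! ### The theorem for `P_d^gr` -/

theorem mainTheorem4 (d : ℕ) [NeZero d] (hd : 2 ≤ d) :
    -- the category is semisimple
    BiMF.IsSemisimple (BiMF.Pgr d) ∧
    -- its simple objects are, up to isomorphism, the pairwise non-isomorphic `P̂_{a:l}`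
    (∀ X : BiMF.Pgr d, CategoryTheory.Simple X ↔
      ∃ (a : ZMod d) (l : ℕ), l ≤ d - 2 ∧ Nonempty (X.obj ≅ BiMF.hatPc d a l)) ∧
    (∀ (a b : ZMod d) (l m : ℕ), l ≤ d - 2 → m ≤ d - 2 →
      Nonempty (BiMF.hatPc d a l ≅ BiMF.hatPc d b m) → a = b ∧ l = m) ∧
    -- each `P̂_{a:l}` lies in the category
    (∀ (a : ZMod d) (l : ℕ), l ≤ d - 2 → BiMF.isPgr d (BiMF.hatPc d a l)) ∧
    -- the category is closed under tensor products
    (∀ M N : BiMF.HMF d, BiMF.isPgr d M → BiMF.isPgr d N → BiMF.isPgr d (M.tensor N)) ∧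
    -- the decomposition of tensor products
    (∀ (m n : ZMod d) (l μ : ℕ), l ≤ d - 2 → μ ≤ d - 2 →
      BiMF.IsDirectSum ((BiMF.hatPc d m l).tensor (BiMF.hatPc d n μ))
        fun ν : BiMF.fusionLabels d l μ =>
          BiMF.hatPc d (m + n + (((l + μ - (ν : ℕ)) / 2 : ℕ) : ZMod d)) ν) := by
  have hlt : ∀ l : ℕ, l ≤ d - 2 → l < d - 1 := fun l hl => by omega
  have hPgr := BiMF.isPgr_iff (d := d) hd
  refine ⟨BiMF.isSchurFamily_simples.isSemisimple (BiMF.isPgr d) hPgr, fun X => ?_,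
    fun a b l m hl hm => ?_, fun a l hl => ?_, fun M N hM hN => ?_, BiMF.fusion hd⟩
  · rw [BiMF.isSchurFamily_simples.simple_iff (BiMF.isPgr d) hPgr X]
    constructor
    · rintro ⟨i, h⟩
      exact ⟨i.1, i.2, by omega, h⟩
    · rintro ⟨a, l, hl, h⟩
      exact ⟨(a, ⟨l, hlt l hl⟩), h⟩
  · rintro ⟨e⟩
    -- An isomorphism out of an object with nonzero identity is a nonzero morphism, so Schur's lemma
    -- identifies the labels.
    have h := BiMF.isSchurFamily_simples.eq_of_ne_zero (S := BiMF.simples d)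
      (i := (a, ⟨l, hlt l hl⟩)) (j := (b, ⟨m, hlt m hm⟩)) e.hom fun h0 =>
        BiMF.isSchurFamily_simples.id_ne_zero (S := BiMF.simples d) (a, ⟨l, hlt l hl⟩)
          (e.hom_inv_id.symm.trans
            ((congrArg (fun f => CategoryTheory.CategoryStruct.comp f e.inv) h0).trans
              CategoryTheory.Limits.zero_comp))
    exact ⟨congrArg Prod.fst h, congrArg (fun i => (i.2 : ℕ)) h⟩
  · exact (hPgr _).mpr (BiMF.IsSummand.self (BiMF.simples d) (a, ⟨l, hlt l hl⟩))
  · obtain ⟨p, a, l, hl, hM⟩ := hM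
    obtain ⟨q, b, m, hm, hN⟩ := hN
    refine (hPgr _).mpr (BiMF.IsSummand.of_isDirectSum (hM.tensor_right N) fun i =>
      BiMF.IsSummand.of_isDirectSum (hN.tensor_left (BiMF.hatPc d (a i) (l i))) fun j =>
        BiMF.isSummand_of_fusion hd (BiMF.fusion hd (a i) (b j) (l i) (m j) (hl i) (hm j)))
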